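/- **Setting.** A closed 4-colored graph (vacuum graph) $\mathcal G$ is a finite bipartite graph, multiple lines allowed, whose lines carry colors in $\{1,2,3,4\}$ and in which each node meets exactly one line of each color; it has $\mathcal N$ nodes. Its dual simplicial complex has one tetrahedron per node; for every line of color $c$, the triangles of color $c$ of its two end nodes (each opposite to the vertex of color $c$) are glued, identifying vertices of equal colors. Let $E(\ell\ell')$ be the set of edges of this complex joining a vertex of color $\ell$ to one of color $\ell'$; they correspond to the connected components of the subgraph of $\mathcal G$ formed by all nodes and the lines of the two colors other than $\ell,\ell'$. The three jackets $J$ are the pairs $(\sigma,\sigma^{-1})$ of cyclic permutations $\sigma=(\ell_1\,\ell_2\,\ell_3\,\ell_4)$ of the colors. The jacket is the surface made of one rectangle per tetrahedron, with one edge per triangle and one vertex per element of $E(\ell_1\ell_2)\cup E(\ell_2\ell_3)\cup E(\ell_3\ell_4)\cup E(\ell_4\ell_1)$; its genus $g_J$ is defined by $2-2g_J=\chi_J$, where $\chi_J$ is its Euler characteristic. Let $dg$ be the Haar probability measure of $\mathrm{SU}(2)$ and, for $\alpha>0$, $K_\alpha(g)=\sum_{j\in\mathbb N/2}(2j+1)e^{-\alpha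 j(j+1)}\chi_j(g)$ the heat kernel, $\chi_j$ being the character of spin $j$. In the colored Boulatov model in vertex variables, each line $f$ of color $c$ carries three elements $G^f_v\in\mathrm{SU}(2)$ ($v\ne c$), integrated with $\delta(G^f_iG^f_jG^f_k)\,dG^f_i\,dG^f_j\,dG^f_k$, where $(i,j,k)=(2,3,4),(4,3,1),(4,1,2),(1,3,2)$ for $c=1,2,3,4$. Writing $G^c_v$ for the element of label $v$ of the line of color $c$ at a given node, each node (white or black) contributes the factor $$\frac{K_\alpha(G^2_1G^3_1G^4_1)\,K_\alpha(G^4_2G^3_2G^1_2)\,K_\alpha(G^4_3G^1_3G^2_3)\,K_\alpha(G^1_4G^3_4G^2_4)}{K_\alpha(1)} .$$ The integral of the product of all node factors, multiplied by $K_\alpha(1)^{-\mathcal N/2}$ (the rescaling $\lambda\to\lambda/\sqrt{K_\alpha(1)}$ of the coupling constant), is the rescaled amplitude $\mathcal A^\alpha_{\mathcal G}$. The divergence degree is $$\gamma_{\mathcal G}=\inf\Big\{\gamma\in\mathbb R\ :\ \lim_{\alpha\to0^+}K_\alpha(1)^{-\gamma}\mathcal A^\alpha_{\mathcal G}\ \text{exists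 and is finite}\Big\}\in[-\infty,+\infty].$$ A connected graph is of leading order if $\gamma_{\mathcal G'}\le\gamma_{\mathcal G}$ for every connected closed 4-colored graph $\mathcal G'$. A graph is melonic if it is obtained from the supermelon (the connected graph with two nodes) by finitely many insertions of elementary melons on lines: a line of color $c$ is cut, its two ends are joined by lines of color $c$ to two new nodes, and the new nodes are joined to each other by three lines of the other colors. **Proposition.** For every connected closed 4-colored graph $\mathcal G$: 1. $\gamma_{\mathcal G}\le 2-g_J$ for every jacket $J$ of $\mathcal G$; 2. $\gamma_{\mathcal G}\le 2-\sup_J g_J$; 3. this strengthens the standard jacket bound: $2-\sup_J g_J\le 2-\frac13\sum_J g_J$, so that in particular $\gamma_{\mathcal G}\le 2-\frac13\sum_J g_J$; 4. if $\mathcal G$ is of leading order, then its dual simplicial complex is homeomorphic to the 3-sphere, and $\mathcal G$ is melonic. -/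

import Mathlib

open MeasureTheory Filter Topology

/-! ## The group SU(2), its normalised Haar measure and its heat kernel -/

/-- The group `SU(2)`. -/
abbrev SU2 : Type := Matrix.specialUnitaryGroup (Fin 2) ℂ

namespace SU2

instance instTopGroup : IsTopologicalGroup SU2 where
  continuous_mul := by
    refine Continuous.subtype_mk ?_ _
    exact (continuous_subtype_val.comp continuous_fst).mul
      (continuous_subtype_val.comp continuous_snd)
  continuous_inv := by
    refine Continuous.subtype_mk ?_ _
    exact continuous_subtype_val.star

theorem isCompact_carrier :
    IsCompact ((Matrix.specialUnitaryGroup (Fin 2) ℂ : Submonoid _) :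
      Set (Matrix (Fin 2) (Fin 2) ℂ)) := by
  have hK : IsCompact (Set.pi Set.univ fun _ : Fin 2 => Set.pi Set.univ fun _ : Fin 2 =>
      Metric.closedBall (0 : ℂ) 1) :=
    isCompact_univ_pi fun _ => isCompact_univ_pi fun _ => isCompact_closedBall _ _
  refine IsCompact.of_isClosed_subset hK ?_ ?_
  · have h1 : IsClosed {A : Matrix (Fin 2) (Fin 2) ℂ | A * star A = 1} :=
      isClosed_eq (continuous_id.mul continuous_star) continuous_const
    have h2 : IsClosed {A : Matrix (Fin 2) (Fin 2) ℂ | A.det = 1} :=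
      isClosed_eq (Continuous.matrix_det continuous_id) continuous_const
    convert h1.inter h2 using 1
    ext A
    simp [Matrix.mem_specialUnitaryGroup_iff, Matrix.mem_unitaryGroup_iff]
  · intro A hA i _ j _
    have hU := (Matrix.mem_specialUnitaryGroup_iff.1 hA).1
    simpa using entry_norm_bound_of_unitary hU i j

instance instCompact : CompactSpace SU2 :=
  isCompact_iff_compactSpace.1 isCompact_carrier

noncomputable instance instMeasurableSpace : MeasurableSpace SU2 := borel SU2

instance instBorelSpace : BorelSpace SU2 := ⟨rfl⟩

/-- `SU(2)` carries its Haar probability measure. -/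
noncomputable instance instMeasureSpace : MeasureSpace SU2 :=
  ⟨Measure.haarMeasure ⊤⟩

/-- The character `χ_j` of the irreducible representation of spin `j = n / 2`. If `g` has
eigenvalues `exp (± i ψ)`, then `tr g / 2 = cos ψ` and
`χ_j(g) = U_n (cos ψ) = sin ((2 j + 1) ψ) / sin ψ`. -/
noncomputable def character (n : ℕ) (g : SU2) : ℝ :=
  (Polynomial.Chebyshev.U ℝ (n : ℤ)).eval ((g : Matrix (Fin 2) (Fin 2) ℂ).trace.re / 2)

/-- The heat kernel `K_α(g) = ∑_j (2 j + 1) exp (- α j (j + 1)) χ_j(g)`,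
where `j = n / 2` runs over the half-integers. -/
noncomputable def heatKernel (α : ℝ) (g : SU2) : ℝ :=
  ∑' n : ℕ, (2 * ((n : ℝ) / 2) + 1) *
    Real.exp (-α * (((n : ℝ) / 2) * ((n : ℝ) / 2 + 1))) * character n g

end SU2

/-! ## Closed 4-colored graphs -/

/-- A closed `4`-colored graph with white nodes `W` and black nodes `B`: a bipartite graph,
possibly with multiple lines, in which every node meets exactly one line of each color. The lines
of color `c` therefore form a bijection from `W` to `B`, and `(c, w)` labels the line of
color `c` incident to the white node `w`, whose black end is `line c w`.

In the dual simplicial complex nodes are tetrahedra and lines of color `c` are triangles; the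
vertex of color `c` of a tetrahedron is the one opposite to its triangle of color `c`. -/
structure ColoredGraph (W B : Type*) where
  /-- The lines of a given color. -/
  line : Fin 4 → (W ≃ B)

namespace ColoredGraph

universe u v

section Combinatorics

variable {W : Type u} {B : Type v}

/-- Adjacency of nodes through the lines whose color lies in `S`. -/
def sub (G : ColoredGraph W B) (S : Set (Fin 4)) : SimpleGraph (W ⊕ B) :=
  SimpleGraph.fromRel fun x y => ∃ c ∈ S, ∃ w, x = Sum.inl w ∧ y = Sum.inr (G.line c w)

/-- The graph is connected (in particular it has at least one node). -/
def Connected (G : ColoredGraph W B) : Prop := (G.sub Set.univ).Connected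

/-- The number `|E(ℓ ℓ')|` of edges of color `(ℓ ℓ')` (joining a vertex of color `ℓ` and a
vertex of color `ℓ'`) of the dual simplicial complex. They correspond to the faces of the graph,
i.e. the cycles of lines, with colors different from `ℓ` and `ℓ'`. -/
noncomputable def numEdges (G : ColoredGraph W B) (ℓ ℓ' : Fin 4) : ℕ :=
  Nat.card (G.sub ({ℓ, ℓ'}ᶜ)).ConnectedComponent

theorem numEdges_comm (G : ColoredGraph W B) (ℓ ℓ' : Fin 4) :
    G.numEdges ℓ ℓ' = G.numEdges ℓ' ℓ := by
  unfold numEdges; rw [Set.pair_comm]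

end Combinatorics

/-! ### Jackets -/

/-- A cyclic permutation `σ = (ℓ₁ ℓ₂ ℓ₃ ℓ₄)` of the whole set of colors. -/
abbrev ColorCycle : Type :=
  {σ : Equiv.Perm (Fin 4) // σ.IsCycle ∧ σ.support = Finset.univ}

/-- Two cycles are identified if they are equal or inverse to each other. -/
instance jacketSetoid : Setoid ColorCycle where
  r σ τ := τ.1 = σ.1 ∨ τ.1 = σ.1⁻¹
  iseqv :=
    { refl := fun _ => Or.inl rfl
      symm := by
        rintro σ τ (h | h)
        · exact Or.inl h.symm
        · exact Or.inr (by rw [h, inv_inv])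
      trans := by
        rintro σ τ ρ (h | h) (h' | h')
        · exact Or.inl (h'.trans h)
        · exact Or.inr (by rw [h', h])
        · exact Or.inr (h'.trans h)
        · exact Or.inl (by rw [h', h, inv_inv]) }

/-- The three jackets, labeled by the pairs `(σ, σ⁻¹)` of cyclic permutations of the colors. -/
abbrev Jacket : Type := Quotient jacketSetoid

noncomputable instance jacketFintype : Fintype Jacket := Fintype.ofFinite Jacket

section Genus

variable {W : Type u} {B : Type v} [Fintype W] [Fintype B]

/-- The number of vertices of the jacket surface: the middle points of the edges of color
`(ℓ σ(ℓ))` of the simplicial complex, i.e. of colors `(ℓ₁ ℓ₂), (ℓ₂ ℓ₃), (ℓ₃ ℓ₄), (ℓ₄ ℓ₁)`. -/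
noncomputable def jacketVertices (G : ColoredGraph W B) (J : Jacket) : ℕ :=
  Quotient.lift (fun σ : ColorCycle => ∑ ℓ, G.numEdges ℓ (σ.1 ℓ))
    (by
      rintro ⟨σ, hσ⟩ ⟨τ, hτ⟩ (h | h)
      · simp only at h
        subst h; rfl
      · simp only at h
        subst h
        change ∑ ℓ, G.numEdges ℓ (σ ℓ) = ∑ ℓ, G.numEdges ℓ (σ⁻¹ ℓ)
        rw [← Equiv.sum_comp σ (fun ℓ => G.numEdges ℓ (σ⁻¹ ℓ))]
        refine Finset.sum_congr rfl fun ℓ _ => ?_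
        rw [show σ⁻¹ (σ ℓ) = ℓ from σ.symm_apply_apply ℓ, numEdges_comm]) J

/-- The Euler characteristic of the jacket: its faces are one rectangle per tetrahedron
(node of the graph), and its edges are one per triangle (line of the graph). -/
noncomputable def jacketEuler (G : ColoredGraph W B) (J : Jacket) : ℤ :=
  (G.jacketVertices J : ℤ) - Fintype.card (Fin 4 × W) + Fintype.card (W ⊕ B)

/-- The genus `g_J` of the jacket (a closed orientable surface, connected if the graph is):
`2 - 2 g_J = χ_J`. -/
noncomputable def genus (G : ColoredGraph W B) (J : Jacket) : ℝ :=
  (2 - (G.jacketEuler J : ℝ)) / 2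

end Genus

/-! ### Regularised Feynman amplitudes of the colored Boulatov model, in vertex variables -/

/-- The cyclic order of the vertices in the triangle of color `c`, which is also the cyclic order
of the triangles around the vertex of color `c` of a tetrahedron:
`1 : (2 3 4)`, `2 : (4 3 1)`, `3 : (4 1 2)`, `4 : (1 3 2)` (here with colors `0, 1, 2, 3`). -/
def cyc : Fin 4 → Fin 3 → Fin 4 :=
  ![![1, 2, 3], ![3, 2, 0], ![3, 0, 1], ![0, 2, 1]]

/-- The three group elements `G^c_v`, `v ≠ c`, carried by a line of color `c`, subject to the
constraint `G^c_i G^c_j G^c_k = 1` with `(i, j, k) = cyc c`. The constraint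
`δ(G^c_i G^c_j G^c_k)` in the covariance is integrated out by solving for `G^c_k`, so that
`∫ dG_i dG_j dG_k δ(G_i G_j G_k) f` is the integral over `p = (G_i, G_j)` with respect to the
product of the Haar measures. The value at `v = c` is never used. -/
noncomputable def strand (c : Fin 4) (p : SU2 × SU2) (v : Fin 4) : SU2 :=
  if v = cyc c 0 then p.1
  else if v = cyc c 1 then p.2
  else if v = cyc c 2 then (p.1 * p.2)⁻¹
  else 1

/-- The regularised interaction kernel of a node whose line of color `c` carries the elements
`Γ c v`:
`K_α(G²₁ G³₁ G⁴₁) K_α(G⁴₂ G³₂ G¹₂) K_α(G⁴₃ G¹₃ G²₃) K_α(G¹₄ G³₄ G²₄) / K_α(1)`. -/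
noncomputable def nodeKernel (α : ℝ) (Γ : Fin 4 → Fin 4 → SU2) : ℝ :=
  (∏ v : Fin 4, SU2.heatKernel α (Γ (cyc v 0) v * Γ (cyc v 1) v * Γ (cyc v 2) v)) /
    SU2.heatKernel α 1

section Amplitude

variable {W : Type u} {B : Type v} [Fintype W] [Fintype B]

/-- The regularised amplitude `A_G^α`: one kernel for each white and each black node (the
kernels of the two conjugate interactions coincide), and one covariance for each line, which
identifies the variables of the line at its two ends. -/
noncomputable def amplitude (G : ColoredGraph W B) (α : ℝ) : ℝ :=
  ∫ X : Fin 4 × W → SU2 × SU2,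
    (∏ w : W, nodeKernel α fun c => strand c (X (c, w))) *
    ∏ b : B, nodeKernel α fun c => strand c (X (c, (G.line c).symm b))

/-- The amplitude after the rescaling `λ → λ / √K_α(1)` of the coupling constant, which brings a
factor `1 / √K_α(1)` for each node. -/
noncomputable def rescaledAmplitude (G : ColoredGraph W B) (α : ℝ) : ℝ :=
  (1 / √(SU2.heatKernel α 1)) ^ Fintype.card (W ⊕ B) * G.amplitude α

/-- The divergence degree
`γ_G = inf {γ ∈ ℝ | lim_{α → 0⁺} K_α(1)^(-γ) A_G^α < +∞}` of the rescaled amplitude. The infimum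
is taken in the extended reals: it is `⊤` if there is no such `γ`. -/
noncomputable def divergenceDegree (G : ColoredGraph W B) : EReal :=
  sInf ((fun γ : ℝ => (γ : EReal)) '' {γ : ℝ | ∃ L : ℝ,
    Tendsto (fun α : ℝ => SU2.heatKernel α 1 ^ (-γ) * G.rescaledAmplitude α) (𝓝[>] 0) (𝓝 L)})

/-- A connected graph is of leading order if no connected graph is more divergent. -/
def IsLeadingOrder (G : ColoredGraph W B) : Prop :=
  G.Connected ∧ ∀ (n : ℕ) (G' : ColoredGraph (Fin n) (Fin n)),
    G'.Connected → G'.divergenceDegree ≤ G.divergenceDegree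

end Amplitude

/-! ### Melonic and spherical graphs -/

open Classical in
/-- Insertion of an elementary melon on the line of color `c` at the white node `w`: this line is
cut, and its white end `w` is joined by a line of color `c` to a new black node, its black end by
a line of color `c` to a new white node; the two new nodes `none` are joined to each other by
three lines of the remaining colors. -/
noncomputable def insertMelon {W : Type u} {B : Type v} (G : ColoredGraph W B) (c : Fin 4)
    (w : W) : ColoredGraph (Option W) (Option B) where
  line c' :=
    if c' = c then (Equiv.swap none (some w)).trans (Equiv.optionCongr (G.line c'))
    else Equiv.optionCongr (G.line c')

/-- The same graph with renamed nodes. -/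
def relabel {W W' : Type u} {B B' : Type v} (G : ColoredGraph W B) (e : W ≃ W') (f : B ≃ B') :
    ColoredGraph W' B' where
  line c := (e.symm.trans (G.line c)).trans f

/-- Melonic graphs: obtained from the supermelon (the graph with two nodes) by successive
insertions of elementary melons on lines. -/
inductive IsMelonic : {W : Type u} → {B : Type v} → ColoredGraph W B → Prop
  | supermelon {W : Type u} {B : Type v} [Unique W] [Unique B] (G : ColoredGraph W B) :
      IsMelonic G
  | insertMelon {W : Type u} {B : Type v} (G : ColoredGraph W B) (c : Fin 4) (w : W) :
      IsMelonic G → IsMelonic (G.insertMelon c w)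
  | relabel {W W' : Type u} {B B' : Type v} (G : ColoredGraph W B) (e : W ≃ W') (f : B ≃ B') :
      IsMelonic G → IsMelonic (G.relabel e f)

section Topology

variable {W : Type u} {B : Type v}

/-- The gluing of the tetrahedra of the dual complex: for each line of color `c`, the triangles
of color `c` (opposite to the vertex `c`, i.e. where the barycentric coordinate `c` vanishes) of
its two end nodes are identified, vertices of equal colors being identified. -/
inductive Glue (G : ColoredGraph W B) :
    (Σ _ : W ⊕ B, stdSimplex ℝ (Fin 4)) → (Σ _ : W ⊕ B, stdSimplex ℝ (Fin 4)) → Prop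
  | glue (c : Fin 4) (w : W) (x : stdSimplex ℝ (Fin 4)) (hx : x.1 c = 0) :
      Glue G ⟨Sum.inl w, x⟩ ⟨Sum.inr (G.line c w), x⟩

/-- The topological space underlying the simplicial complex dual to the graph: one tetrahedron
for each node, glued along triangles, with the quotient topology. -/
abbrev Realization (G : ColoredGraph W B) : Type (max u v) := Quot G.Glue

/-- The dual complex is a `3`-sphere. -/
def IsSpherical (G : ColoredGraph W B) : Prop :=
  Nonempty (G.Realization ≃ₜ Metric.sphere (0 : EuclideanSpace ℝ (Fin 4)) 1)

end Topology

end ColoredGraph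

/-! Write `n` for the number of white nodes, so that there are `2 n` nodes, and `K` for `K_α(1)`.
The heart of the proof is a bound for each of the three ways to split the colors into pairs `{a,
b}`, `{c, d}`: the rescaled amplitude is `O(K ^ (|E(ab)| + |E(cd)| + 1 - n))`
(`Frame.exists_abs_rescaledAmplitude_le`). The vertices of a jacket are the edges belonging to two
of these three splittings, and `2 - g_J` is the mean of the two exponents. The smaller exponent is
at most the mean, which gives the jacket bound; the bounds with the supremum and with the average of
the genera follow formally.

The exponent is obtained from two properties of the heat kernel: `|K_α| ≤ K`, and `∫ |K_α|` is
bounded uniformly for `0 < α ≤ 1`. In coordinates adapted to the splitting, the four kernels at a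
node form two corners, one on the edge `ab` and one on the edge `cd` of the tetrahedron; the two
kernels of a corner share a word in variables `s`, and the other variables `h` enter as parameters.
One kernel per node is bounded by `K`, which leaves a corner with one kernel and a corner with two.
One single-kernel corner in each element of `E(ab)` and `E(cd)` is also bounded by `K`. The
remaining corner words can be integrated one after the other, each through a variable that the
others no longer contain (`lintegral_prod_forest`). What is left is one convolution square per node,
evaluated at a word in `h`; since the graph is connected, one more bound by `K` makes these words
independent too.

For the leading order, an explicit region near the unit shows that the supermelon has degree at
least `2`. A leading graph therefore satisfies `|E(ab)| + |E(cd)| ≥ n + 1` for all three splittings,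
hence has at least `3 n + 3` faces. This is the largest number possible for a connected graph, and
it forces an elementary melon (`faceCount_le`, by removing pairs of nodes joined by several lines).
Removing a melon preserves extremality, so the graph is melonic. Finally, the supermelon is dual to
two tetrahedra bent into hemispheres, and inserting a melon only slices one tetrahedron into three
slabs, so melonic graphs are dual to spheres. -/

namespace ColoredGraph

universe u v

/-! ### Connected components of the subgraphs of given colors -/

section Components

variable {W : Type u} {B : Type v}

theorem sub_adj_line (G : ColoredGraph W B) {S : Set (Fin 4)} {c : Fin 4} (hc : c ∈ S) (w : W) :
    (G.sub S).Adj (Sum.inl w) (Sum.inr (G.line c w)) := by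
  rw [sub, SimpleGraph.fromRel_adj]
  exact ⟨by simp, Or.inl ⟨c, hc, w, rfl, rfl⟩⟩

/-- The connected component of a node in the subgraph of the lines with colors in `S`. -/
abbrev comp (G : ColoredGraph W B) (S : Set (Fin 4)) (x : W ⊕ B) :
    (G.sub S).ConnectedComponent :=
  (G.sub S).connectedComponentMk x

/-- The number of connected components of the subgraph of the lines with colors in `S`. -/
noncomputable def numComp (G : ColoredGraph W B) (S : Set (Fin 4)) : ℕ :=
  Nat.card (G.sub S).ConnectedComponent

theorem comp_line (G : ColoredGraph W B) {S : Set (Fin 4)} {c : Fin 4} (hc : c ∈ S) (w : W) :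
    G.comp S (Sum.inl w) = G.comp S (Sum.inr (G.line c w)) :=
  SimpleGraph.ConnectedComponent.sound (G.sub_adj_line hc w).reachable

theorem comp_symm (G : ColoredGraph W B) {S : Set (Fin 4)} {c : Fin 4} (hc : c ∈ S) (b : B) :
    G.comp S (Sum.inl ((G.line c).symm b)) = G.comp S (Sum.inr b) := by
  simpa using G.comp_line hc ((G.line c).symm b)

theorem eq_of_reachable (G : ColoredGraph W B) {S : Set (Fin 4)} {α : Sort*} (r : W ⊕ B → α)
    (h : ∀ c ∈ S, ∀ w, r (Sum.inl w) = r (Sum.inr (G.line c w))) {x y : W ⊕ B}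
    (hxy : (G.sub S).Reachable x y) : r x = r y := by
  obtain ⟨p⟩ := hxy
  induction p with
  | nil => rfl
  | cons hadj _ ih =>
    refine Eq.trans ?_ ih
    rw [sub, SimpleGraph.fromRel_adj] at hadj
    obtain ⟨-, ⟨c, hc, w, rfl, rfl⟩ | ⟨c, hc, w, rfl, rfl⟩⟩ := hadj
    · exact h c hc w
    · exact (h c hc w).symm

theorem eq_of_comp_eq (G : ColoredGraph W B) {S : Set (Fin 4)} {α : Sort*} (r : W ⊕ B → α)
    (h : ∀ c ∈ S, ∀ w, r (Sum.inl w) = r (Sum.inr (G.line c w))) {x y : W ⊕ B}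
    (hxy : G.comp S x = G.comp S y) : r x = r y :=
  G.eq_of_reachable r h (SimpleGraph.ConnectedComponent.exact hxy)

/-- The universal property of components; the comparisons of component counts below use maps built
from it. -/
theorem exists_comp_lift (G : ColoredGraph W B) {S : Set (Fin 4)} {α : Sort*} (r : W ⊕ B → α)
    (h : ∀ c ∈ S, ∀ w, r (Sum.inl w) = r (Sum.inr (G.line c w))) :
    ∃ f : (G.sub S).ConnectedComponent → α, ∀ x, f (G.comp S x) = r x :=
  ⟨fun κ => Quot.lift r (fun _ _ hxy => G.eq_of_reachable r h hxy) κ, fun _ => rfl⟩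

theorem exists_rep (G : ColoredGraph W B) {S : Set (Fin 4)} (κ : (G.sub S).ConnectedComponent) :
    ∃ x, G.comp S x = κ := κ.exists_rep

theorem exists_white_rep (G : ColoredGraph W B) {S : Set (Fin 4)} {c : Fin 4} (hc : c ∈ S)
    (κ : (G.sub S).ConnectedComponent) : ∃ w, G.comp S (Sum.inl w) = κ := by
  obtain ⟨x | x, rfl⟩ := G.exists_rep κ
  · exact ⟨x, rfl⟩
  · exact ⟨_, G.comp_symm hc x⟩

theorem exists_black_rep (G : ColoredGraph W B) {S : Set (Fin 4)} {c : Fin 4} (hc : c ∈ S)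
    (κ : (G.sub S).ConnectedComponent) : ∃ b, G.comp S (Sum.inr b) = κ := by
  obtain ⟨x | x, rfl⟩ := G.exists_rep κ
  · exact ⟨_, (G.comp_line hc x).symm⟩
  · exact ⟨x, rfl⟩

theorem comp_mono (G : ColoredGraph W B) {S T : Set (Fin 4)} (hST : S ⊆ T) {x y : W ⊕ B}
    (h : G.comp S x = G.comp S y) : G.comp T x = G.comp T y :=
  G.eq_of_comp_eq (G.comp T) (fun _ hc w => G.comp_line (hST hc) w) h

/-- A cycle of lines of two colors stays connected when one of its lines is removed. -/
theorem eq_of_cut_line [Finite W] (G : ColoredGraph W B) {k l : Fin 4} {α : Sort*}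
    (r : W ⊕ B → α) (a : W) (hl : ∀ w, r (Sum.inl w) = r (Sum.inr (G.line l w)))
    (hk : ∀ w, w ≠ a → r (Sum.inl w) = r (Sum.inr (G.line k w))) :
    r (Sum.inl a) = r (Sum.inr (G.line k a)) := by
  let π : Equiv.Perm W := (G.line k).trans (G.line l).symm
  have hπ : ∀ w, r (Sum.inl (π w)) = r (Sum.inr (G.line k w)) := fun w => by
    rw [hl]; simp [π]
  by_contra hne
  -- Going round the cycle from the black end of the removed line, `r` keeps its value as long as
  -- `a` is not reached. Under `hne` it is never reached, which contradicts the finite order of `π`.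
  have key : ∀ m : ℕ, r (Sum.inl ((π ^ (m + 1)) a)) = r (Sum.inr (G.line k a)) := by
    intro m
    induction m with
    | zero => simpa using hπ a
    | succ m ih =>
      have : (π ^ (m + 1)) a ≠ a := fun h => hne (by rw [h] at ih; exact ih)
      rw [pow_succ', Equiv.Perm.mul_apply, hπ, ← hk _ this, ih]
  have h := key (orderOf π - 1)
  rw [Nat.sub_add_cancel (isOfFinOrder_of_finite π).orderOf_pos, pow_orderOf_eq_one] at h
  exact hne h

/-- Each cycle contains a chosen white node and the next white node along it; these differ because
no two nodes are joined by both an `i`-line and a `j`-line. -/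
theorem two_mul_numComp_le [Finite W] (G : ColoredGraph W B) {i j : Fin 4}
    (h : ∀ w, G.line i w ≠ G.line j w) : 2 * G.numComp {i, j} ≤ Nat.card W := by
  choose f hf using G.exists_white_rep (S := {i, j}) (Set.mem_insert i {j})
  have hg : ∀ κ, G.comp {i, j} (Sum.inl ((G.line j).symm (G.line i (f κ)))) = κ := fun κ => by
    rw [G.comp_symm (by simp), ← G.comp_line (by simp), hf]
  have hinj : Function.Injective
      (Sum.elim f fun κ => (G.line j).symm (G.line i (f κ))) := by
    have hne : ∀ κ κ', f κ ≠ (G.line j).symm (G.line i (f κ')) := by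
      intro κ κ' he
      have : κ = κ' := by rw [← hf κ, he, hg]
      subst this
      exact h (f κ) (by conv_rhs => rw [he]
                        simp)
    rintro (κ | κ) (κ' | κ') he
    · simp only [Sum.elim_inl] at he
      rw [← hf κ, he, hf]
    · exact absurd he (hne _ _)
    · exact absurd he.symm (hne _ _)
    · simp only [Sum.elim_inr] at he
      rw [← hg κ, he, hg]
  have hle := Nat.card_le_card_of_injective _ hinj
  have : Finite (G.sub {i, j}).ConnectedComponent :=
    Finite.of_injective f fun κ κ' he => by rw [← hf κ, he, hf]
  rw [Nat.card_sum] at hle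
  unfold numComp
  omega

end Components

/-! ### Removing a pair of adjacent nodes -/

section Contract

variable {W : Type u} {B : Type v}

open Classical in
/-- The graph obtained by removing the white node `v` and the black node `b`, and joining for every
color the two lines that are cut open. -/
noncomputable def contract (G : ColoredGraph W B) (v : W) (b : B) :
    ColoredGraph {w // w ≠ v} {x // x ≠ b} where
  line c := ((G.line c).trans (Equiv.swap b (G.line c v))).subtypeEquiv fun w => by
    simp only [Equiv.trans_apply]
    rw [not_iff_not, Equiv.swap_apply_eq_iff, Equiv.swap_apply_left]
    simp

theorem contract_line_of_ne (G : ColoredGraph W B) {v : W} {b : B} {c : Fin 4} {w : {w // w ≠ v}}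
    (h : G.line c w ≠ b) : (((G.contract v b).line c w : {x // x ≠ b}) : B) = G.line c w := by
  classical
  simp only [contract, Equiv.subtypeEquiv_apply, Equiv.trans_apply]
  exact Equiv.swap_apply_of_ne_of_ne h fun h' => w.2 ((G.line c).injective h')

theorem contract_line_of_eq (G : ColoredGraph W B) {v : W} {b : B} {c : Fin 4} {w : {w // w ≠ v}}
    (h : G.line c w = b) : (((G.contract v b).line c w : {x // x ≠ b}) : B) = G.line c v := by
  simp only [contract, Equiv.subtypeEquiv_apply, Equiv.trans_apply, h, Equiv.swap_apply_left]

/-- The inclusion of the remaining nodes. -/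
def incl (v : W) (b : B) : {w // w ≠ v} ⊕ {x // x ≠ b} → W ⊕ B :=
  Sum.map Subtype.val Subtype.val

variable (G : ColoredGraph W B) {v : W} {b : B} {S : Set (Fin 4)}

theorem contract_respects {α : Sort*} (r : W ⊕ B → α)
    (h : ∀ c ∈ S, ∀ w, w ≠ v → G.line c w ≠ b → r (Sum.inl w) = r (Sum.inr (G.line c w)))
    (h' : ∀ c ∈ S, ∀ w, w ≠ v → G.line c w = b → r (Sum.inl w) = r (Sum.inr (G.line c v)))
    (c : Fin 4) (hc : c ∈ S) (w : {w // w ≠ v}) :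
    r (incl v b (Sum.inl w)) = r (incl v b (Sum.inr ((G.contract v b).line c w))) := by
  by_cases hw : G.line c w = b
  · simp only [incl, Sum.map_inl, Sum.map_inr, G.contract_line_of_eq hw]
    exact h' c hc w w.2 hw
  · simp only [incl, Sum.map_inl, Sum.map_inr, G.contract_line_of_ne hw]
    exact h c hc w w.2 hw

/-- A spliced line of the contraction is replaced in `G` by its two halves, ending at `b` and at
`v`; these are connected once `v` and `b` are. -/
theorem exists_contract_up
    (hv : ∀ c ∈ S, G.line c v ≠ b → G.comp S (Sum.inl v) = G.comp S (Sum.inr b)) :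
    ∃ f : ((G.contract v b).sub S).ConnectedComponent → (G.sub S).ConnectedComponent,
      ∀ x, f ((G.contract v b).comp S x) = G.comp S (incl v b x) := by
  refine (G.contract v b).exists_comp_lift (fun x => G.comp S (incl v b x)) fun c hc w =>
    G.contract_respects (G.comp S) (fun c hc w _ _ => G.comp_line hc w) ?_ c hc w
  intro c hc w hw hwb
  have hcv : G.line c v ≠ b := fun h => hw ((G.line c).injective (hwb.trans h.symm))
  rw [G.comp_line hc w, hwb, ← hv c hc hcv, G.comp_line hc v]

/-- Reinserting `v` and `b` can only merge the components that contain spliced lines, so a map `m`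
descends as soon as it takes one value `P` on them. The choice of `m` (identity, `some`, or an
identification of two components) adapts this to each count. -/
theorem exists_contract_down {α : Sort*}
    (m : ((G.contract v b).sub S).ConnectedComponent → α) (P : α)
    (hP : ∀ c ∈ S, ∀ h : G.line c v ≠ b,
      m ((G.contract v b).comp S (Sum.inr ⟨G.line c v, h⟩)) = P) :
    ∃ f : (G.sub S).ConnectedComponent → α,
      (∀ x, f (G.comp S (incl v b x)) = m ((G.contract v b).comp S x)) ∧
      f (G.comp S (Sum.inl v)) = P ∧ f (G.comp S (Sum.inr b)) = P := by
  classical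
  let r : W ⊕ B → α := Sum.elim
    (fun w => if h : w = v then P else m ((G.contract v b).comp S (Sum.inl ⟨w, h⟩)))
    (fun x => if h : x = b then P else m ((G.contract v b).comp S (Sum.inr ⟨x, h⟩)))
  obtain ⟨f, hf⟩ := G.exists_comp_lift (S := S) r (by
    intro c hc w
    by_cases hw : w = v
    · subst hw
      by_cases hb : G.line c w = b
      · simp [r, hb]
      · simp [r, hb, hP c hc hb]
    · by_cases hb : G.line c w = b
      · have hcv : G.line c v ≠ b := fun h => hw ((G.line c).injective (hb.trans h.symm))
        simp only [r, Sum.elim_inl, Sum.elim_inr, hw, hb, dif_pos, dif_neg, not_false_iff]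
        rw [← hP c hc hcv, (G.contract v b).comp_line hc]
        congr 3
        exact Subtype.ext (G.contract_line_of_eq (w := ⟨w, hw⟩) hb)
      · simp only [r, Sum.elim_inl, Sum.elim_inr, hw, hb, dif_neg, not_false_iff]
        rw [(G.contract v b).comp_line hc]
        congr 3
        exact Subtype.ext (G.contract_line_of_ne (w := ⟨w, hw⟩) hb))
  refine ⟨f, ?_, ?_, ?_⟩
  · rintro (w | x)
    · rw [hf]; simp [r, incl, w.2]
    · rw [hf]; simp [r, incl, x.2]
  · rw [hf]; simp [r]
  · rw [hf]; simp [r]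

theorem exists_incl_or (κ : (G.sub S).ConnectedComponent) :
    (∃ x, G.comp S (incl v b x) = κ) ∨ κ = G.comp S (Sum.inl v) ∨ κ = G.comp S (Sum.inr b) := by
  obtain ⟨w | x, rfl⟩ := G.exists_rep κ
  · by_cases h : w = v
    · exact Or.inr (Or.inl (by rw [h]))
    · exact Or.inl ⟨Sum.inl ⟨w, h⟩, rfl⟩
  · by_cases h : x = b
    · exact Or.inr (Or.inr (by rw [h]))
    · exact Or.inl ⟨Sum.inr ⟨x, h⟩, rfl⟩

theorem exists_incl {c : Fin 4} (hc : c ∈ S) (hcv : G.line c v ≠ b)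
    (κ : (G.sub S).ConnectedComponent) : ∃ x, G.comp S (incl v b x) = κ := by
  rcases G.exists_incl_or (v := v) (b := b) κ with h | rfl | rfl
  · exact h
  · exact ⟨Sum.inr ⟨_, hcv⟩, (G.comp_line hc v).symm⟩
  · refine ⟨Sum.inl ⟨(G.line c).symm b, fun h => hcv (by rw [← h]; simp)⟩, ?_⟩
    exact G.comp_symm hc b

theorem numComp_contract_eq {k : Fin 4} (hk : k ∈ S) (hkv : G.line k v ≠ b)
    (hvb : G.comp S (Sum.inl v) = G.comp S (Sum.inr b))
    (hP : ∀ c ∈ S, ∀ h : G.line c v ≠ b,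
      (G.contract v b).comp S (Sum.inr ⟨G.line c v, h⟩) =
        (G.contract v b).comp S (Sum.inr ⟨G.line k v, hkv⟩)) :
    (G.contract v b).numComp S = G.numComp S := by
  obtain ⟨f, hf⟩ := G.exists_contract_up (S := S) (v := v) (b := b) fun _ _ _ => hvb
  obtain ⟨g, hg, -, -⟩ := G.exists_contract_down id _ hP
  refine Nat.card_eq_of_bijective f ⟨Function.LeftInverse.injective (g := g) ?_, ?_⟩
  · intro κ
    obtain ⟨x, rfl⟩ := (G.contract v b).exists_rep κ
    rw [hf, hg]; rfl
  · intro κ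
    obtain ⟨x, rfl⟩ := G.exists_incl hk hkv κ
    exact ⟨_, hf x⟩

/-- Here `{v, b}` is a component by itself, and it is the only one that disappears. -/
theorem numComp_eq_contract_add_one [Finite W] [Finite B]
    {c : Fin 4} (hc : c ∈ S) (hS : ∀ c ∈ S, G.line c v = b) :
    G.numComp S = (G.contract v b).numComp S + 1 := by
  obtain ⟨f, hf⟩ := G.exists_contract_up (S := S) (v := v) (b := b) fun c hc h => absurd (hS c hc) h
  obtain ⟨g, hg, hgv, hgb⟩ := G.exists_contract_down (S := S) (v := v) (b := b)
    (some : _ → Option ((G.contract v b).sub S).ConnectedComponent) none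
    fun c hc h => absurd (hS c hc) h
  have hvb : G.comp S (Sum.inl v) = G.comp S (Sum.inr b) := by rw [G.comp_line hc, hS c hc]
  have hfin : Finite ((G.contract v b).sub S).ConnectedComponent := Quot.finite _
  rw [numComp, numComp, ← Finite.card_option]
  refine Nat.card_eq_of_bijective g ⟨Function.LeftInverse.injective
    (g := fun o => o.elim (G.comp S (Sum.inl v)) f) ?_, ?_⟩
  · intro κ
    rcases G.exists_incl_or (v := v) (b := b) κ with ⟨x, rfl⟩ | rfl | rfl
    · rw [hg]; exact hf x
    · rw [hgv]; rfl
    · rw [hgb]; exact hvb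
  · rintro (_ | κ)
    · exact ⟨_, hgv⟩
    · obtain ⟨x, rfl⟩ := (G.contract v b).exists_rep κ
      exact ⟨_, hg x⟩

/-- The contraction can at worst merge the component of `v` with that of `b`; all components of `G`
except that of `v` are recovered from their images, through `t`. -/
theorem numComp_le_contract_add_one [Finite W] [Finite B] {k : Fin 4} (hk : k ∈ S)
    (hkv : G.line k v ≠ b)
    (hP : ∀ c ∈ S, ∀ h : G.line c v ≠ b,
      (G.contract v b).comp S (Sum.inr ⟨G.line c v, h⟩) =
        (G.contract v b).comp S (Sum.inr ⟨G.line k v, hkv⟩)) :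
    G.numComp S ≤ (G.contract v b).numComp S + 1 := by
  classical
  obtain ⟨g, hg, hgv, hgb⟩ := G.exists_contract_down id _ hP
  let s : W ⊕ B → (G.sub S).ConnectedComponent := fun x =>
    if G.comp S x = G.comp S (Sum.inl v) then G.comp S (Sum.inr b) else G.comp S x
  obtain ⟨t, ht⟩ := (G.contract v b).exists_comp_lift (S := S) (fun x => s (incl v b x)) (by
    intro c hc w
    refine G.contract_respects s ?_ ?_ c hc w
    · intro c hc w _ _
      simp only [s, G.comp_line hc w]
    · intro c hc w _ hwb
      simp only [s, G.comp_line hc w, hwb, ← G.comp_line hc v, if_true]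
      split_ifs <;> rfl)
  have hfin : Finite ((G.contract v b).sub S).ConnectedComponent := Quot.finite _
  rw [numComp, numComp, ← Finite.card_option]
  refine Nat.card_le_card_of_injective
    (fun κ => if κ = G.comp S (Sum.inl v) then none else some (g κ)) ?_
  intro κ κ' h
  by_cases h1 : κ = G.comp S (Sum.inl v) <;> by_cases h2 : κ' = G.comp S (Sum.inl v)
  · rw [h1, h2]
  · simp [h1, h2] at h
  · simp [h1, h2] at h
  · simp only [h1, h2, if_false, Option.some.injEq] at h
    obtain ⟨x, rfl⟩ := G.exists_incl hk hkv κ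
    obtain ⟨y, rfl⟩ := G.exists_incl hk hkv κ'
    rw [hg, hg] at h
    have := congrArg t h
    simp only [id, ht, s, h1, h2, if_false] at this
    exact this

/-- The component containing `v` and `b` is split by the contraction, so the surjection back to the
components of `G` is not injective. -/
theorem numComp_lt_contract [Finite W] [Finite B] {k l : Fin 4} (hk : k ∈ S) (hl : l ∈ S)
    (hkv : G.line k v ≠ b) (hlv : G.line l v ≠ b)
    (hvb : G.comp S (Sum.inl v) = G.comp S (Sum.inr b))
    (hne : (G.contract v b).comp S (Sum.inr ⟨G.line k v, hkv⟩) ≠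
        (G.contract v b).comp S (Sum.inr ⟨G.line l v, hlv⟩)) :
    G.numComp S < (G.contract v b).numComp S := by
  obtain ⟨f, hf⟩ := G.exists_contract_up (S := S) (v := v) (b := b) fun _ _ _ => hvb
  have hfin : Finite ((G.contract v b).sub S).ConnectedComponent := Quot.finite _
  have hsurj : Function.Surjective f := fun κ => by
    obtain ⟨x, rfl⟩ := G.exists_incl hk hkv κ
    exact ⟨_, hf x⟩
  refine lt_of_le_of_ne (Nat.card_le_card_of_surjective f hsurj) fun h => ?_
  have := (Function.Surjective.bijective_of_nat_card_le hsurj h.ge).1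
  refine hne (this ?_)
  rw [hf, hf]
  exact (G.comp_line hk v).symm.trans (G.comp_line hl v)

/-- Only two lines are spliced, so the component of `v` and `b` breaks into at most two pieces. -/
theorem contract_numComp_le_add_one [Finite W] [Finite B] {k l : Fin 4}
    (hkv : G.line k v ≠ b) (hlv : G.line l v ≠ b)
    (hvb : G.comp S (Sum.inl v) = G.comp S (Sum.inr b))
    (hS : ∀ c ∈ S, G.line c v ≠ b → c = k ∨ c = l) :
    (G.contract v b).numComp S ≤ G.numComp S + 1 := by
  classical
  obtain ⟨f, hf⟩ := G.exists_contract_up (S := S) (v := v) (b := b) fun _ _ _ => hvb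
  let Q := (G.contract v b).comp S (Sum.inr ⟨G.line l v, hlv⟩)
  let P := (G.contract v b).comp S (Sum.inr ⟨G.line k v, hkv⟩)
  obtain ⟨g, hg, -, -⟩ := G.exists_contract_down (S := S) (v := v) (b := b)
    (fun κ => if κ = Q then P else κ) P (by
      intro c hc h
      rcases hS c hc h with rfl | rfl
      · simp only [P]; split_ifs <;> rfl
      · simp [Q])
  have hfin : Finite (G.sub S).ConnectedComponent := Quot.finite _
  rw [numComp, numComp, ← Finite.card_option]
  refine Nat.card_le_card_of_injective (fun κ => if κ = Q then none else some (f κ)) ?_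
  intro κ κ' h
  by_cases h1 : κ = Q <;> by_cases h2 : κ' = Q
  · rw [h1, h2]
  · simp [h1, h2] at h
  · simp [h1, h2] at h
  · simp only [h1, h2, if_false, Option.some.injEq] at h
    obtain ⟨x, rfl⟩ := (G.contract v b).exists_rep κ
    obtain ⟨y, rfl⟩ := (G.contract v b).exists_rep κ'
    rw [hf, hf] at h
    have := congrArg g h
    simpa only [hg, h1, h2, if_false] using this

end Contract

end ColoredGraph

namespace ColoredGraph

universe u v

/-! ### Graphs with the maximal number of faces -/

section Faces

variable {W : Type u} {B : Type v}

/-- The number of faces, i.e. of bicolored cycles. -/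
noncomputable def faceCount (G : ColoredGraph W B) : ℕ :=
  G.numComp {0, 1} + G.numComp {2, 3} + G.numComp {0, 2} + G.numComp {1, 3} +
    G.numComp {0, 3} + G.numComp {1, 2}

theorem faceCount_eq (G : ColoredGraph W B) {i j k l : Fin 4} (hij : i ≠ j) (hik : i ≠ k)
    (hil : i ≠ l) (hjk : j ≠ k) (hjl : j ≠ l) (hkl : k ≠ l) :
    G.faceCount = G.numComp {i, j} + G.numComp {k, l} + G.numComp {i, k} + G.numComp {j, l} +
      G.numComp {i, l} + G.numComp {j, k} := by
  have h : ∀ a b : Fin 4, G.numComp {a, b} = G.numComp {b, a} := fun a b => by rw [Set.pair_comm]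
  have h1 := h 1 0
  have h2 := h 2 0
  have h3 := h 3 0
  have h4 := h 2 1
  have h5 := h 3 1
  have h6 := h 3 2
  unfold faceCount
  clear h
  fin_cases i <;> fin_cases j <;> first | exact absurd rfl hij | skip
  all_goals fin_cases k <;> first | exact absurd rfl hik | exact absurd rfl hjk | skip
  all_goals fin_cases l <;>
    first | exact absurd rfl hil | exact absurd rfl hjl | exact absurd rfl hkl | skip
  all_goals simp only [Fin.mk_zero, Fin.mk_one, Fin.isValue, Fin.reduceFinMk] at *
  all_goals omega

/-- The lines of all colors but `k` at the white node `v` have the same black end, and the line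
of color `k` has another one. -/
def IsMelonAt (G : ColoredGraph W B) (v : W) (k : Fin 4) : Prop :=
  (∀ c c', c ≠ k → c' ≠ k → G.line c v = G.line c' v) ∧ ∀ c, c ≠ k → G.line c v ≠ G.line k v

/-- Either all the lines at `w` have the same ends, or there is an elementary melon in the component
of `w` which does not have the line of color `c` at `w` among its three inner lines. -/
def HasMelonAvoiding (G : ColoredGraph W B) (c : Fin 4) (w : W) : Prop :=
  (∀ c', G.line c' w = G.line c w) ∨ ∃ v k,
    G.comp Set.univ (Sum.inl v) = G.comp Set.univ (Sum.inl w) ∧ G.IsMelonAt v k ∧ (v = w → c = k)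

variable (G : ColoredGraph W B) {v : W} {b : B}

/-- A component of `G` that does not contain `v` is untouched by the contraction. -/
theorem HasMelonAvoiding.of_contract {i : Fin 4} (hi : G.line i v = b) {c : Fin 4}
    {w : {w // w ≠ v}}
    (hw : G.comp Set.univ (Sum.inl w.1) ≠ G.comp Set.univ (Sum.inl v))
    (h : (G.contract v b).HasMelonAvoiding c w) : G.HasMelonAvoiding c w := by
  have hvb : G.comp Set.univ (Sum.inl v) = G.comp Set.univ (Sum.inr b) := by
    rw [← hi]; exact G.comp_line (Set.mem_univ _) _
  have key : ∀ x : {w // w ≠ v},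
      G.comp Set.univ (Sum.inl x.1) = G.comp Set.univ (Sum.inl w.1) → ∀ c,
      (((G.contract v b).line c x : {x // x ≠ b}) : B) = G.line c x := by
    intro x hx c
    refine G.contract_line_of_ne fun hxb => hw ?_
    rw [← hx, hvb, ← hxb]
    exact G.comp_line (Set.mem_univ _) _
  obtain ⟨f, hf⟩ := G.exists_contract_up (S := Set.univ) (v := v) (b := b) fun _ _ _ => hvb
  rcases h with h | ⟨x, k, hx, hm, ha⟩
  · refine Or.inl fun c' => ?_
    rw [← key w rfl, ← key w rfl, h c']
  · have hx' : G.comp Set.univ (Sum.inl x.1) = G.comp Set.univ (Sum.inl w.1) := by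
      have := congrArg f hx
      rwa [hf, hf] at this
    refine Or.inr ⟨x, k, hx', ⟨fun c c' hc hc' => ?_, fun c hc => ?_⟩,
      fun h => ha (Subtype.ext h)⟩
    · rw [← key x hx', ← key x hx', hm.1 c c' hc hc']
    · rw [← key x hx', ← key x hx']
      exact fun h => hm.2 c hc (Subtype.ext h)

/-- The only spliced line in this component is the `k`-line at `a`, and this is why the melons are
required to avoid a prescribed line: a melon of the contraction which does not have the spliced line
among its inner lines is already a melon of `G`. If the component is a supermelon, cutting its
`k`-line leaves three parallel lines, that is a melon at `a`. -/
theorem exists_isMelonAt_of_contract {k : Fin 4} (hk : G.line k v ≠ b) {a : {w // w ≠ v}}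
    (ha : G.line k a = b)
    (hne : ∀ c, c ≠ k → ∀ w : {w // w ≠ v}, G.line c w = b →
      (G.contract v b).comp Set.univ (Sum.inl w) ≠ (G.contract v b).comp Set.univ (Sum.inl a))
    (h : (G.contract v b).HasMelonAvoiding k a) :
    ∃ (x : {w // w ≠ v}) (k' : Fin 4),
      (G.contract v b).comp Set.univ (Sum.inl x) = (G.contract v b).comp Set.univ (Sum.inl a) ∧
      G.IsMelonAt x k' := by
  have key : ∀ x : {w // w ≠ v}, (G.contract v b).comp Set.univ (Sum.inl x) =
      (G.contract v b).comp Set.univ (Sum.inl a) → ∀ c, c ≠ k →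
      (((G.contract v b).line c x : {x // x ≠ b}) : B) = G.line c x := fun x hx c hc =>
    G.contract_line_of_ne fun hxb => hne c hc x hxb hx
  have key' : ∀ c, c ≠ k → G.line c a ≠ G.line k a := fun c hc h =>
    hne c hc a (h.trans ha) rfl
  rcases h with h | ⟨x, k', hx, hm, hax⟩
  · refine ⟨a, k, rfl, fun c c' hc hc' => ?_, key'⟩
    rw [← key a rfl c hc, ← key a rfl c' hc', h c, h c']
  · refine ⟨x, k', hx, ?_⟩
    by_cases hxa : x = a
    · obtain rfl := hax hxa
      subst hxa
      refine ⟨fun c c' hc hc' => ?_, key'⟩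
      rw [← key x rfl c hc, ← key x rfl c' hc', hm.1 c c' hc hc']
    · have key2 : ∀ c, (((G.contract v b).line c x : {x // x ≠ b}) : B) = G.line c x := by
        intro c
        by_cases hc : c = k
        · subst hc
          exact G.contract_line_of_ne fun h =>
            hxa (Subtype.ext ((G.line c).injective (h.trans ha.symm)))
        · exact key x hx c hc
      refine ⟨fun c c' hc hc' => ?_, fun c hc => ?_⟩
      · rw [← key2, ← key2, hm.1 c c' hc hc']
      · rw [← key2, ← key2]
        exact fun h => hm.2 c hc (Subtype.ext h)

theorem card_contract [Finite W] {n : ℕ} (hW : Nat.card W = n) :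
    Nat.card {w // w ≠ v} = n - 1 := by
  classical
  have := Fintype.ofFinite W
  rw [Nat.card_eq_fintype_card, Fintype.card_subtype_compl, ← Nat.card_eq_fintype_card, hW]
  simp

end Faces

theorem exists_others {i j : Fin 4} (hij : i ≠ j) : ∃ k l : Fin 4,
    i ≠ k ∧ i ≠ l ∧ j ≠ k ∧ j ≠ l ∧ k ≠ l ∧ ∀ c, c = i ∨ c = j ∨ c = k ∨ c = l := by
  revert i j; decide

/-- A `4`-colored graph with `2 n` nodes and `C` components has at most `3 n + 3 C` faces, and if it
has that many, then it has many elementary melons. -/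
theorem faceCount_le (n : ℕ) : ∀ (W : Type u) (B : Type v) [Finite W] [Finite B]
    (G : ColoredGraph W B), Nat.card W = n →
    G.faceCount ≤ 3 * n + 3 * G.numComp Set.univ ∧
      (G.faceCount = 3 * n + 3 * G.numComp Set.univ → ∀ c w, G.HasMelonAvoiding c w) := by
  induction n with
  | zero =>
    intro W B _ _ G hn
    have hW : IsEmpty W := (Finite.card_eq_zero_iff).1 hn
    have h : ∀ i j, i ≠ j → G.numComp {i, j} = 0 := fun i j _ => by
      have := G.two_mul_numComp_le (i := i) (j := j) fun w => isEmptyElim w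
      omega
    refine ⟨?_, fun _ _ w => isEmptyElim w⟩
    simp [faceCount, h]
  | succ n ih =>
    intro W B _ _ G hn
    by_cases hface : ∀ i j, i ≠ j → ∀ w, G.line i w ≠ G.line j w
    -- Without parallel lines every face has at least two white nodes, so each of the six pairs of
    -- colors has at most half as many faces as there are white nodes. Equality in the claim is then
    -- impossible, as there is a component.
    · have h : ∀ i j, i ≠ j → 2 * G.numComp {i, j} ≤ n + 1 := fun i j hij =>
        hn ▸ G.two_mul_numComp_le (hface i j hij)
      have h1 := h 0 1 (by decide)
      have h2 := h 0 2 (by decide)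
      have h3 := h 0 3 (by decide)
      have h4 := h 1 2 (by decide)
      have h5 := h 1 3 (by decide)
      have h6 := h 2 3 (by decide)
      have hle : G.faceCount ≤ 3 * (n + 1) := by unfold faceCount; omega
      refine ⟨by omega, fun heq c w => ?_⟩
      have : Finite (G.sub Set.univ).ConnectedComponent := Quot.finite _
      have : Nonempty (G.sub Set.univ).ConnectedComponent := ⟨G.comp _ (Sum.inl w)⟩
      have : 0 < G.numComp Set.univ := Nat.card_pos
      omega
    · push Not at hface
      obtain ⟨i, j, hij, v, hv⟩ := hface
      generalize hb : G.line i v = b at hv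
      replace hv := hv.symm
      obtain ⟨hle, hmel⟩ := ih _ _ (G.contract v b) (card_contract hn)
      have hvb : ∀ S : Set (Fin 4), i ∈ S ∨ j ∈ S →
          G.comp S (Sum.inl v) = G.comp S (Sum.inr b) := by
        rintro S (h | h)
        · rw [G.comp_line h, hb]
        · rw [G.comp_line h, hv]
      have hvbu := hvb Set.univ (Or.inl (Set.mem_univ _))
      -- the two cases where at least three lines join the two nodes
      have three : ∀ k l, i ≠ k → i ≠ l → j ≠ k → j ≠ l → k ≠ l →
          (∀ c, c = i ∨ c = j ∨ c = k ∨ c = l) → G.line l v = b →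
          G.faceCount ≤ 3 * (n + 1) + 3 * G.numComp Set.univ ∧
          (G.faceCount = 3 * (n + 1) + 3 * G.numComp Set.univ →
            ∀ c w, G.HasMelonAvoiding c w) := by
        intro k l hik hil hjk hjl hkl hall hlv
        rw [faceCount_eq _ hij hik hil hjk hjl hkl] at hle hmel ⊢
        have e1 := G.numComp_eq_contract_add_one (S := {i, j}) (v := v) (b := b)
          (c := i) (by simp) (by simp [hb, hv])
        have e2 := G.numComp_eq_contract_add_one (S := {i, l}) (v := v) (b := b)
          (c := i) (by simp) (by simp [hb, hlv])
        have e3 := G.numComp_eq_contract_add_one (S := {j, l}) (v := v) (b := b)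
          (c := j) (by simp) (by simp [hv, hlv])
        by_cases hkv : G.line k v = b
        · have hallb : ∀ c, G.line c v = b := fun c => by
            rcases hall c with rfl | rfl | rfl | rfl <;> assumption
          have e4 := G.numComp_eq_contract_add_one (S := {k, l}) (v := v) (b := b)
            (c := k) (by simp) (by simp [hkv, hlv])
          have e5 := G.numComp_eq_contract_add_one (S := {i, k}) (v := v) (b := b)
            (c := i) (by simp) (by simp [hb, hkv])
          have e6 := G.numComp_eq_contract_add_one (S := {j, k}) (v := v) (b := b)
            (c := j) (by simp) (by simp [hv, hkv])
          have e7 := G.numComp_eq_contract_add_one (S := Set.univ) (v := v) (b := b)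
            (c := i) (by simp) (fun c _ => hallb c)
          refine ⟨by omega, fun heq c w => ?_⟩
          by_cases hw : w = v
          · subst hw
            exact Or.inl fun c' => by rw [hallb, hallb]
          · refine HasMelonAvoiding.of_contract G hb (w := ⟨w, hw⟩) ?_ (hmel (by omega) _ _)
            obtain ⟨g, hg, hgv, -⟩ := G.exists_contract_down (S := Set.univ) (v := v) (b := b)
              (some : _ → Option ((G.contract v b).sub Set.univ).ConnectedComponent) none
              fun c _ h => absurd (hallb c) h
            intro h
            have h2 := (hg (Sum.inl ⟨w, hw⟩)).symm.trans (congrArg g h)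
            rw [hgv] at h2
            exact absurd h2 (by simp)
        · have hone : ∀ c, G.line c v ≠ b → c = k := fun c hc => by
            rcases hall c with rfl | rfl | rfl | rfl
            · exact absurd hb hc
            · exact absurd hv hc
            · rfl
            · exact absurd hlv hc
          have heqS : ∀ S : Set (Fin 4), k ∈ S → G.comp S (Sum.inl v) = G.comp S (Sum.inr b) →
              (G.contract v b).numComp S = G.numComp S := fun S hk hS =>
            G.numComp_contract_eq hk hkv hS fun c _ h => by
              obtain rfl := hone c h; rfl
          have e4 := heqS {k, l} (by simp) (by rw [G.comp_line (c := l) (by simp), hlv])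
          have e5 := heqS {i, k} (by simp) (hvb _ (by simp))
          have e6 := heqS {j, k} (by simp) (hvb _ (by simp))
          have e7 := heqS Set.univ (by simp) hvbu
          refine ⟨by omega, fun heq c w => ?_⟩
          replace hmel := hmel (by omega)
          have hm : G.IsMelonAt v k := by
            have : ∀ c, c ≠ k → G.line c v = b := fun c hc => by
              by_contra h; exact hc (hone c h)
            exact ⟨fun c c' hc hc' => by rw [this c hc, this c' hc'],
              fun c hc h => hkv (by rw [← h, this c hc])⟩
          by_cases hw : w = v
          · subst hw
            by_cases hck : c = k
            · exact Or.inr ⟨w, k, rfl, hm, fun _ => hck⟩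
            -- The prescribed line is an inner line of the melon at `w`, so another melon is needed:
            -- one of the contraction that avoids the spliced line.
            · have hav : (G.line k).symm b ≠ w := fun h => hkv (by rw [← h]; simp)
              obtain ⟨x, k', hx, hxm⟩ := G.exists_isMelonAt_of_contract hkv
                (a := ⟨(G.line k).symm b, hav⟩) (by simp) (by
                  intro c' hc' y hy
                  have : G.line c' w = b := by by_contra h; exact hc' (hone c' h)
                  exact absurd ((G.line c').injective (hy.trans this.symm)) y.2) (hmel _ _)
              obtain ⟨f, hf⟩ := G.exists_contract_up (S := Set.univ) (v := w) (b := b)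
                fun _ _ _ => hvbu
              have hx' := congrArg f hx
              rw [hf, hf] at hx'
              refine Or.inr ⟨x, k', hx'.trans ?_, hxm, fun h => absurd h x.2⟩
              rw [hvbu]
              exact G.comp_symm (Set.mem_univ _) _
          · by_cases hwv : G.comp Set.univ (Sum.inl w) = G.comp Set.univ (Sum.inl v)
            · exact Or.inr ⟨v, k, hwv.symm, hm, fun h => absurd h.symm hw⟩
            · exact HasMelonAvoiding.of_contract G hb (w := ⟨w, hw⟩) hwv (hmel _ _)
      obtain ⟨k, l, hik, hil, hjk, hjl, hkl, hall⟩ := exists_others hij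
      by_cases hlv : G.line l v = b
      · exact three k l hik hil hjk hjl hkl hall hlv
      by_cases hkv : G.line k v = b
      · exact three l k hil hik hjl hjk hkl.symm (fun c => by rcases hall c with h | h | h | h <;> simp [h]) hkv
      clear three
      rw [faceCount_eq _ hij hik hil hjk hjl hkl] at hle hmel ⊢
      have hkl' : ∀ c, G.line c v ≠ b → c = k ∨ c = l := fun c hc => by
        rcases hall c with rfl | rfl | rfl | rfl
        · exact absurd hb hc
        · exact absurd hv hc
        · exact Or.inl rfl
        · exact Or.inr rfl
      have e1 := G.numComp_eq_contract_add_one (S := {i, j}) (v := v) (b := b)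
          (c := i) (by simp) (by simp [hb, hv])
      have two : ∀ i k, G.line i v = b → ∀ h : G.line k v ≠ b,
          (G.contract v b).numComp {i, k} = G.numComp {i, k} := fun i k hi hk =>
        G.numComp_contract_eq (k := k) (by simp) hk
          (by rw [G.comp_line (c := i) (by simp), hi]) (by
            rintro c (rfl | rfl) h
            · exact absurd hi h
            · rfl)
      have e2 := two i k hb hkv
      have e3 := two j l hv hlv
      have e4 := two i l hb hlv
      have e5 := two j k hv hkv
      have e6 := G.contract_numComp_le_add_one (S := Set.univ) hkv hlv hvbu
        fun c _ h => hkl' c h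
      have huniv : (G.contract v b).comp Set.univ (Sum.inr ⟨G.line k v, hkv⟩) =
          (G.contract v b).comp Set.univ (Sum.inr ⟨G.line l v, hlv⟩) →
          (G.contract v b).numComp Set.univ = G.numComp Set.univ := fun h =>
        G.numComp_contract_eq (Set.mem_univ k) hkv hvbu fun c _ hc => by
          rcases hkl' c hc with rfl | rfl
          · rfl
          · exact h.symm
      by_cases hX : (G.contract v b).comp {k, l} (Sum.inr ⟨G.line k v, hkv⟩) =
          (G.contract v b).comp {k, l} (Sum.inr ⟨G.line l v, hlv⟩)
      -- The two spliced lines remain on one face: at most two faces are lost and the number of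
      -- components is unchanged, so equality is excluded.
      · have e7 := huniv ((G.contract v b).comp_mono (Set.subset_univ _) hX)
        have e8 := G.numComp_le_contract_add_one (S := {k, l}) (by simp) hkv (by
          rintro c (rfl | rfl) h
          · rfl
          · exact hX.symm)
        refine ⟨by omega, fun heq => by omega⟩
      -- The spliced lines lie on different `kl`-faces. Then `v` and `b` lie on one face of `G`:
      -- going round the face of the spliced `k`-line, with that line removed, leads in `G` from `v`
      -- to the other end `b` of the cut.
      · have hkl2 : G.comp {k, l} (Sum.inl v) = G.comp {k, l} (Sum.inr b) := by
          classical
          let r : {w // w ≠ v} ⊕ {x // x ≠ b} → Prop := fun x =>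
            (G.contract v b).comp {k, l} x =
              (G.contract v b).comp {k, l} (Sum.inr ⟨G.line k v, hkv⟩) ∧
            G.comp {k, l} (incl v b x) = G.comp {k, l} (Sum.inl v)
          have hav : (G.line k).symm b ≠ v := fun h => hkv (by rw [← h]; simp)
          have hlast : r (Sum.inl ⟨(G.line k).symm b, hav⟩) := by
            have hline : (G.contract v b).line k ⟨(G.line k).symm b, hav⟩ =
                ⟨G.line k v, hkv⟩ :=
              Subtype.ext (G.contract_line_of_eq (by simp))
            have hcut := (G.contract v b).eq_of_cut_line (k := k) (l := l) r
              ⟨(G.line k).symm b, hav⟩ ?_ ?_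
            · rw [hcut, hline]
              exact ⟨rfl, (G.comp_line (by simp) v).symm⟩
            · intro w
              simp only [r, (G.contract v b).comp_line (S := {k, l}) (c := l) (by simp) w]
              by_cases hw : G.line l w = b
              · have h1 : (G.contract v b).line l w = ⟨G.line l v, hlv⟩ :=
                  Subtype.ext (G.contract_line_of_eq hw)
                rw [h1, eq_iff_iff]
                exact ⟨fun h => absurd h.1.symm hX, fun h => absurd h.1.symm hX⟩
              · simp only [incl, Sum.map_inl, Sum.map_inr, G.contract_line_of_ne hw,
                  G.comp_line (S := {k, l}) (c := l) (by simp) w.1]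
            · intro w hwa
              simp only [r, (G.contract v b).comp_line (S := {k, l}) (c := k) (by simp) w]
              have hw : G.line k w ≠ b := fun h => hwa (Subtype.ext (by simp [← h]))
              simp only [incl, Sum.map_inl, Sum.map_inr, G.contract_line_of_ne hw,
                  G.comp_line (S := {k, l}) (c := k) (by simp) w.1]
          rw [← hlast.2]
          exact G.comp_symm (by simp) _
        have e8 := G.numComp_lt_contract (S := {k, l}) (k := k) (l := l) (by simp) (by simp)
          hkv hlv hkl2 hX
        -- The `ij`-face is lost and at least one `kl`-face is gained. Equality therefore forces the
        -- contraction to have one more component and to be extremal itself.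
        refine ⟨by omega, fun heq c w => ?_⟩
        have hne : (G.contract v b).comp Set.univ (Sum.inr ⟨G.line k v, hkv⟩) ≠
          (G.contract v b).comp Set.univ (Sum.inr ⟨G.line l v, hlv⟩) := fun h => by
          have := huniv h
          omega
        replace hmel := hmel (by omega)
        by_cases hwv : G.comp Set.univ (Sum.inl w) = G.comp Set.univ (Sum.inl v)
        swap
        · exact HasMelonAvoiding.of_contract G hb (w := ⟨w, fun h => hwv (by rw [h])⟩) hwv
            (hmel _ _)
        -- The contraction separates the spliced `k`-line from the spliced `l`-line. A melon is
        -- taken on a side that does not contain `w`; it avoids the prescribed line at `w`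
        -- automatically.
        have side : ∀ k l, (∀ c, G.line c v ≠ b → c = k ∨ c = l) →
            ∀ (hkv : G.line k v ≠ b) (hlv : G.line l v ≠ b),
            (G.contract v b).comp Set.univ (Sum.inr ⟨G.line k v, hkv⟩) ≠
              (G.contract v b).comp Set.univ (Sum.inr ⟨G.line l v, hlv⟩) →
            (∀ hw : w ≠ v, (G.contract v b).comp Set.univ (Sum.inl ⟨w, hw⟩) ≠
              (G.contract v b).comp Set.univ (Sum.inr ⟨G.line k v, hkv⟩)) →
            G.HasMelonAvoiding c w := by
          intro k l hkl' hkv hlv hne hw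
          have hend : ∀ c (y : {w // w ≠ v}) (hcv : G.line c v ≠ b), G.line c y = b →
              (G.contract v b).comp Set.univ (Sum.inl y) =
                (G.contract v b).comp Set.univ (Sum.inr ⟨G.line c v, hcv⟩) := by
            intro c y hcv hy
            rw [(G.contract v b).comp_line (Set.mem_univ c)]
            congr 2
            exact Subtype.ext (G.contract_line_of_eq hy)
          have hav : (G.line k).symm b ≠ v := fun h => hkv (by rw [← h]; simp)
          have ha := hend k ⟨(G.line k).symm b, hav⟩ hkv (by simp)
          obtain ⟨x, k', hx, hxm⟩ := G.exists_isMelonAt_of_contract hkv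
            (a := ⟨(G.line k).symm b, hav⟩) (by simp) (by
              intro c' hc' y hy h
              by_cases hcv : G.line c' v = b
              · exact y.2 ((G.line c').injective (hy.trans hcv.symm))
              · obtain rfl := (hkl' c' hcv).resolve_left hc'
                exact hne (by rw [← ha, ← h, hend _ y hcv hy])) (hmel _ _)
          obtain ⟨f, hf⟩ := G.exists_contract_up (S := Set.univ) (v := v) (b := b)
            fun _ _ _ => hvbu
          have hx' := congrArg f hx
          rw [hf, hf] at hx'
          refine Or.inr ⟨x, k', ?_, hxm, fun h => ?_⟩
          · refine hx'.trans ?_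
            rw [hwv, hvbu]
            exact G.comp_symm (Set.mem_univ _) _
          · subst h
            exact absurd (hx.trans ha) (hw x.2)
        by_cases hw : ∃ hw : w ≠ v, (G.contract v b).comp Set.univ (Sum.inl ⟨w, hw⟩) =
              (G.contract v b).comp Set.univ (Sum.inr ⟨G.line k v, hkv⟩)
        · obtain ⟨hw, hwk⟩ := hw
          exact side l k (fun c hc => (hkl' c hc).symm) hlv hkv hne.symm fun _ h =>
            hne (hwk.symm.trans h)
        · push Not at hw
          exact side k l hkl' hkv hlv hne hw

/-! ### Recognising melonic graphs -/

section Melonic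

theorem comp_eq_of_connected {W : Type u} {B : Type v} {G : ColoredGraph W B} (hG : G.Connected)
    (x y : W ⊕ B) : G.comp Set.univ x = G.comp Set.univ y :=
  SimpleGraph.ConnectedComponent.sound (hG.preconnected x y)

theorem numComp_eq_one {W : Type u} {B : Type v} {G : ColoredGraph W B} (hG : G.Connected) :
    G.numComp Set.univ = 1 := by
  rw [numComp, Nat.card_eq_one_iff_unique]
  obtain ⟨x⟩ := hG.nonempty
  refine ⟨⟨fun κ κ' => ?_⟩, ⟨G.comp _ x⟩⟩
  obtain ⟨x, rfl⟩ := G.exists_rep κ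
  obtain ⟨y, rfl⟩ := G.exists_rep κ'
  exact comp_eq_of_connected hG x y

theorem connected_of_numComp_eq_one {W : Type u} {B : Type v} {G : ColoredGraph W B}
    (h : G.numComp Set.univ = 1) : G.Connected := by
  rw [numComp, Nat.card_eq_one_iff_unique] at h
  obtain ⟨h1, ⟨κ⟩⟩ := h
  obtain ⟨x, -⟩ := G.exists_rep κ
  have : Nonempty (W ⊕ B) := ⟨x⟩
  exact ⟨fun x y => SimpleGraph.ConnectedComponent.exact (h1.elim (G.comp _ x) (G.comp _ y))⟩

section InsertMelonLines

variable {W : Type u} {B : Type v} (G : ColoredGraph W B) {c : Fin 4} {w : W}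

theorem insertMelon_line_none : (G.insertMelon c w).line c none = some (G.line c w) := by
  simp [insertMelon]

theorem insertMelon_line_cut : (G.insertMelon c w).line c (some w) = none := by
  simp [insertMelon]

theorem insertMelon_line_some {w' : W} (h : w' ≠ w) :
    (G.insertMelon c w).line c (some w') = some (G.line c w') := by
  classical
  simp only [insertMelon, if_true, Equiv.trans_apply]
  rw [Equiv.swap_apply_of_ne_of_ne (by simp) (by simpa using h)]
  simp

theorem insertMelon_line_other {c' : Fin 4} (h : c' ≠ c) (o : Option W) :
    (G.insertMelon c w).line c' o = o.map (G.line c') := by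
  simp [insertMelon, h]

end InsertMelonLines

/-- Contraction at a melon is inverse to insertion. The line to be cut again is the spliced one, at
the white node whose `k`-line ends at `b` in `G`. -/
theorem isMelonic_of_contract {W : Type u} {B : Type v} (G : ColoredGraph W B) {v : W} {k : Fin 4}
    {b : B} (hb : ∀ c, c ≠ k → G.line c v = b) (hk : G.line k v ≠ b)
    (h : (G.contract v b).IsMelonic) : G.IsMelonic := by
  classical
  have hav : (G.line k).symm b ≠ v := fun h => hk (by rw [← h]; simp)
  have h2 := (h.insertMelon _ k ⟨(G.line k).symm b, hav⟩).relabel _ (Equiv.optionSubtypeNe v)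
    (Equiv.optionSubtypeNe b)
  suffices hG : G = _ from hG ▸ h2
  obtain ⟨line⟩ := G
  simp only [relabel, ColoredGraph.mk.injEq] at *
  funext c
  ext w
  obtain ⟨o, rfl⟩ := (Equiv.optionSubtypeNe v).surjective w
  simp only [Equiv.trans_apply, Equiv.symm_apply_apply]
  rcases o with _ | w
  · by_cases hc : c = k
    · subst hc
      rw [insertMelon_line_none, Equiv.optionSubtypeNe_some, contract_line_of_eq _ (by simp)]
      simp
    · rw [insertMelon_line_other _ hc]
      simp [hb c hc]
  · by_cases hc : c = k
    · subst hc
      by_cases hw : w = ⟨(line c).symm b, hav⟩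
      · subst hw
        rw [insertMelon_line_cut]
        simp
      · have hwb : line c w ≠ b := fun h => hw (Subtype.ext (by simp [← h]))
        rw [insertMelon_line_some _ hw, Equiv.optionSubtypeNe_some b,
          contract_line_of_ne _ (by exact hwb)]
        simp
    · have hwb : line c w ≠ b := fun h => w.2 ((line c).injective (h.trans (hb c hc).symm))
      rw [insertMelon_line_other _ hc, Option.map_some, Equiv.optionSubtypeNe_some b,
        contract_line_of_ne _ (by exact hwb)]
      simp

/-- A connected graph with the maximal number of faces is melonic. -/
theorem isMelonic_of_faceCount (n : ℕ) : ∀ (W : Type u) (B : Type v) [Finite W] [Finite B]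
    (G : ColoredGraph W B), Nat.card W = n → G.Connected → 3 * n + 3 ≤ G.faceCount →
    G.IsMelonic := by
  induction n with
  | zero =>
    intro W B _ _ G hn hG _
    have hW : IsEmpty W := (Finite.card_eq_zero_iff).1 hn
    obtain ⟨w | x⟩ := hG.nonempty
    · exact hW.elim w
    · exact hW.elim ((G.line 0).symm x)
  | succ n ih =>
    intro W B _ _ G hn hG hF
    obtain ⟨hle, hmel⟩ := faceCount_le (n + 1) W B G hn
    have h1 := numComp_eq_one hG
    have : Nonempty W := (Nat.card_pos_iff.1 (by omega)).1
    obtain ⟨w⟩ := this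
    rcases hmel (by omega) 0 w with h | ⟨v, k, -, hm, -⟩
    · have hall : ∀ x : W ⊕ B, x = Sum.inl w ∨ x = Sum.inr (G.line 0 w) := fun x => by
        have := G.eq_of_comp_eq (S := Set.univ)
          (fun x => x = Sum.inl w ∨ x = Sum.inr (G.line 0 w)) (fun c _ y => by
            simp only [Sum.inl.injEq, reduceCtorEq, or_false, false_or, Sum.inr.injEq, eq_iff_iff]
            rw [← h c, (G.line c).injective.eq_iff]) (comp_eq_of_connected hG (Sum.inl w) x)
        exact this ▸ Or.inl rfl
      let _ : Unique W := ⟨⟨w⟩, fun y => by simpa using hall (Sum.inl y)⟩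
      let _ : Unique B := ⟨⟨G.line 0 w⟩, fun y => by simpa using hall (Sum.inr y)⟩
      exact IsMelonic.supermelon G
    · obtain ⟨i, hi⟩ : ∃ i, i ≠ k := exists_ne k
      have hb : ∀ c, c ≠ k → G.line c v = G.line i v := fun c hc => hm.1 c i hc hi
      have hk : G.line k v ≠ G.line i v := (hm.2 i hi).symm
      refine G.isMelonic_of_contract hb hk ?_
      obtain ⟨j, l, hik, hil, hjk, hjl, hkl, hall⟩ := exists_others hi.symm
      generalize G.line i v = b at *
      have hone : ∀ c, G.line c v ≠ b → c = k := fun c hc => by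
        by_contra h; exact hc (hb c h)
      have heqS : ∀ S : Set (Fin 4), k ∈ S → (∃ c ∈ S, c ≠ k) →
          (G.contract v b).numComp S = G.numComp S := fun S hkS ⟨c, hcS, hck⟩ =>
        G.numComp_contract_eq hkS hk (by rw [G.comp_line hcS, hb c hck]) fun c _ h => by
          obtain rfl := hone c h; rfl
      have hadd : ∀ i j, i ≠ k → j ≠ k →
          G.numComp {i, j} = (G.contract v b).numComp {i, j} + 1 := fun i j hi hj =>
        G.numComp_eq_contract_add_one (c := i) (by simp) (by simp [hb i hi, hb j hj])
      have hu := heqS Set.univ (Set.mem_univ _) ⟨i, Set.mem_univ _, hi⟩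
      refine ih _ _ _ (card_contract hn) (connected_of_numComp_eq_one (hu.trans h1)) ?_
      -- The three faces formed by inner lines disappear and all others survive, which matches the
      -- drop of `3 n + 3` by three.
      rw [faceCount_eq _ hi.symm hik hil hjk hjl hkl] at hF ⊢
      have e1 := heqS {k, i} (by simp) ⟨i, by simp, hi⟩
      have e2 := heqS {k, j} (by simp) ⟨j, by simp, hik.symm⟩
      have e3 := heqS {k, l} (by simp) ⟨l, by simp, hil.symm⟩
      have e4 := hadd i j hi hik.symm
      have e5 := hadd i l hi hil.symm
      have e6 := hadd j l hik.symm hil.symm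
      omega

end Melonic

end ColoredGraph

namespace ColoredGraph

universe u v

/-! ### Melonic graphs are dual to spheres -/

/-- The least barycentric coordinate other than the one of the vertex `c`. -/
noncomputable def lowest (c : Fin 4) (x : stdSimplex ℝ (Fin 4)) : ℝ :=
  (Finset.univ.erase c).inf' (by fin_cases c <;> decide) x.1

theorem lowest_le {c i : Fin 4} (h : i ≠ c) (x : stdSimplex ℝ (Fin 4)) : lowest c x ≤ x.1 i :=
  Finset.inf'_le _ (by simp [h])

theorem exists_eq_lowest (c : Fin 4) (x : stdSimplex ℝ (Fin 4)) :
    ∃ i, i ≠ c ∧ x.1 i = lowest c x := by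
  obtain ⟨i, hi, h⟩ := Finset.exists_mem_eq_inf' (s := Finset.univ.erase c)
    (by fin_cases c <;> decide) x.1
  exact ⟨i, by simpa using hi, h.symm⟩

theorem lowest_nonneg (c : Fin 4) (x : stdSimplex ℝ (Fin 4)) : 0 ≤ lowest c x := by
  obtain ⟨i, -, hi⟩ := exists_eq_lowest c x
  rw [← hi]
  exact x.2.1 i

theorem lowest_eq {c : Fin 4} {x : stdSimplex ℝ (Fin 4)} {y : ℝ} (h : ∀ i, i ≠ c → y ≤ x.1 i)
    {i : Fin 4} (hi : i ≠ c) (hxi : x.1 i = y) : lowest c x = y := by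
  obtain ⟨j, hj, hxj⟩ := exists_eq_lowest c x
  exact le_antisymm (hxi ▸ lowest_le hi x) (hxj ▸ h j hj)

theorem continuous_coord (i : Fin 4) : Continuous fun x : stdSimplex ℝ (Fin 4) => x.1 i :=
  (continuous_apply i).comp continuous_subtype_val

theorem continuous_lowest (c : Fin 4) : Continuous (lowest c) :=
  Continuous.finset_inf'_apply _ fun i _ => continuous_coord i

/-- Three times the distance (in the coordinate `c`) to the face `c` of the point of the other faces
which lies above `x`. -/
noncomputable def top (c : Fin 4) (x : stdSimplex ℝ (Fin 4)) : ℝ := 3 * lowest c x + x.1 c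

theorem le_top (c : Fin 4) (x : stdSimplex ℝ (Fin 4)) : x.1 c ≤ top c x := by
  unfold top; linarith [lowest_nonneg c x]

theorem top_nonneg (c : Fin 4) (x : stdSimplex ℝ (Fin 4)) : 0 ≤ top c x :=
  (x.2.1 c).trans (le_top c x)

/-- On the faces other than `c` a point is at the upper end of its vertical segment. This makes the
rescalings of the segments compatible with the gluings along these faces. -/
theorem top_eq {c i : Fin 4} {x : stdSimplex ℝ (Fin 4)} (hi : i ≠ c) (h : x.1 i = 0) :
    top c x = x.1 c := by
  have : lowest c x = 0 := lowest_eq (fun j _ => x.2.1 j) hi h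
  simp [top, this]

/-- The point above `x` whose coordinate `c` is `s` (or the closest admissible value). -/
noncomputable def raise (c : Fin 4) (x : stdSimplex ℝ (Fin 4)) (s : ℝ) : stdSimplex ℝ (Fin 4) :=
  ⟨fun i => if i = c then max 0 (min s (top c x)) else
      x.1 i + (x.1 c - max 0 (min s (top c x))) / 3, by
    have h1 : max 0 (min s (top c x)) ≤ top c x := max_le (top_nonneg c x) (min_le_right _ _)
    have h0 : 0 ≤ max 0 (min s (top c x)) := le_max_left _ _
    generalize max 0 (min s (top c x)) = s' at h0 h1
    refine ⟨fun i => ?_, ?_⟩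
    · beta_reduce
      split_ifs with hi
      · exact h0
      · have := lowest_le hi x
        unfold top at h1
        linarith
    · have hx := x.2.2
      rw [Fin.sum_univ_four] at hx ⊢
      fin_cases c <;> simp <;> linarith⟩

theorem continuous_top (c : Fin 4) : Continuous (top c) :=
  (continuous_const.mul (continuous_lowest c)).add (continuous_coord c)

theorem continuous_raise (c : Fin 4) {s : stdSimplex ℝ (Fin 4) → ℝ} (hs : Continuous s) :
    Continuous fun x => raise c x (s x) := by
  have h : Continuous fun x => max 0 (min (s x) (top c x)) :=
    continuous_const.max (hs.min (continuous_top c))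
  refine Continuous.subtype_mk (continuous_pi fun i => ?_) _
  by_cases hi : i = c
  · simpa [hi] using h
  · simp only [hi, if_false]
    exact (continuous_coord i).add (((continuous_coord c).sub h).div_const 3)

section

variable {c : Fin 4} {x : stdSimplex ℝ (Fin 4)} {s : ℝ}

theorem raise_same (h0 : 0 ≤ s) (h1 : s ≤ top c x) : (raise c x s).1 c = s := by
  simp [raise, h0, h1]

theorem raise_other (h0 : 0 ≤ s) (h1 : s ≤ top c x) {i : Fin 4} (hi : i ≠ c) :
    (raise c x s).1 i = x.1 i + (x.1 c - s) / 3 := by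
  simp [raise, h0, h1, hi]

theorem raise_self : raise c x (x.1 c) = x := by
  ext i
  by_cases hi : i = c
  · subst hi; exact raise_same (x.2.1 _) (le_top _ _)
  · have := raise_other (x.2.1 c) (le_top c x) hi
    rw [sub_self, zero_div, add_zero] at this
    exact this

theorem top_raise (h0 : 0 ≤ s) (h1 : s ≤ top c x) : top c (raise c x s) = top c x := by
  obtain ⟨i, hi, hxi⟩ := exists_eq_lowest c x
  have : lowest c (raise c x s) = lowest c x + (x.1 c - s) / 3 := by
    refine lowest_eq (fun j hj => ?_) hi ?_
    · rw [raise_other h0 h1 hj]; linarith [lowest_le hj x]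
    · rw [raise_other h0 h1 hi, hxi]
  rw [top, top, this, raise_same h0 h1]; ring

theorem raise_raise (h0 : 0 ≤ s) (h1 : s ≤ top c x) {s' : ℝ} (h0' : 0 ≤ s') (h1' : s' ≤ top c x) :
    raise c (raise c x s) s' = raise c x s' := by
  have h1'' : s' ≤ top c (raise c x s) := by rwa [top_raise h0 h1]
  ext i
  by_cases hi : i = c
  · subst hi; exact (raise_same h0' h1'').trans (raise_same h0' h1').symm
  · refine (raise_other h0' h1'' hi).trans (Eq.trans ?_ (raise_other h0' h1' hi).symm)
    rw [raise_same h0 h1, raise_other h0 h1 hi]; ring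

theorem exists_raise_top_eq_zero : ∃ i, i ≠ c ∧ (raise c x (top c x)).1 i = 0 := by
  obtain ⟨i, hi, hxi⟩ := exists_eq_lowest c x
  refine ⟨i, hi, ?_⟩
  rw [raise_other (top_nonneg c x) le_rfl hi, hxi, top]; ring

end

/-! ### Insertion of a melon as a slicing of one tetrahedron -/

section Insert

variable {W : Type u} {B : Type v} (G : ColoredGraph W B) (c : Fin 4) (w : W)

/-- A point of the tetrahedron of a node. -/
abbrev pt (a : W ⊕ B) (x : stdSimplex ℝ (Fin 4)) : G.Realization := Quot.mk _ ⟨a, x⟩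

theorem pt_glue {c' : Fin 4} {w' : W} {b' : B} (h : G.line c' w' = b') {x : stdSimplex ℝ (Fin 4)}
    (hx : x.1 c' = 0) : G.pt (Sum.inl w') x = G.pt (Sum.inr b') x :=
  h ▸ Quot.sound (Glue.glue c' w' x hx)

open Classical in
/-- The two new tetrahedra and the tetrahedron of `w` are stacked over the face `c` of the
latter. -/
noncomputable def collapseFun : Option W ⊕ Option B → stdSimplex ℝ (Fin 4) → G.Realization
  | Sum.inl none, x => G.pt (Sum.inl w) (raise c x (x.1 c / 3))
  | Sum.inl (some w'), x =>
      G.pt (Sum.inl w') (if w' = w then raise c x ((2 * top c x + x.1 c) / 3) else x)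
  | Sum.inr none, x => G.pt (Sum.inl w) (raise c x ((2 * top c x - x.1 c) / 3))
  | Sum.inr (some b'), x => G.pt (Sum.inr b') x

theorem collapseFun_self (x : stdSimplex ℝ (Fin 4)) : collapseFun G c w (Sum.inl (some w)) x =
    G.pt (Sum.inl w) (raise c x ((2 * top c x + x.1 c) / 3)) := by
  simp [collapseFun]

theorem collapseFun_ne {w' : W} (h : w' ≠ w) (x : stdSimplex ℝ (Fin 4)) :
    collapseFun G c w (Sum.inl (some w')) x = G.pt (Sum.inl w') x := by
  simp [collapseFun, h]

/-- The slabs are the lower, middle and upper thirds of each vertical segment, the middle one being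
turned upside down. Thus the two new nodes meet at height `top / 3`, along the faces other than `c`,
the new black node meets `w` at `2 * top / 3`, along the face `c`, and the outer boundary is fixed.
-/
theorem collapseFun_glue (p q : Σ _ : Option W ⊕ Option B, stdSimplex ℝ (Fin 4))
    (h : (G.insertMelon c w).Glue p q) : collapseFun G c w p.1 p.2 = collapseFun G c w q.1 q.2 := by
  obtain ⟨c', o, x, hx⟩ := h
  have hxs : ∀ i, i ≠ c → x.1 i = 0 → (2 * top c x + x.1 c) / 3 = x.1 c ∧
      (2 * top c x - x.1 c) / 3 = x.1 c / 3 := fun i hi h => by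
    rw [top_eq hi h]; constructor <;> ring
  by_cases hc : c' = c
  · subst hc
    rcases o with _ | w'
    · simp only [insertMelon_line_none, collapseFun]
      rw [hx, zero_div, ← hx, raise_self]
      exact G.pt_glue rfl hx
    · by_cases hw : w' = w
      · subst hw
        simp [insertMelon_line_cut, collapseFun, hx]
      · simp only [insertMelon_line_some _ hw, collapseFun, if_neg hw]
        exact G.pt_glue rfl hx
  · rw [insertMelon_line_other _ hc]
    obtain ⟨h1, h2⟩ := hxs c' hc hx
    rcases o with _ | w'
    · simp only [Option.map_none, collapseFun, h2]
    · simp only [Option.map_some, collapseFun, h1, raise_self, ite_self]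
      exact G.pt_glue rfl hx

open Classical in
/-- The inverse of the stacking. -/
noncomputable def expandFun : W ⊕ B → stdSimplex ℝ (Fin 4) → (G.insertMelon c w).Realization
  | Sum.inl w', x =>
      if w' = w then
        if 3 * x.1 c ≤ top c x then pt _ (Sum.inl none) (raise c x (3 * x.1 c))
        else if 3 * x.1 c ≤ 2 * top c x then pt _ (Sum.inr none)
          (raise c x (2 * top c x - 3 * x.1 c))
        else pt _ (Sum.inl (some w)) (raise c x (3 * x.1 c - 2 * top c x))
      else pt _ (Sum.inl (some w')) x
  | Sum.inr b', x => pt _ (Sum.inr (some b')) x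

variable {x : stdSimplex ℝ (Fin 4)}

theorem expandFun_low (h : 3 * x.1 c ≤ top c x) :
    expandFun G c w (Sum.inl w) x = pt _ (Sum.inl none) (raise c x (3 * x.1 c)) := by
  simp [expandFun, h]

/-- On the borders between thirds the two branches give points that are glued together, so each
formula holds on a closed third. -/
theorem expandFun_mid (h : top c x ≤ 3 * x.1 c) (h' : 3 * x.1 c ≤ 2 * top c x) :
    expandFun G c w (Sum.inl w) x =
      pt _ (Sum.inr none) (raise c x (2 * top c x - 3 * x.1 c)) := by
  by_cases h0 : 3 * x.1 c ≤ top c x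
  · rw [expandFun_low _ _ _ h0]
    have he : 3 * x.1 c = top c x := le_antisymm h0 h
    rw [he, show 2 * top c x - top c x = top c x by ring]
    obtain ⟨i, hi, hi0⟩ := exists_raise_top_eq_zero (c := c) (x := x)
    exact pt_glue _ (by rw [insertMelon_line_other _ hi]; rfl) hi0
  · simp [expandFun, h0, h']

theorem expandFun_high (h : 2 * top c x ≤ 3 * x.1 c) :
    expandFun G c w (Sum.inl w) x =
      pt _ (Sum.inl (some w)) (raise c x (3 * x.1 c - 2 * top c x)) := by
  by_cases h0 : 3 * x.1 c ≤ 2 * top c x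
  · rw [expandFun_mid _ _ _ (by linarith [top_nonneg c x]) h0]
    have he : 3 * x.1 c = 2 * top c x := le_antisymm h0 h
    rw [he, sub_self]
    exact (pt_glue _ (insertMelon_line_cut _)
      (raise_same le_rfl (top_nonneg c x))).symm
  · have : ¬ 3 * x.1 c ≤ top c x := fun h1 => h0 (h1.trans (by linarith [top_nonneg c x]))
    simp [expandFun, h0, this]

theorem expandFun_glue (p q : Σ _ : W ⊕ B, stdSimplex ℝ (Fin 4)) (h : G.Glue p q) :
    expandFun G c w p.1 p.2 = expandFun G c w q.1 q.2 := by
  obtain ⟨c', w', x, hx⟩ := h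
  by_cases hw : w' = w
  · subst hw
    by_cases hc : c' = c
    · subst hc
      simp only
      rw [expandFun_low _ _ _ (by rw [hx]; simpa using top_nonneg c' x), hx, mul_zero, ← hx,
        raise_self]
      exact pt_glue _ (insertMelon_line_none _) hx
    · have ht := top_eq hc hx
      have h0 := x.2.1 c
      simp only
      rw [expandFun_high _ _ _ (by rw [ht]; linarith), ht,
        show 3 * x.1 c - 2 * x.1 c = x.1 c by ring, raise_self]
      exact pt_glue _ (by rw [insertMelon_line_other _ hc]; rfl) hx
  · simp only [expandFun, hw, if_false]
    refine pt_glue _ ?_ hx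
    by_cases hc : c' = c
    · subst hc
      exact insertMelon_line_some _ hw
    · rw [insertMelon_line_other _ hc]; rfl

/-- Insertion of a melon does not change the dual space, as a set. -/
noncomputable def collapseEquiv : (G.insertMelon c w).Realization ≃ G.Realization where
  toFun := Quot.lift (fun p => collapseFun G c w p.1 p.2) (collapseFun_glue G c w)
  invFun := Quot.lift (fun p => expandFun G c w p.1 p.2) (expandFun_glue G c w)
  left_inv := by
    rintro ⟨a, x⟩
    have h0 := x.2.1 c
    have h1 := le_top c x
    rcases a with (_ | w') | (_ | b')
    · change expandFun G c w (Sum.inl w) (raise c x (x.1 c / 3)) = _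
      have h2 : 0 ≤ x.1 c / 3 := by linarith
      have h3 : x.1 c / 3 ≤ top c x := by linarith
      rw [expandFun_low _ _ _ (by rw [raise_same h2 h3, top_raise h2 h3]; linarith),
        raise_same h2 h3, raise_raise h2 h3 (by linarith) (by linarith),
        show 3 * (x.1 c / 3) = x.1 c by ring, raise_self]
    · by_cases hw : w' = w
      · subst hw
        change Quot.lift _ (expandFun_glue G c w') (collapseFun G c w' (Sum.inl (some w')) x) = _
        rw [collapseFun_self]
        change expandFun G c w' (Sum.inl w') _ = _
        have h2 : 0 ≤ (2 * top c x + x.1 c) / 3 := by linarith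
        have h3 : (2 * top c x + x.1 c) / 3 ≤ top c x := by linarith
        rw [expandFun_high _ _ _ (by rw [raise_same h2 h3, top_raise h2 h3]; linarith),
          raise_same h2 h3, top_raise h2 h3, raise_raise h2 h3 (by linarith) (by linarith),
          show 3 * ((2 * top c x + x.1 c) / 3) - 2 * top c x = x.1 c by ring, raise_self]
      · change Quot.lift _ (expandFun_glue G c w) (collapseFun G c w (Sum.inl (some w')) x) = _
        rw [collapseFun_ne _ _ _ hw]
        simp [hw, expandFun]
    · change expandFun G c w (Sum.inl w) (raise c x ((2 * top c x - x.1 c) / 3)) = _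
      have h2 : 0 ≤ (2 * top c x - x.1 c) / 3 := by linarith
      have h3 : (2 * top c x - x.1 c) / 3 ≤ top c x := by linarith
      rw [expandFun_mid _ _ _ (by rw [raise_same h2 h3, top_raise h2 h3]; linarith)
        (by rw [raise_same h2 h3, top_raise h2 h3]; linarith),
        raise_same h2 h3, top_raise h2 h3, raise_raise h2 h3 (by linarith) (by linarith),
        show 2 * top c x - 3 * ((2 * top c x - x.1 c) / 3) = x.1 c by ring, raise_self]
    · rfl
  right_inv := by
    rintro ⟨a, x⟩
    have h0 := x.2.1 c
    have h1 := le_top c x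
    rcases a with w' | b'
    · by_cases hw : w' = w
      · subst hw
        change Quot.lift _ _ (expandFun G c w' (Sum.inl w') x) = _
        rcases le_total (3 * x.1 c) (top c x) with h | h
        · rw [expandFun_low _ _ _ h]
          change G.pt _ _ = _
          rw [raise_same (by linarith) h, raise_raise (by linarith) h (by linarith) (by linarith),
            show 3 * x.1 c / 3 = x.1 c by ring, raise_self]
        rcases le_total (3 * x.1 c) (2 * top c x) with h' | h'
        · rw [expandFun_mid _ _ _ h h']
          change G.pt _ _ = _
          have h2 : 0 ≤ 2 * top c x - 3 * x.1 c := by linarith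
          have h3 : 2 * top c x - 3 * x.1 c ≤ top c x := by linarith
          rw [raise_same h2 h3, top_raise h2 h3, raise_raise h2 h3 (by linarith) (by linarith),
            show (2 * top c x - (2 * top c x - 3 * x.1 c)) / 3 = x.1 c by ring, raise_self]
        · rw [expandFun_high _ _ _ h']
          change collapseFun G c w' (Sum.inl (some w')) _ = _
          rw [collapseFun_self]
          have h2 : 0 ≤ 3 * x.1 c - 2 * top c x := by linarith
          have h3 : 3 * x.1 c - 2 * top c x ≤ top c x := by linarith
          rw [raise_same h2 h3, top_raise h2 h3, raise_raise h2 h3 (by linarith) (by linarith),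
            show (2 * top c x + (3 * x.1 c - 2 * top c x)) / 3 = x.1 c by ring, raise_self]
      · change Quot.lift _ _ (expandFun G c w (Sum.inl w') x) = _
        simp [expandFun, hw, collapseFun]
    · rfl

theorem continuous_pt (a : W ⊕ B) : Continuous (G.pt a) :=
  continuous_quot_mk.comp continuous_sigmaMk

theorem continuous_collapseEquiv : Continuous (collapseEquiv G c w) := by
  refine continuous_quot_lift _ (continuous_sigma fun a => ?_)
  rcases a with (_ | w') | (_ | b')
  · exact (G.continuous_pt _).comp (continuous_raise c ((continuous_coord c).div_const 3))
  · by_cases hw : w' = w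
    · simp only [collapseFun, hw, if_true]
      exact (G.continuous_pt _).comp (continuous_raise c
        (((continuous_const.mul (continuous_top c)).add (continuous_coord c)).div_const 3))
    · simp only [collapseFun, hw, if_false]
      exact G.continuous_pt _
  · exact (G.continuous_pt _).comp (continuous_raise c
        (((continuous_const.mul (continuous_top c)).sub (continuous_coord c)).div_const 3))
  · exact G.continuous_pt _

end Insert

theorem compactSpace_realization {W : Type u} {B : Type v} [Finite W] [Finite B]
    (G : ColoredGraph W B) : CompactSpace G.Realization := by
  have : CompactSpace (stdSimplex ℝ (Fin 4)) := inferInstance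
  infer_instance

theorem IsSpherical.t2Space {W : Type u} {B : Type v} {G : ColoredGraph W B} (h : G.IsSpherical) :
    T2Space G.Realization := by
  obtain ⟨e⟩ := h
  exact e.symm.t2Space

/-- Continuity in one direction suffices: the source is compact and the target is Hausdorff. -/
theorem IsSpherical.of_equiv {W W' : Type u} {B B' : Type v} [Finite W'] [Finite B']
    {G : ColoredGraph W B} {G' : ColoredGraph W' B'} (h : G.IsSpherical)
    (e : G'.Realization ≃ G.Realization) (he : Continuous e) : G'.IsSpherical := by
  have := h.t2Space
  have := G'.compactSpace_realization
  obtain ⟨f⟩ := h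
  exact ⟨(he.homeoOfEquivCompactToT2).trans f⟩

theorem IsSpherical.relabel {W W' : Type u} {B B' : Type v} [Finite W'] [Finite B']
    {G : ColoredGraph W B} (h : G.IsSpherical) (e : W ≃ W') (f : B ≃ B') :
    (G.relabel e f).IsSpherical := by
  have hG : ∀ p q, (G.relabel e f).Glue p q →
      G.pt (Sum.map e.symm f.symm p.1) p.2 = G.pt (Sum.map e.symm f.symm q.1) q.2 := by
    rintro _ _ ⟨c, w, x, hx⟩
    refine G.pt_glue ?_ hx
    simp [ColoredGraph.relabel]
  have hG' : ∀ p q, G.Glue p q →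
      (G.relabel e f).pt (Sum.map e f p.1) p.2 = (G.relabel e f).pt (Sum.map e f q.1) q.2 := by
    rintro _ _ ⟨c, w, x, hx⟩
    refine pt_glue _ ?_ hx
    simp [ColoredGraph.relabel]
  refine h.of_equiv ⟨Quot.lift _ hG, Quot.lift _ hG', ?_, ?_⟩ ?_
  · rintro ⟨a | a, x⟩ <;> simp
  · rintro ⟨a | a, x⟩ <;> simp
  · exact continuous_quot_lift _ (continuous_sigma fun a =>
      G.continuous_pt (Sum.map e.symm f.symm a))

/-! ### The supermelon as two hemispheres -/

section Supermelon

/-- The least barycentric coordinate. -/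
noncomputable def minCoord (x : Fin 4 → ℝ) : ℝ := Finset.univ.inf' ⟨0, Finset.mem_univ 0⟩ x

theorem minCoord_le (x : Fin 4 → ℝ) (i : Fin 4) : minCoord x ≤ x i :=
  Finset.inf'_le _ (Finset.mem_univ i)

theorem exists_eq_minCoord (x : Fin 4 → ℝ) : ∃ i, x i = minCoord x := by
  obtain ⟨i, -, h⟩ := Finset.exists_mem_eq_inf' (s := Finset.univ) ⟨0, Finset.mem_univ 0⟩ x
  exact ⟨i, h.symm⟩

theorem minCoord_affine {x y : Fin 4 → ℝ} {a t : ℝ} (ha : 0 ≤ a) (h : ∀ i, y i = a * x i + t) :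
    minCoord y = a * minCoord x + t := by
  obtain ⟨i, hi⟩ := exists_eq_minCoord x
  obtain ⟨j, hj⟩ := exists_eq_minCoord y
  refine le_antisymm ?_ ?_
  · rw [← hi, ← h]; exact minCoord_le y i
  · rw [← hj, h]
    have := mul_le_mul_of_nonneg_left (minCoord_le x j) ha
    linarith

theorem minCoord_nonneg (x : stdSimplex ℝ (Fin 4)) : 0 ≤ minCoord x.1 := by
  obtain ⟨i, hi⟩ := exists_eq_minCoord x.1
  rw [← hi]; exact x.2.1 i

/-- The sign of a hemisphere: `1` for a white node, `-1` for a black one. -/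
def nodeSign {W : Type u} {B : Type v} : W ⊕ B → ℝ := Sum.elim (fun _ => 1) fun _ => -1

theorem nodeSign_sq {W : Type u} {B : Type v} (a : W ⊕ B) : nodeSign a * nodeSign a = 1 := by
  rcases a with a | a <;> simp [nodeSign]

/-- A point of a hemisphere, before normalisation: the tetrahedron is bent over the hyperplane
orthogonal to `(1, 1, 1, 1)`. -/
noncomputable def bend (ε : ℝ) (x : stdSimplex ℝ (Fin 4)) : EuclideanSpace ℝ (Fin 4) :=
  WithLp.toLp 2 fun i => x.1 i - 1 / 4 + ε * minCoord x.1

theorem bend_apply (ε : ℝ) (x : stdSimplex ℝ (Fin 4)) (i : Fin 4) :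
    bend ε x i = x.1 i - 1 / 4 + ε * minCoord x.1 := rfl

theorem continuous_bend (ε : ℝ) : Continuous (bend ε) := by
  refine (PiLp.continuous_toLp 2 _).comp (continuous_pi fun i => ?_)
  exact ((continuous_coord i).sub continuous_const).add (continuous_const.mul
    (Continuous.finset_inf'_apply _ fun i _ => continuous_coord i))

theorem sum_bend (ε : ℝ) (x : stdSimplex ℝ (Fin 4)) : ∑ i, bend ε x i = 4 * (ε * minCoord x.1) := by
  have hx := x.2.2
  simp only [bend_apply, Finset.sum_add_distrib, Finset.sum_sub_distrib, hx]
  simp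

/-- The sum of the coordinates recovers the signed height `ε * minCoord x`; squaring removes the
signs, so heights scale by `ρ`. The least coordinates are also related by the affine map `t ↦ ρ t +
(1 - ρ) / 4`, and comparison gives `ρ = 1`. -/
theorem eq_of_smul_bend {ε ε' ρ : ℝ} (hε : ε * ε = 1) (hε' : ε' * ε' = 1) (hρ : 0 ≤ ρ)
    {x x' : stdSimplex ℝ (Fin 4)} (h : bend ε' x' = ρ • bend ε x) :
    x = x' ∧ (ε = ε' ∨ minCoord x.1 = 0) := by
  have hi : ∀ i, x'.1 i - 1 / 4 + ε' * minCoord x'.1 = ρ * (x.1 i - 1 / 4 + ε * minCoord x.1) :=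
    fun i => congrArg (fun z : EuclideanSpace ℝ (Fin 4) => z i) h
  have hsum : ε' * minCoord x'.1 = ρ * (ε * minCoord x.1) := by
    have h1 := sum_bend ε' x'
    simp only [bend_apply, hi, ← Finset.mul_sum] at h1
    have h2 := sum_bend ε x
    simp only [bend_apply] at h2
    rw [h2] at h1
    linarith
  have hmin := minCoord_affine (x := x.1) (y := x'.1) (a := ρ) (t := 1 / 4 - ρ / 4) hρ fun i => by
    have := hi i
    linarith
  have hμ := minCoord_nonneg x
  have hμ' := minCoord_nonneg x'
  have hs : minCoord x'.1 = ρ * minCoord x.1 := by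
    have h1 := congrArg (fun t => t * t) hsum
    have h2 : minCoord x'.1 ^ 2 = (ρ * minCoord x.1) ^ 2 := by
      linear_combination h1 - minCoord x'.1 ^ 2 * hε' + (ρ * minCoord x.1) ^ 2 * hε
    exact (pow_left_inj₀ hμ' (by positivity) two_ne_zero).1 h2
  obtain rfl : ρ = 1 := by linarith
  have hx : x = x' := Subtype.ext (funext fun i => by have := hi i; linarith)
  subst hx
  refine ⟨rfl, ?_⟩
  by_cases h0 : minCoord x.1 = 0
  · exact Or.inr h0
  · exact Or.inl (mul_right_cancel₀ h0 (by linarith))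

theorem bend_ne_zero {ε : ℝ} (hε : ε * ε = 1) (x : stdSimplex ℝ (Fin 4)) : bend ε x ≠ 0 := by
  intro h
  have h1 := sum_bend ε x
  have h0 : ∀ i, bend ε x i = 0 := fun i => by rw [h]; rfl
  simp only [h0, Finset.sum_const_zero] at h1
  have h2 : ε * minCoord x.1 = 0 := by linarith
  obtain ⟨i, hi⟩ := exists_eq_minCoord x.1
  have h3 := h0 i
  rw [bend_apply, h2, hi] at h3
  have h4 : ε * ε * minCoord x.1 = 0 := by rw [mul_assoc, h2, mul_zero]
  rw [hε] at h4
  linarith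

/-- With `τ` the mean of the coordinates of `z` and `y` the deviation from it, `ρ` is chosen so that
the least coordinate of `ρ y + 1/4` is `ρ |τ|`. The sign of `τ` selects the hemisphere. -/
theorem exists_smul_bend (z : EuclideanSpace ℝ (Fin 4)) (hz : z ≠ 0) :
    ∃ ε x, (ε = 1 ∨ ε = -1) ∧ ∃ ρ : ℝ, 0 < ρ ∧ bend ε x = ρ • z := by
  obtain ⟨τ, hτ⟩ : ∃ τ, τ = (∑ i, z i) / 4 := ⟨_, rfl⟩
  obtain ⟨y, hy⟩ : ∃ y : Fin 4 → ℝ, y = fun i => z i - τ := ⟨_, rfl⟩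
  have hysum : ∑ i, y i = 0 := by
    simp only [hy, Finset.sum_sub_distrib]
    simp [hτ]; ring
  obtain ⟨k, hk⟩ := exists_eq_minCoord y
  have hpos : 0 < |τ| - minCoord y := by
    have h0 : minCoord y ≤ 0 := by
      have := Finset.card_nsmul_le_sum Finset.univ y (minCoord y) fun i _ => minCoord_le y i
      simp [hysum] at this
      linarith
    rcases h0.lt_or_eq with h | h
    · linarith [abs_nonneg τ]
    · have hy0 : ∀ i, y i = 0 := fun i =>
        (Finset.sum_eq_zero_iff_of_nonneg fun j _ => h ▸ minCoord_le y j).1 hysum i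
          (Finset.mem_univ i)
      have : τ ≠ 0 := fun h0 => hz (by
        ext i
        have := hy0 i
        simp only [hy, h0] at this
        simpa using this)
      rw [h, sub_zero]
      exact abs_pos.2 this
  obtain ⟨ρ, hρ⟩ : ∃ ρ, ρ = 1 / (4 * (|τ| - minCoord y)) := ⟨_, rfl⟩
  have hρ0 : 0 < ρ := hρ ▸ by positivity
  have hρ1 : ρ * |τ| = ρ * minCoord y + 1 / 4 := by
    rw [hρ]; field_simp; ring
  obtain ⟨x, hx⟩ : ∃ x : stdSimplex ℝ (Fin 4), x.1 = fun i => ρ * y i + 1 / 4 := by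
    refine ⟨⟨fun i => ρ * y i + 1 / 4, fun i => ?_, ?_⟩, rfl⟩
    · have := mul_le_mul_of_nonneg_left (minCoord_le y i) hρ0.le
      have := mul_nonneg hρ0.le (abs_nonneg τ)
      beta_reduce
      linarith
    · rw [Finset.sum_add_distrib, ← Finset.mul_sum, hysum]; simp
  have hmin : minCoord x.1 = ρ * |τ| := by
    rw [hρ1]
    exact minCoord_affine hρ0.le fun i => by rw [hx]
  have hfin : ∀ ε, ε * |τ| = τ → bend ε x = ρ • z := fun ε hε => by
    ext i
    rw [bend_apply, hmin, hx]
    simp only [hy, PiLp.smul_apply, smul_eq_mul]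
    linear_combination ρ * hε
  rcases le_total 0 τ with h | h
  · exact ⟨1, x, Or.inl rfl, ρ, hρ0, hfin _ (by rw [abs_of_nonneg h, one_mul])⟩
  · exact ⟨-1, x, Or.inr rfl, ρ, hρ0, hfin _ (by rw [abs_of_nonpos h]; ring)⟩

variable {W : Type u} {B : Type v}

/-- A point of a tetrahedron on its hemisphere. -/
noncomputable def toSphere (p : Σ _ : W ⊕ B, stdSimplex ℝ (Fin 4)) :
    Metric.sphere (0 : EuclideanSpace ℝ (Fin 4)) 1 :=
  ⟨‖bend (nodeSign p.1) p.2‖⁻¹ • bend (nodeSign p.1) p.2, by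
    rw [mem_sphere_zero_iff_norm, norm_smul, norm_inv, norm_norm,
      inv_mul_cancel₀ (norm_ne_zero_iff.2 (bend_ne_zero (nodeSign_sq _) _))]⟩

theorem minCoord_eq_zero {c : Fin 4} {x : stdSimplex ℝ (Fin 4)} (hx : x.1 c = 0) :
    minCoord x.1 = 0 :=
  le_antisymm (hx ▸ minCoord_le x.1 c) (minCoord_nonneg x)

theorem isSpherical_of_unique [Unique W] [Unique B] (G : ColoredGraph W B) : G.IsSpherical := by
  have hG : ∀ p q, G.Glue p q → (toSphere p) = toSphere q := by
    rintro _ _ ⟨c, w, x, hx⟩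
    have h : ∀ ε ε', bend ε x = bend ε' x := fun ε ε' => by
      simp [bend, minCoord_eq_zero hx]
    apply Subtype.ext
    simp only [toSphere]
    rw [h]
  have hcont : Continuous (Quot.lift toSphere hG) := by
    refine continuous_quot_lift _ (continuous_sigma fun a => Continuous.subtype_mk ?_ _)
    exact ((continuous_bend _).norm.inv₀ fun x => norm_ne_zero_iff.2
      (bend_ne_zero (nodeSign_sq _) _)).smul (continuous_bend (nodeSign a))
  have hbij : Function.Bijective (Quot.lift toSphere hG) := by
    constructor
    · rintro ⟨a, x⟩ ⟨a', x'⟩ h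
      have h1 : ‖bend (nodeSign a) x‖⁻¹ • bend (nodeSign a) x =
        ‖bend (nodeSign a') x'‖⁻¹ • bend (nodeSign a') x' := congrArg Subtype.val h
      have hn := norm_ne_zero_iff.2 (bend_ne_zero (nodeSign_sq a') x')
      obtain ⟨rfl, h2⟩ := eq_of_smul_bend (nodeSign_sq a) (nodeSign_sq a')
        (ρ := ‖bend (nodeSign a') x'‖ * ‖bend (nodeSign a) x‖⁻¹) (by positivity) (x := x)
        (x' := x') (by rw [mul_smul, h1, smul_smul, mul_inv_cancel₀ hn, one_smul])
      -- The equator consists of the images of the boundary points, where the two tetrahedra are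
      -- glued.
      have key : minCoord x.1 = 0 → ∀ (w : W) (b : B), G.pt (Sum.inl w) x = G.pt (Sum.inr b) x := by
        intro h0 w b
        obtain ⟨i, hi⟩ := exists_eq_minCoord x.1
        exact G.pt_glue (c' := i) (Subsingleton.elim _ _) (hi.trans h0)
      rcases a with a | a <;> rcases a' with a' | a'
      · rw [Subsingleton.elim a a']
      · exact key (h2.resolve_left (by norm_num [nodeSign])) _ _
      · exact (key (h2.resolve_left (by norm_num [nodeSign])) _ _).symm
      · rw [Subsingleton.elim a a']
    · rintro ⟨z, hz⟩
      have hz1 : ‖z‖ = 1 := mem_sphere_zero_iff_norm.1 hz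
      obtain ⟨ε, x, hε, ρ, hρ, h⟩ := exists_smul_bend z (by rintro rfl; simp at hz1)
      obtain ⟨a, ha⟩ : ∃ a : W ⊕ B, nodeSign a = ε := by
        rcases hε with rfl | rfl
        · exact ⟨Sum.inl default, rfl⟩
        · exact ⟨Sum.inr default, rfl⟩
      refine ⟨G.pt a x, Subtype.ext ?_⟩
      change ‖bend (nodeSign a) x‖⁻¹ • bend (nodeSign a) x = z
      rw [ha, h, norm_smul, hz1, mul_one, Real.norm_of_nonneg hρ.le, smul_smul,
        inv_mul_cancel₀ hρ.ne', one_smul]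
  have := G.compactSpace_realization
  exact ⟨Continuous.homeoOfEquivCompactToT2 (f := Equiv.ofBijective _ hbij) hcont⟩

end Supermelon

theorem IsMelonic.isSpherical {W : Type u} {B : Type v} {G : ColoredGraph W B}
    (h : G.IsMelonic) : Finite W ∧ Finite B ∧ G.IsSpherical := by
  induction h with
  | supermelon G => exact ⟨inferInstance, inferInstance, isSpherical_of_unique G⟩
  | insertMelon G c w _ ih =>
    obtain ⟨_, _, hs⟩ := ih
    exact ⟨inferInstance, inferInstance,
      hs.of_equiv (collapseEquiv G c w) (continuous_collapseEquiv G c w)⟩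
  | relabel G e f _ ih =>
    obtain ⟨_, _, hs⟩ := ih
    have := Finite.of_equiv _ e
    have := Finite.of_equiv _ f
    exact ⟨inferInstance, inferInstance, hs.relabel e f⟩

end ColoredGraph

namespace SU2

/-! ### Invariance of the Haar measure of `SU(2)` -/

instance instSecondCountable : SecondCountableTopology SU2 := by
  have : SecondCountableTopology (Matrix (Fin 2) (Fin 2) ℂ) :=
    inferInstanceAs (SecondCountableTopology (Fin 2 → Fin 2 → ℂ))
  exact TopologicalSpace.Subtype.secondCountableTopology _

instance instIsHaarMeasure : (volume : Measure SU2).IsHaarMeasure := by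
  unfold volume instMeasureSpace
  infer_instance

instance instIsProbabilityMeasure : IsProbabilityMeasure (volume : Measure SU2) :=
  ⟨Measure.haarMeasure_self⟩

/-- Uniqueness of Haar measure; it yields right and inversion invariance, and the concrete model by
quaternions. -/
theorem eq_volume (ν : Measure SU2) [IsProbabilityMeasure ν] [ν.IsMulLeftInvariant] :
    ν = volume := by
  have h := Measure.isMulInvariant_eq_smul_of_compactSpace ν (volume : Measure SU2)
  have h1 := congrArg (fun m : Measure SU2 => m Set.univ) h
  simp only [measure_univ, Measure.smul_apply, ENNReal.smul_def, smul_eq_mul, mul_one] at h1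
  rw [h, ← ENNReal.coe_one, ENNReal.coe_inj] at *
  rw [← h1, one_smul]

instance instIsMulRightInvariant : (volume : Measure SU2).IsMulRightInvariant := by
  refine ⟨fun g => ?_⟩
  have : IsProbabilityMeasure (Measure.map (· * g) (volume : Measure SU2)) :=
    Measure.isProbabilityMeasure_map (measurable_mul_const g).aemeasurable
  exact eq_volume _

instance instIsInvInvariant : (volume : Measure SU2).IsInvInvariant := by
  refine ⟨?_⟩
  have : IsProbabilityMeasure (volume : Measure SU2).inv :=
    Measure.isProbabilityMeasure_map measurable_inv.aemeasurable
  exact eq_volume _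

/-! ### Haar measure as the radial projection of Lebesgue measure -/

/-- The matrix of a quaternion. -/
noncomputable def quat (x : EuclideanSpace ℝ (Fin 4)) : Matrix (Fin 2) (Fin 2) ℂ :=
  !![⟨x 0, x 1⟩, ⟨-x 2, x 3⟩; ⟨x 2, x 3⟩, ⟨x 0, -x 1⟩]

theorem norm_sq_eq (x : EuclideanSpace ℝ (Fin 4)) :
    ‖x‖ ^ 2 = x 0 ^ 2 + x 1 ^ 2 + x 2 ^ 2 + x 3 ^ 2 := by
  rw [EuclideanSpace.norm_sq_eq, Fin.sum_univ_four]
  simp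

theorem quat_mem {x : EuclideanSpace ℝ (Fin 4)} (hx : ‖x‖ = 1) :
    quat x ∈ Matrix.specialUnitaryGroup (Fin 2) ℂ := by
  have h := norm_sq_eq x
  rw [hx] at h
  rw [Matrix.mem_specialUnitaryGroup_iff, Matrix.mem_unitaryGroup_iff, Matrix.star_eq_conjTranspose]
  constructor
  · ext i j
    fin_cases i <;> fin_cases j <;>
      simp [quat, Matrix.mul_apply, Fin.sum_univ_two, Complex.ext_iff] <;>
      constructor <;> nlinarith [h]
  · rw [Matrix.det_fin_two]
    simp [quat, Complex.ext_iff]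
    constructor <;> nlinarith [h]

/-- Radial projection of the space of quaternions to `SU(2)`. -/
noncomputable def proj (x : EuclideanSpace ℝ (Fin 4)) : SU2 :=
  if h : ‖x‖⁻¹ * ‖x‖ = 1 then ⟨quat (‖x‖⁻¹ • x), quat_mem (by rwa [norm_smul, norm_inv, norm_norm])⟩
  else 1

theorem proj_coe {x : EuclideanSpace ℝ (Fin 4)} (h : x ≠ 0) :
    (proj x : Matrix (Fin 2) (Fin 2) ℂ) = quat (‖x‖⁻¹ • x) := by
  have : ‖x‖⁻¹ * ‖x‖ = 1 := inv_mul_cancel₀ (norm_ne_zero_iff.2 h)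
  simp [proj, this]

/-- The product of quaternions. -/
noncomputable def qmul (a : EuclideanSpace ℝ (Fin 4)) :
    EuclideanSpace ℝ (Fin 4) →ₗ[ℝ] EuclideanSpace ℝ (Fin 4) where
  toFun x := !₂[a 0 * x 0 - a 1 * x 1 - a 2 * x 2 - a 3 * x 3,
    a 0 * x 1 + a 1 * x 0 - a 2 * x 3 + a 3 * x 2,
    a 2 * x 0 - a 3 * x 1 + a 0 * x 2 + a 1 * x 3,
    a 2 * x 1 + a 3 * x 0 + a 0 * x 3 - a 1 * x 2]
  map_add' x y := by
    ext i; fin_cases i <;> simp <;> ring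
  map_smul' r x := by
    ext i; fin_cases i <;> simp <;> ring

theorem quat_qmul (a x : EuclideanSpace ℝ (Fin 4)) : quat (qmul a x) = quat a * quat x := by
  ext i j
  fin_cases i <;> fin_cases j <;>
    simp [quat, qmul, Matrix.mul_apply, Fin.sum_univ_two, Complex.ext_iff] <;>
    constructor <;> ring

theorem norm_qmul (a x : EuclideanSpace ℝ (Fin 4)) : ‖qmul a x‖ = ‖a‖ * ‖x‖ := by
  refine (pow_left_inj₀ (norm_nonneg _) (by positivity) two_ne_zero).1 ?_
  rw [mul_pow, norm_sq_eq, norm_sq_eq, norm_sq_eq]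
  simp [qmul]
  ring

/-- Unitarity and determinant one give `star M = M.adjugate`, so the second column is determined by
the first. -/
theorem exists_quat_eq (g : SU2) : ∃ a : EuclideanSpace ℝ (Fin 4), ‖a‖ = 1 ∧
    (g : Matrix (Fin 2) (Fin 2) ℂ) = quat a := by
  obtain ⟨M, hM⟩ := g
  obtain ⟨hU, hdet⟩ := Matrix.mem_specialUnitaryGroup_iff.1 hM
  have hinv : star M = M.adjugate := by
    have h1 := Matrix.mem_unitaryGroup_iff.1 hU
    have h2 : M.adjugate * M = 1 := by rw [Matrix.adjugate_mul, hdet, one_smul]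
    calc star M = M.adjugate * M * star M := by rw [h2, one_mul]
      _ = M.adjugate := by rw [mul_assoc, h1, mul_one]
  rw [Matrix.adjugate_fin_two] at hinv
  have h00 := congrFun (congrFun hinv 0) 0
  have h10 := congrFun (congrFun hinv 1) 0
  simp [Matrix.star_apply, Complex.ext_iff] at h00 h10
  have hq : M = quat !₂[(M 0 0).re, (M 0 0).im, (M 1 0).re, (M 1 0).im] := by
    ext i j
    fin_cases i <;> fin_cases j <;> simp [quat, Complex.ext_iff]
    · constructor <;> linarith [h10.1, h10.2]
    · constructor <;> linarith [h00.1, h00.2]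
  refine ⟨_, ?_, hq⟩
  refine (pow_left_inj₀ (norm_nonneg _) zero_le_one two_ne_zero).1 ?_
  rw [norm_sq_eq]
  rw [Matrix.det_fin_two, hq] at hdet
  simp [quat, Complex.ext_iff] at hdet
  simp
  nlinarith [hdet.1]

theorem proj_qmul {a x : EuclideanSpace ℝ (Fin 4)} (ha : ‖a‖ = 1) (hx : x ≠ 0) {g : SU2}
    (hg : (g : Matrix (Fin 2) (Fin 2) ℂ) = quat a) : proj (qmul a x) = g * proj x := by
  have hne : qmul a x ≠ 0 := by
    rw [← norm_ne_zero_iff, norm_qmul, ha, one_mul]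
    exact norm_ne_zero_iff.2 hx
  apply Subtype.ext
  rw [Submonoid.coe_mul, proj_coe hne, proj_coe hx, hg, ← quat_qmul, norm_qmul, ha, one_mul,
    map_smul]

end SU2

namespace SU2

theorem continuous_quat : Continuous quat := by
  have h : ∀ i, Continuous fun x : EuclideanSpace ℝ (Fin 4) => x i := fun i => by fun_prop
  have hc : ∀ f g : EuclideanSpace ℝ (Fin 4) → ℝ, Continuous f → Continuous g →
      Continuous fun x => (⟨f x, g x⟩ : ℂ) := fun f g hf hg => by
    have : (fun x => (⟨f x, g x⟩ : ℂ)) = fun x => (f x : ℂ) + g x * Complex.I := by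
      ext x; exact Complex.mk_eq_add_mul_I _ _
    rw [this]
    fun_prop
  refine continuous_matrix fun i j => ?_
  fin_cases i <;> fin_cases j
  · exact hc _ _ (h 0) (h 1)
  · exact hc _ _ (h 2).neg (h 3)
  · exact hc _ _ (h 2) (h 3)
  · exact hc _ _ (h 0) (h 1).neg

theorem measurable_proj : Measurable proj := by
  refine measurable_of_continuousOn_compl_singleton 0 ?_
  rw [Topology.IsInducing.subtypeVal.continuousOn_iff]
  have h : ContinuousOn (fun x : EuclideanSpace ℝ (Fin 4) => quat (‖x‖⁻¹ • x)) {0}ᶜ :=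
    continuous_quat.comp_continuousOn
      ((continuous_norm.continuousOn.inv₀ fun x hx => norm_ne_zero_iff.2 hx).smul continuousOn_id)
  exact h.congr fun x hx => proj_coe hx

/-- The normalised radial projection of Lebesgue measure. -/
noncomputable def projMeasure : Measure SU2 :=
  (volume (Metric.ball (0 : EuclideanSpace ℝ (Fin 4)) 1))⁻¹ •
    Measure.map proj (volume.restrict (Metric.ball (0 : EuclideanSpace ℝ (Fin 4)) 1))

theorem ball_pos : 0 < volume (Metric.ball (0 : EuclideanSpace ℝ (Fin 4)) 1) :=
  Metric.measure_ball_pos _ _ one_pos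

theorem ball_lt_top : volume (Metric.ball (0 : EuclideanSpace ℝ (Fin 4)) 1) < ⊤ :=
  measure_ball_lt_top

theorem projMeasure_apply {A : Set SU2} (hA : MeasurableSet A) :
    projMeasure A = (volume (Metric.ball (0 : EuclideanSpace ℝ (Fin 4)) 1))⁻¹ *
      volume (proj ⁻¹' A ∩ Metric.ball 0 1) := by
  rw [projMeasure, Measure.smul_apply, Measure.map_apply measurable_proj hA,
    Measure.restrict_apply (measurable_proj hA), smul_eq_mul]

instance : IsProbabilityMeasure projMeasure := by
  refine ⟨?_⟩
  rw [projMeasure_apply MeasurableSet.univ, Set.preimage_univ, Set.univ_inter]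
  exact ENNReal.inv_mul_cancel ball_pos.ne' ball_lt_top.ne

/-- Left multiplication by a unit quaternion is a linear isometry; it preserves Lebesgue measure and
the ball, and commutes with radial projection off the origin. -/
instance : projMeasure.IsMulLeftInvariant := by
  refine ⟨fun g => ?_⟩
  ext A hA
  obtain ⟨a, ha, hg⟩ := exists_quat_eq g
  have hmeas := measurable_const_mul g
  rw [Measure.map_apply hmeas hA, projMeasure_apply (hmeas hA), projMeasure_apply hA]
  congr 1
  let L : EuclideanSpace ℝ (Fin 4) →ₗᵢ[ℝ] EuclideanSpace ℝ (Fin 4) :=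
    ⟨qmul a, fun x => by rw [norm_qmul, ha, one_mul]⟩
  have hL := (L.toLinearIsometryEquiv rfl).measurePreserving
  have hLx : ∀ x, L.toLinearIsometryEquiv rfl x = qmul a x := fun _ => rfl
  rw [← hL.measure_preimage ((measurable_proj hA).inter
    Metric.isOpen_ball.measurableSet).nullMeasurableSet]
  refine measure_congr ?_
  have h0 : ∀ᵐ x : EuclideanSpace ℝ (Fin 4), x ≠ 0 :=
    (Set.countable_singleton 0).ae_notMem volume
  filter_upwards [h0] with x hx
  refine propext (and_congr ?_ ?_)
  · change g * proj x ∈ A ↔ proj (L.toLinearIsometryEquiv rfl x) ∈ A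
    rw [hLx, proj_qmul ha hx hg]
  · change x ∈ Metric.ball 0 1 ↔ L.toLinearIsometryEquiv rfl x ∈ Metric.ball 0 1
    simp

/-- The deviation `1 - cos ψ` of a group element from the unit element. -/
noncomputable def defect (g : SU2) : ℝ := 1 - (g : Matrix (Fin 2) (Fin 2) ℂ).trace.re / 2

theorem continuous_defect : Continuous defect := by
  have h : Continuous fun g : SU2 => (g : Matrix (Fin 2) (Fin 2) ℂ).trace :=
    Continuous.matrix_trace continuous_subtype_val
  exact continuous_const.sub ((Complex.continuous_re.comp h).div_const 2)

theorem defect_proj {x : EuclideanSpace ℝ (Fin 4)} (hx : x ≠ 0) :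
    defect (proj x) = 1 - x 0 / ‖x‖ := by
  rw [defect, proj_coe hx]
  simp [quat, Matrix.trace_fin_two]
  ring

theorem volume_defect_le (r : ℝ) : volume {g : SU2 | defect g ≤ r ^ 2} =
    (volume (Metric.ball (0 : EuclideanSpace ℝ (Fin 4)) 1))⁻¹ *
      volume (proj ⁻¹' {g : SU2 | defect g ≤ r ^ 2} ∩ Metric.ball 0 1) := by
  rw [← eq_volume projMeasure]
  exact projMeasure_apply (isClosed_le continuous_defect continuous_const).measurableSet

theorem volume_box (a b : Fin 4 → ℝ) :
    volume {x : EuclideanSpace ℝ (Fin 4) | ∀ i, a i ≤ x i ∧ x i ≤ b i} =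
      ∏ i, ENNReal.ofReal (b i - a i) := by
  have h := (EuclideanSpace.volume_preserving_symm_measurableEquiv_toLp (Fin 4)).measure_preimage
    (s := Set.Icc a b) measurableSet_Icc.nullMeasurableSet
  rw [Real.volume_Icc_pi] at h
  rw [← h]
  congr 1
  ext x
  simp only [Set.mem_ofPred_eq, Set.mem_preimage, Set.mem_Icc, Pi.le_def]
  exact forall_and

/-- The cone over the set, cut by the unit ball, satisfies `x₁² + x₂² + x₃² ≤ 2 r²`, so it lies in a
box with one side `2` and three sides `4 r`. -/
theorem exists_volume_defect_le : ∃ C : ℝ, 0 < C ∧ ∀ r : ℝ, 0 ≤ r →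
    volume {g : SU2 | defect g ≤ r ^ 2} ≤ ENNReal.ofReal (C * r ^ 3) := by
  obtain ⟨V, hV⟩ : ∃ V, V = (volume (Metric.ball (0 : EuclideanSpace ℝ (Fin 4)) 1))⁻¹ := ⟨_, rfl⟩
  have hV0 : V ≠ 0 := by rw [hV]; exact ENNReal.inv_ne_zero.2 ball_lt_top.ne
  have hVt : V ≠ ⊤ := by rw [hV]; exact ENNReal.inv_ne_top.2 ball_pos.ne'
  refine ⟨V.toReal * 128, by have := ENNReal.toReal_pos hV0 hVt; positivity, fun r hr => ?_⟩
  rw [volume_defect_le, ← hV, mul_assoc, ENNReal.ofReal_mul ENNReal.toReal_nonneg,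
    ENNReal.ofReal_toReal hVt]
  gcongr
  have hbox := volume_box ![-1, -(2 * r), -(2 * r), -(2 * r)] ![1, 2 * r, 2 * r, 2 * r]
  calc _ ≤ volume ({x : EuclideanSpace ℝ (Fin 4) |
        ∀ i, ![-1, -(2 * r), -(2 * r), -(2 * r)] i ≤ x i ∧ x i ≤ ![1, 2 * r, 2 * r, 2 * r] i}) := ?_
    _ = ENNReal.ofReal (128 * r ^ 3) := by
      rw [hbox, ← ENNReal.ofReal_prod_of_nonneg]
      · congr 1
        simp [Fin.prod_univ_four]; ring
      · intro i _
        fin_cases i <;> simp <;> linarith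
  refine measure_mono fun x hx => ?_
  obtain ⟨hx, hx1⟩ := hx
  rw [mem_ball_zero_iff] at hx1
  have hsq := norm_sq_eq x
  have hn := norm_nonneg x
  have hx2 : ‖x‖ ^ 2 ≤ 1 := by nlinarith
  have h0 : (x 0) ^ 2 ≤ 1 := by nlinarith [sq_nonneg (x 1), sq_nonneg (x 2), sq_nonneg (x 3)]
  have hrest : x 1 ^ 2 + x 2 ^ 2 + x 3 ^ 2 ≤ 2 * r ^ 2 := by
    by_cases hx0 : x = 0
    · subst hx0
      simp
      positivity
    rw [Set.mem_preimage, Set.mem_ofPred_eq, defect_proj hx0] at hx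
    have hpos : 0 < ‖x‖ := norm_pos_iff.2 hx0
    by_cases hr1 : r ^ 2 ≤ 1
    · have h1 : (1 - r ^ 2) * ‖x‖ ≤ x 0 := by
        have : 1 - r ^ 2 ≤ x 0 / ‖x‖ := by linarith
        rwa [le_div_iff₀ hpos] at this
      have h2 : ((1 - r ^ 2) * ‖x‖) ^ 2 ≤ x 0 ^ 2 :=
        pow_le_pow_left₀ (mul_nonneg (by linarith) hn) h1 2
      nlinarith [sq_nonneg (r ^ 2 * ‖x‖), sq_nonneg r]
    · nlinarith [sq_nonneg (x 0)]
  have hle : ∀ t : ℝ, t ^ 2 ≤ 2 * r ^ 2 → -(2 * r) ≤ t ∧ t ≤ 2 * r := fun t ht =>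
    abs_le.1 (abs_le_of_sq_le_sq (by nlinarith [sq_nonneg r]) (by linarith))
  have e1 := hle (x 1) (by nlinarith [sq_nonneg (x 2), sq_nonneg (x 3)])
  have e2 := hle (x 2) (by nlinarith [sq_nonneg (x 1), sq_nonneg (x 3)])
  have e3 := hle (x 3) (by nlinarith [sq_nonneg (x 2), sq_nonneg (x 1)])
  intro i
  fin_cases i
  · exact abs_le.1 (abs_le_of_sq_le_sq (by simpa using h0) zero_le_one)
  · exact e1
  · exact e2
  · exact e3

/-- The cone contains a box with one side `1 / 4` and three sides `r / 4`, at distance of order one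
from the origin. -/
theorem exists_le_volume_defect : ∃ C : ℝ, 0 < C ∧ ∀ r : ℝ, 0 ≤ r → r ≤ 1 →
    ENNReal.ofReal (C * r ^ 3) ≤ volume {g : SU2 | defect g ≤ r ^ 2} := by
  obtain ⟨V, hV⟩ : ∃ V, V = (volume (Metric.ball (0 : EuclideanSpace ℝ (Fin 4)) 1))⁻¹ := ⟨_, rfl⟩
  have hV0 : V ≠ 0 := by rw [hV]; exact ENNReal.inv_ne_zero.2 ball_lt_top.ne
  have hVt : V ≠ ⊤ := by rw [hV]; exact ENNReal.inv_ne_top.2 ball_pos.ne'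
  refine ⟨V.toReal * (1 / 256), by have := ENNReal.toReal_pos hV0 hVt; positivity,
    fun r hr hr1 => ?_⟩
  rw [volume_defect_le, ← hV, mul_assoc, ENNReal.ofReal_mul ENNReal.toReal_nonneg,
    ENNReal.ofReal_toReal hVt]
  gcongr
  have hbox := volume_box ![1 / 4, -(r / 8), -(r / 8), -(r / 8)] ![1 / 2, r / 8, r / 8, r / 8]
  calc
    ENNReal.ofReal (1 / 256 * r ^ 3) = volume ({x : EuclideanSpace ℝ (Fin 4) |
        ∀ i, ![1 / 4, -(r / 8), -(r / 8), -(r / 8)] i ≤ x i ∧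
          x i ≤ ![1 / 2, r / 8, r / 8, r / 8] i}) := by
      rw [hbox, ← ENNReal.ofReal_prod_of_nonneg]
      · congr 1
        simp [Fin.prod_univ_four]; ring
      · intro i _
        fin_cases i <;> simp <;> linarith
    _ ≤ _ := ?_
  refine measure_mono fun x hx => ?_
  have h0 := hx 0
  have h1 := hx 1
  have h2 := hx 2
  have h3 := hx 3
  simp only [Matrix.cons_val] at h0 h1 h2 h3
  have hsq := norm_sq_eq x
  have hn := norm_nonneg x
  have hle : ∀ t : ℝ, -(r / 8) ≤ t ∧ t ≤ r / 8 → t ^ 2 ≤ r ^ 2 / 64 := fun t ht => by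
    nlinarith [ht.1, ht.2]
  have e1 := hle _ h1
  have e2 := hle _ h2
  have e3 := hle _ h3
  have hx0 : x ≠ 0 := by
    rintro rfl
    have := h0.1
    norm_num at this
  have hpos : 0 < ‖x‖ := norm_pos_iff.2 hx0
  have hge : x 0 ≤ ‖x‖ := by
    refine le_of_sq_le_sq ?_ hn
    nlinarith [sq_nonneg (x 1), sq_nonneg (x 2), sq_nonneg (x 3)]
  refine ⟨?_, ?_⟩
  · rw [Set.mem_preimage, Set.mem_ofPred_eq, defect_proj hx0]
    have : 1 - r ^ 2 ≤ x 0 / ‖x‖ := by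
      rw [le_div_iff₀ hpos]
      nlinarith [mul_nonneg (sq_nonneg r) (sub_nonneg.2 hge), h0.1]
    linarith
  · rw [mem_ball_zero_iff]
    nlinarith [h0.1, h0.2]

end SU2

namespace SU2

/-! ### Gaussian bounds of the heat kernel -/

/-! ### Gaussian bounds of the odd theta kernel -/

section OddKernel

open Real

variable {T : ℝ}

/-- Mean value inequality on an interval of length `2 h`, where with `u = π x² T` the derivative is
controlled by `|1 - 2 u| e^(-u) ≤ 4 e^(-u/2)`. -/
theorem abs_mul_exp_sub_le (hT : 0 ≤ T) {p h : ℝ} (hh : 0 ≤ h) (hp : h ≤ p) :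
    |(p + h) * exp (-π * (p + h) ^ 2 * T) - (p - h) * exp (-π * (p - h) ^ 2 * T)| ≤
      8 * h * exp (-π * (p - h) ^ 2 * T / 2) := by
  have hderiv : ∀ x ∈ Set.Icc (p - h) (p + h),
      HasDerivWithinAt (fun x => x * exp (-π * x ^ 2 * T))
        ((1 - 2 * (π * x ^ 2 * T)) * exp (-π * x ^ 2 * T)) (Set.Icc (p - h) (p + h)) x := by
    intro x _
    have h1 : HasDerivAt (fun x : ℝ => -π * x ^ 2 * T) (-π * (2 * x) * T) x := by
      simpa using ((hasDerivAt_pow 2 x).const_mul (-π)).mul_const T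
    have h2 := (hasDerivAt_id x).mul h1.exp
    refine (h2.congr_deriv ?_).hasDerivWithinAt
    simp only [id]
    ring
  have hbound : ∀ x ∈ Set.Icc (p - h) (p + h),
      ‖(1 - 2 * (π * x ^ 2 * T)) * exp (-π * x ^ 2 * T)‖ ≤
        4 * exp (-π * (p - h) ^ 2 * T / 2) := by
    intro x hx
    have hu : 0 ≤ π * x ^ 2 * T := by positivity
    have h1 : |1 - 2 * (π * x ^ 2 * T)| ≤ 4 * exp (π * x ^ 2 * T / 2) := by
      have := add_one_le_exp (π * x ^ 2 * T / 2)
      rw [abs_le]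
      constructor <;> linarith
    have hsq : (p - h) ^ 2 ≤ x ^ 2 := pow_le_pow_left₀ (by linarith) hx.1 2
    have hmul : π * (p - h) ^ 2 * T ≤ π * x ^ 2 * T := by gcongr
    calc ‖(1 - 2 * (π * x ^ 2 * T)) * exp (-π * x ^ 2 * T)‖
        = |1 - 2 * (π * x ^ 2 * T)| * exp (-π * x ^ 2 * T) := by
          rw [norm_mul, norm_eq_abs, norm_of_nonneg (exp_nonneg _)]
      _ ≤ 4 * exp (π * x ^ 2 * T / 2) * exp (-π * x ^ 2 * T) := by gcongr
      _ = 4 * exp (-(π * x ^ 2 * T) / 2) := by rw [mul_assoc, ← exp_add]; ring_nf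
      _ ≤ _ := by gcongr; linarith
  have := Convex.norm_image_sub_le_of_norm_hasDerivWithin_le hderiv hbound (convex_Icc _ _)
    (Set.left_mem_Icc.2 (by linarith)) (Set.right_mem_Icc.2 (by linarith))
  rw [norm_eq_abs, norm_eq_abs, show p + h - (p - h) = 2 * h by ring,
    abs_of_nonneg (by linarith : 0 ≤ 2 * h)] at this
  linarith

theorem exp_neg_le_half {y : ℝ} (hy : 1 ≤ y) : exp (-y) ≤ 1 / 2 := by
  rw [exp_neg, ← one_div]
  exact one_div_le_one_div_of_le two_pos (by linarith [add_one_le_exp y])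

theorem abs_hasSum_le {f : ℕ → ℝ} {S C y : ℝ} (hf : HasSum f S) (hC : 0 ≤ C) (hy : 1 ≤ y)
    (h : ∀ n : ℕ, |f n| ≤ C * exp (-y * (n + 1))) : |S| ≤ 2 * C * exp (-y) := by
  have hq := exp_neg_le_half hy
  have hgeo := ((hasSum_geometric_of_lt_one (exp_nonneg (-y)) (by linarith)).mul_left
    (C * exp (-y)))
  have h1 := hf.norm_le_of_bounded hgeo fun n => by
    rw [norm_eq_abs, mul_assoc, ← pow_succ', ← exp_nat_mul]
    convert! h n using 3
    push_cast; ring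
  rw [norm_eq_abs] at h1
  have h2 : (1 - exp (-y))⁻¹ ≤ 2 := by
    rw [inv_le_comm₀ (by linarith) two_pos]; linarith
  calc |S| ≤ C * exp (-y) * (1 - exp (-y))⁻¹ := h1
    _ ≤ C * exp (-y) * 2 := by gcongr
    _ = _ := by ring

/-- Pairing the terms `n + 1` and `-(n + 1)` makes the error proportional to `a`; this factor is
needed because the kernel will be divided by `sin ψ`. -/
theorem abs_oddKernel_sub_le (hT : 12 ≤ T) {a : ℝ} (h0 : 0 ≤ a) (h1 : a ≤ 1 / 4) :
    |HurwitzZeta.oddKernel a T - a * exp (-π * a ^ 2 * T)| ≤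
      16 * a * exp (-(9 * (π * T / 32))) := by
  have hy : 1 ≤ π * T / 32 := by nlinarith [pi_gt_three]
  have h := (HurwitzZeta.hasSum_int_oddKernel a (by linarith : 0 < T)).nat_add_neg
  have h' := (hasSum_nat_add_iff' 1).2 h
  simp only [Finset.sum_range_one] at h'
  have h2 := abs_hasSum_le (C := 8 * a) (y := 9 * (π * T / 32)) h' (by linarith) (by linarith) (by
    intro n
    have h3 := abs_mul_exp_sub_le (by linarith : 0 ≤ T) h0
      (p := n + 1) (by have : (0 : ℝ) ≤ n := n.cast_nonneg
                       linarith)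
    push_cast
    have e : (-((n : ℝ) + 1) + a) * exp (-π * (-((n : ℝ) + 1) + a) ^ 2 * T) =
        -(((n : ℝ) + 1 - a) * exp (-π * ((n : ℝ) + 1 - a) ^ 2 * T)) := by
      rw [show (-((n : ℝ) + 1) + a) ^ 2 = ((n : ℝ) + 1 - a) ^ 2 by ring]; ring
    rw [e, ← sub_eq_add_neg]
    refine h3.trans ?_
    gcongr
    have hn : (0 : ℝ) ≤ n := n.cast_nonneg
    have h4 : 9 / 16 * ((n : ℝ) + 1) ≤ ((n : ℝ) + 1 - a) ^ 2 := by nlinarith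
    have h5 : π * T * (9 / 16 * ((n : ℝ) + 1)) ≤ π * T * ((n : ℝ) + 1 - a) ^ 2 := by gcongr
    linarith)
  convert h2 using 2
  · simp
  · ring

/-- Near the antipode the terms `n` and `-(n + 1)` cancel at `b = 0`; pairing them gives the factor
`b` that compensates the zero of `sin ψ` at `π`. -/
theorem abs_oddKernel_half_sub_le (hT : 12 ≤ T) {b : ℝ} (h0 : 0 ≤ b) (h1 : b ≤ 1 / 4) :
    |HurwitzZeta.oddKernel ((1 / 2 - b : ℝ) : UnitAddCircle) T| ≤
      16 * b * exp (-(π * T / 32)) := by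
  have hy : 1 ≤ π * T / 32 := by nlinarith [pi_gt_three]
  have h := (HurwitzZeta.hasSum_int_oddKernel (1 / 2 - b)
    (by linarith : 0 < T)).nat_add_neg_add_one
  have h2 := abs_hasSum_le (C := 8 * b) (y := π * T / 32) h (by linarith) hy (by
    intro n
    have hn : (0 : ℝ) ≤ n := n.cast_nonneg
    have h3 := abs_mul_exp_sub_le (by linarith : 0 ≤ T) h0 (p := n + 1 / 2) (by linarith)
    push_cast
    have e1 : (n : ℝ) + (1 / 2 - b) = n + 1 / 2 - b := by ring
    have e : (-((n : ℝ) + 1) + (1 / 2 - b)) * exp (-π * (-((n : ℝ) + 1) + (1 / 2 - b)) ^ 2 * T) =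
        -(((n : ℝ) + 1 / 2 + b) * exp (-π * ((n : ℝ) + 1 / 2 + b) ^ 2 * T)) := by
      rw [show (-((n : ℝ) + 1) + (1 / 2 - b)) ^ 2 = ((n : ℝ) + 1 / 2 + b) ^ 2 by ring]; ring
    rw [e, e1, ← sub_eq_add_neg, abs_sub_comm]
    refine h3.trans ?_
    gcongr
    have h4 : ((n : ℝ) + 1) / 16 ≤ ((n : ℝ) + 1 / 2 - b) ^ 2 := by nlinarith
    have h5 : π * T * (((n : ℝ) + 1) / 16) ≤ π * T * ((n : ℝ) + 1 / 2 - b) ^ 2 := by gcongr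
    linarith)
  refine h2.trans (le_of_eq ?_)
  ring

theorem oddKernel_bounds (hT : 12 ≤ T) {a : ℝ} (h0 : 0 ≤ a) (h1 : a ≤ 1 / 4) :
    1 / 2 * a * exp (-π * a ^ 2 * T) ≤ HurwitzZeta.oddKernel a T ∧
      HurwitzZeta.oddKernel a T ≤ 2 * a * exp (-π * a ^ 2 * T) := by
  have hy : 1 ≤ π * T / 32 := by nlinarith [pi_gt_three]
  have h := abs_le.1 (abs_oddKernel_sub_le hT h0 h1)
  -- With `y = π T / 32`, seven of the nine factors `e^(-y) ≤ 1 / 2` absorb the constant; the other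
  -- two dominate the Gaussian, as `a ≤ 1 / 4`.
  have h2 : 16 * exp (-(9 * (π * T / 32))) ≤ 1 / 2 * exp (-π * a ^ 2 * T) := by
    have h3 : exp (-(π * T / 32)) ^ 7 ≤ (1 / 2) ^ 7 :=
      pow_le_pow_left₀ (exp_nonneg _) (exp_neg_le_half hy) 7
    have h4 : exp (-(2 * (π * T / 32))) ≤ exp (-π * a ^ 2 * T) := by
      gcongr
      have : π * T * a ^ 2 ≤ π * T * (1 / 4) ^ 2 := by gcongr
      linarith
    have h5 : exp (-(9 * (π * T / 32))) =
        exp (-(π * T / 32)) ^ 7 * exp (-(2 * (π * T / 32))) := by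
      rw [← exp_nat_mul, ← exp_add]; congr 1; push_cast; ring
    rw [h5]
    have h6 := mul_le_mul h3 h4 (exp_nonneg _) (by positivity)
    have := exp_nonneg (-π * a ^ 2 * T)
    linarith
  have h3 := mul_le_mul_of_nonneg_left h2 h0
  constructor <;> nlinarith [mul_nonneg h0 (exp_nonneg (-π * a ^ 2 * T))]

end OddKernel

/-! ### The heat kernel as a theta function -/

section HeatKernel

open Real

/-- From `U_{n+1} = X U_n + T_{n+1}` and `|T_{n+1}| ≤ 1`. The bound is attained at `t = 1`, whence
the heat kernel is largest at the unit. -/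
theorem abs_eval_U_le {t : ℝ} (ht : |t| ≤ 1) (n : ℕ) :
    |(Polynomial.Chebyshev.U ℝ (n : ℤ)).eval t| ≤ n + 1 := by
  induction n with
  | zero => simp
  | succ n ih =>
    have hT : |(Polynomial.Chebyshev.T ℝ ((n : ℤ) + 1)).eval t| ≤ 1 := by
      obtain ⟨h1, h2⟩ := abs_le.1 ht
      rw [← cos_arccos h1 h2, Polynomial.Chebyshev.T_real_cos]
      exact abs_cos_le_one _
    push_cast
    rw [Polynomial.Chebyshev.U_eq_X_mul_U_add_T, Polynomial.eval_add, Polynomial.eval_mul,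
      Polynomial.eval_X]
    refine (abs_add_le _ _).trans (add_le_add ?_ hT)
    rw [abs_mul]
    exact (mul_le_of_le_one_left (abs_nonneg _) ht).trans ih

/-- The coefficient of the character of spin `n / 2` in the heat kernel. -/
noncomputable def coeff (α : ℝ) (n : ℕ) : ℝ :=
  (2 * ((n : ℝ) / 2) + 1) * exp (-α * (((n : ℝ) / 2) * ((n : ℝ) / 2 + 1)))

/-- The heat kernel as a function of half the trace. -/
noncomputable def kernelOfTrace (α t : ℝ) : ℝ :=
  ∑' n : ℕ, coeff α n * (Polynomial.Chebyshev.U ℝ (n : ℤ)).eval t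

theorem heatKernel_eq (α : ℝ) (g : SU2) :
    heatKernel α g = kernelOfTrace α (1 - defect g) := by
  simp [heatKernel, kernelOfTrace, coeff, character, defect]

variable {α : ℝ}

theorem coeff_pos (n : ℕ) : 0 < coeff α n := by unfold coeff; positivity

theorem summable_coeff (hα : 0 < α) : Summable fun n : ℕ => coeff α n * (n + 1) := by
  have hr : ‖exp (-α / 2)‖ < 1 := by
    rw [norm_of_nonneg (exp_nonneg _), exp_lt_one_iff]; linarith
  have h := ((summable_pow_mul_geometric_of_norm_lt_one 2 hr).add
    ((summable_pow_mul_geometric_of_norm_lt_one 1 hr).mul_left 2)).add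
    (summable_pow_mul_geometric_of_norm_lt_one 0 hr)
  refine Summable.of_nonneg_of_le (fun n => by have := coeff_pos (α := α) n; positivity)
    (fun n => ?_) h
  have h1 : exp (-α * (((n : ℝ) / 2) * ((n : ℝ) / 2 + 1))) ≤ exp (-α / 2) ^ n := by
    rw [← exp_nat_mul, exp_le_exp]
    nlinarith [mul_nonneg hα.le (sq_nonneg (n : ℝ))]
  calc coeff α n * (n + 1) =
        (n + 1) ^ 2 * exp (-α * (((n : ℝ) / 2) * ((n : ℝ) / 2 + 1))) := by unfold coeff; ring
    _ ≤ (n + 1) ^ 2 * exp (-α / 2) ^ n := by gcongr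
    _ = _ := by ring

theorem abs_term_le {t : ℝ} (ht : t ∈ Set.Icc (-1 : ℝ) 1) (n : ℕ) :
    ‖coeff α n * (Polynomial.Chebyshev.U ℝ (n : ℤ)).eval t‖ ≤ coeff α n * (n + 1) := by
  rw [norm_mul, norm_of_nonneg (coeff_pos n).le, norm_eq_abs]
  exact mul_le_mul_of_nonneg_left (abs_eval_U_le (abs_le.2 ht) n) (coeff_pos n).le

theorem continuousOn_kernelOfTrace (hα : 0 < α) :
    ContinuousOn (kernelOfTrace α) (Set.Icc (-1) 1) :=
  continuousOn_tsum (fun _ => (continuous_const.mul (Polynomial.continuous _)).continuousOn)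
    (summable_coeff hα) fun n _ ht => abs_term_le ht n

theorem kernelOfTrace_one : kernelOfTrace α 1 = ∑' n : ℕ, coeff α n * (n + 1) := by
  simp [kernelOfTrace]

theorem abs_kernelOfTrace_le (hα : 0 < α) {t : ℝ} (ht : t ∈ Set.Icc (-1 : ℝ) 1) :
    |kernelOfTrace α t| ≤ kernelOfTrace α 1 := by
  rw [kernelOfTrace_one]
  exact tsum_of_norm_bounded (summable_coeff hα).hasSum (abs_term_le ht)

/-- Completing the square, `j (j + 1) = ((n + 1)² - 1) / 4` for `j = n / 2`, turns the series into a
sine theta series times `e^(α/4) / 2`. The functional equation converts small `α` into large `T = 4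
π / α`. -/
theorem kernelOfTrace_cos (hα : 0 < α) (ψ : ℝ) : kernelOfTrace α (cos ψ) * sin ψ =
    exp (α / 4) / 2 * (4 * π / α) ^ (3 / 2 : ℝ) *
      HurwitzZeta.oddKernel ((ψ / (2 * π) : ℝ) : UnitAddCircle) (4 * π / α) := by
  have hT : 0 < 4 * π / α := by positivity
  rw [HurwitzZeta.oddKernel_functional_equation]
  have hs := HurwitzZeta.hasSum_nat_sinKernel (ψ / (2 * π)) (one_div_pos.2 hT)
  have hs' := (hasSum_nat_add_iff' 1).2 hs
  simp only [Finset.sum_range_one, Nat.cast_zero, mul_zero, zero_mul, sub_zero] at hs'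
  have hk : HasSum (fun n : ℕ => coeff α n * (Polynomial.Chebyshev.U ℝ (n : ℤ)).eval (cos ψ) * sin ψ)
      (kernelOfTrace α (cos ψ) * sin ψ) := by
    refine HasSum.mul_right _ (Summable.hasSum ?_)
    exact Summable.of_norm_bounded (summable_coeff hα)
      (abs_term_le ⟨neg_one_le_cos ψ, cos_le_one ψ⟩)
  have heq := (hs'.mul_left (exp (α / 4) / 2)).unique (?_ : HasSum _ (kernelOfTrace α (cos ψ) * sin ψ))
  · rw [← heq, mul_assoc, ← mul_assoc (_ ^ (3 / 2 : ℝ)), mul_one_div_cancel (by positivity), one_mul]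
  · convert! hk using 2 with n
    rw [mul_assoc (coeff α n), Polynomial.Chebyshev.U_real_cos]
    have h1 : exp (α / 4) * exp (-π * ((n + 1 : ℕ) : ℝ) ^ 2 * (1 / (4 * π / α))) =
        exp (-α * (((n : ℝ) / 2) * ((n : ℝ) / 2 + 1))) := by
      rw [← exp_add]
      congr 1
      push_cast
      field_simp
      ring
    have h2 : 2 * π * (ψ / (2 * π)) * ((n + 1 : ℕ) : ℝ) = (((n : ℤ) : ℝ) + 1) * ψ := by
      push_cast
      field_simp
    rw [h2, coeff, ← h1]
    push_cast
    ring

/-- The order of magnitude of the heat kernel at the unit element. -/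
noncomputable def scale (α : ℝ) : ℝ := (4 * π / α) ^ (3 / 2 : ℝ)

theorem scale_pos (hα : 0 < α) : 0 < scale α := by unfold scale; positivity

theorem exp_quarter_le : exp (1 / 4) ≤ 2 := by
  have h1 : exp (1 / 4) ^ 4 = exp 1 := by rw [← exp_nat_mul]; norm_num
  by_contra h
  have := pow_lt_pow_left₀ (not_le.1 h) (by norm_num) (show 4 ≠ 0 by norm_num)
  rw [h1] at this
  linarith [exp_one_lt_d9]

/-- Jordan's inequality handles the division by `sin ψ` on each half of `(0, π)`. The exponent is
weakened to `(1 - cos ψ) / (2 α)` so that one formula covers both halves. -/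
theorem abs_kernelOfTrace_cos_le (hα : 0 < α) (hα1 : α ≤ 1) {ψ : ℝ} (h0 : 0 < ψ) (h1 : ψ < π) :
    |kernelOfTrace α (cos ψ)| ≤ 4 * scale α * exp (-(1 - cos ψ) / (2 * α)) := by
  have hπ := pi_pos
  have hT : 12 ≤ 4 * π / α := by
    rw [le_div_iff₀ hα]; nlinarith [pi_gt_three]
  have hsin := sin_pos_of_pos_of_lt_pi h0 h1
  have hκ := scale_pos hα
  have he : exp (α / 4) / 2 ≤ 1 := by
    have : exp (α / 4) ≤ exp (1 / 4) := exp_le_exp.2 (by linarith)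
    linarith [exp_quarter_le]
  have he0 : 0 ≤ exp (α / 4) / 2 := by positivity
  have heq := kernelOfTrace_cos hα ψ
  rw [← scale] at heq
  refine le_of_mul_le_mul_right ?_ hsin
  rw [← abs_of_pos hsin, ← abs_mul, heq, abs_of_pos hsin, abs_mul,
    abs_of_nonneg (by positivity : 0 ≤ exp (α / 4) / 2 * scale α)]
  have hF : ∀ F E : ℝ, |F| ≤ E → exp (α / 4) / 2 * scale α * |F| ≤ scale α * E := fun F E h => by
    have h2 : exp (α / 4) / 2 * scale α ≤ 1 * scale α := by gcongr
    rw [one_mul] at h2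
    exact mul_le_mul h2 h (abs_nonneg _) hκ.le
  rcases le_total ψ (π / 2) with h | h
  · obtain ⟨h2, h3⟩ := oddKernel_bounds hT (a := ψ / (2 * π)) (by positivity) (by
      rw [div_le_iff₀ (by positivity)]; linarith)
    have h4 : 2 / π * ψ ≤ sin ψ := mul_le_sin h0.le h
    have h5 : exp (-π * (ψ / (2 * π)) ^ 2 * (4 * π / α)) ≤ exp (-(1 - cos ψ) / (2 * α)) := by
      rw [exp_le_exp]
      have e1 : -π * (ψ / (2 * π)) ^ 2 * (4 * π / α) = -ψ ^ 2 / α := by field_simp; ring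
      rw [e1, div_le_div_iff₀ hα (by positivity)]
      nlinarith [one_sub_sq_div_two_le_cos (x := ψ), mul_nonneg hα.le (sq_nonneg ψ)]
    refine (hF _ _ (abs_le.2 ⟨?_, h3⟩)).trans ?_
    · exact le_trans (neg_nonpos.2 (by positivity)) (le_trans (by positivity) h2)
    · calc scale α * (2 * (ψ / (2 * π)) * exp (-π * (ψ / (2 * π)) ^ 2 * (4 * π / α)))
          = 1 / 2 * scale α * exp (-π * (ψ / (2 * π)) ^ 2 * (4 * π / α)) * (2 / π * ψ) := by
            field_simp
        _ ≤ 4 * scale α * exp (-(1 - cos ψ) / (2 * α)) * sin ψ := by gcongr; norm_num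
  · have h2 := abs_oddKernel_half_sub_le hT (b := 1 / 2 - ψ / (2 * π))
      (by rw [sub_nonneg, div_le_iff₀ (by positivity)]; linarith)
      (by rw [sub_le_comm, le_div_iff₀ (by positivity)]; linarith)
    rw [sub_sub_cancel] at h2
    have h4 : 2 / π * (π - ψ) ≤ sin ψ := by
      rw [← sin_pi_sub]
      exact mul_le_sin (by linarith) (by linarith)
    have h5 : exp (-(π * (4 * π / α) / 32)) ≤ exp (-(1 - cos ψ) / (2 * α)) := by
      rw [exp_le_exp]
      have e1 : -(π * (4 * π / α) / 32) = -(π ^ 2 / 8) / α := by field_simp; ring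
      rw [e1, div_le_div_iff₀ hα (by positivity)]
      have h9 : 2 ≤ π ^ 2 / 4 := by nlinarith [pi_gt_three]
      nlinarith [neg_one_le_cos ψ, mul_nonneg hα.le (sub_nonneg.2 h9)]
    refine (hF _ _ h2).trans ?_
    calc scale α * (16 * (1 / 2 - ψ / (2 * π)) * exp (-(π * (4 * π / α) / 32)))
          = 4 * scale α * exp (-(π * (4 * π / α) / 32)) * (2 / π * (π - ψ)) := by
            field_simp; ring
        _ ≤ 4 * scale α * exp (-(1 - cos ψ) / (2 * α)) * sin ψ := by gcongr

/-- The factor `5` in the exponent comes from `1 - cos ψ ≥ 2 ψ² / π² ≥ ψ² / 5`. -/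
theorem le_kernelOfTrace_cos (hα : 0 < α) (hα1 : α ≤ 1) {ψ : ℝ} (h0 : 0 < ψ) (h1 : ψ ≤ π / 2) :
    1 / 32 * scale α * exp (-(5 * (1 - cos ψ)) / α) ≤ kernelOfTrace α (cos ψ) := by
  have hπ := pi_pos
  have hT : 12 ≤ 4 * π / α := by
    rw [le_div_iff₀ hα]; nlinarith [pi_gt_three]
  have hsin := sin_pos_of_pos_of_lt_pi h0 (by linarith)
  have hκ := scale_pos hα
  have he : 1 / 2 ≤ exp (α / 4) / 2 := by
    have : 1 ≤ exp (α / 4) := one_le_exp (by positivity)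
    linarith
  have heq := kernelOfTrace_cos hα ψ
  rw [← scale] at heq
  refine le_of_mul_le_mul_right ?_ hsin
  rw [heq]
  obtain ⟨h2, -⟩ := oddKernel_bounds hT (a := ψ / (2 * π)) (by positivity) (by
      rw [div_le_iff₀ (by positivity)]; linarith)
  have h5 : exp (-(5 * (1 - cos ψ)) / α) ≤ exp (-π * (ψ / (2 * π)) ^ 2 * (4 * π / α)) := by
    rw [exp_le_exp]
    have e1 : -π * (ψ / (2 * π)) ^ 2 * (4 * π / α) = -ψ ^ 2 / α := by field_simp; ring
    rw [e1, div_le_div_iff_of_pos_right hα]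
    have h6 := cos_le_one_sub_mul_cos_sq (x := ψ) (by rw [abs_of_pos h0]; linarith)
    have h7 : 1 / 5 * ψ ^ 2 ≤ 2 / π ^ 2 * ψ ^ 2 := by
      refine mul_le_mul_of_nonneg_right ?_ (sq_nonneg ψ)
      rw [div_le_div_iff₀ (by norm_num) (by positivity)]
      nlinarith [pi_lt_d2]
    linarith
  have h8 : 1 / 32 ≤ 1 / (8 * π) := by
    rw [div_le_div_iff₀ (by norm_num) (by positivity)]; linarith [pi_lt_four]
  calc 1 / 32 * scale α * exp (-(5 * (1 - cos ψ)) / α) * sin ψ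
      ≤ 1 / (8 * π) * scale α * exp (-π * (ψ / (2 * π)) ^ 2 * (4 * π / α)) * ψ := by
        gcongr
        exact (sin_lt h0).le
    _ = 1 / 2 * scale α * (1 / 2 * (ψ / (2 * π)) *
          exp (-π * (ψ / (2 * π)) ^ 2 * (4 * π / α))) := by field_simp; ring
    _ ≤ _ := by gcongr

/-- The endpoints, where `sin ψ` vanishes, are reached by continuity. -/
theorem abs_kernelOfTrace_le_exp (hα : 0 < α) (hα1 : α ≤ 1) {t : ℝ} (ht : t ∈ Set.Icc (-1 : ℝ) 1) :
    |kernelOfTrace α t| ≤ 4 * scale α * exp (-(1 - t) / (2 * α)) := by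
  rw [← closure_Ioo (by norm_num)] at ht
  refine le_on_closure (s := Set.Ioo (-1 : ℝ) 1) (f := fun t => |kernelOfTrace α t|)
    (g := fun t => 4 * scale α * exp (-(1 - t) / (2 * α))) ?_ ?_ ?_ ht
  · intro t ht
    have := abs_kernelOfTrace_cos_le hα hα1 (arccos_pos.2 ht.2) (arccos_lt_pi.2 ht.1)
    rwa [cos_arccos ht.1.le ht.2.le] at this
  · rw [closure_Ioo (by norm_num)]
    exact (continuousOn_kernelOfTrace hα).abs
  · fun_prop

theorem le_kernelOfTrace (hα : 0 < α) (hα1 : α ≤ 1) {t : ℝ} (ht : t ∈ Set.Icc (0 : ℝ) 1) :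
    1 / 32 * scale α * exp (-(5 * (1 - t)) / α) ≤ kernelOfTrace α t := by
  rw [← closure_Ioo (by norm_num)] at ht
  refine le_on_closure (s := Set.Ioo (0 : ℝ) 1) (g := fun t => kernelOfTrace α t)
    (f := fun t => 1 / 32 * scale α * exp (-(5 * (1 - t)) / α)) ?_ ?_ ?_ ht
  · intro t ht
    have := le_kernelOfTrace_cos hα hα1 (arccos_pos.2 ht.2) (arccos_le_pi_div_two.2 ht.1.le)
    rwa [cos_arccos (by linarith [ht.1]) ht.2.le] at this
  · fun_prop
  · rw [closure_Ioo (by norm_num)]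
    exact (continuousOn_kernelOfTrace hα).mono (Set.Icc_subset_Icc (by norm_num) le_rfl)

end HeatKernel

end SU2

/-! ### Pointwise and integral bounds of the heat kernel on the group -/

namespace SU2

open Real in
theorem scale_mul_sqrt_pow {α : ℝ} (hα : 0 < α) : scale α * √α ^ 3 = (4 * π) ^ (3 / 2 : ℝ) := by
  have h : √α ^ 3 = α ^ (3 / 2 : ℝ) := by
    rw [sqrt_eq_rpow, ← rpow_natCast, ← rpow_mul hα.le]; norm_num
  rw [scale, div_rpow (by positivity) hα.le, h, div_mul_cancel₀ _ (by positivity)]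

theorem defect_eq {g : SU2} {a : EuclideanSpace ℝ (Fin 4)}
    (h : (g : Matrix (Fin 2) (Fin 2) ℂ) = quat a) : defect g = 1 - a 0 := by
  rw [defect, h]
  simp [quat, Matrix.trace_fin_two]

theorem one_sub_defect_mem (g : SU2) : 1 - defect g ∈ Set.Icc (-1 : ℝ) 1 := by
  obtain ⟨a, ha, hg⟩ := exists_quat_eq g
  have h := norm_sq_eq a
  rw [ha] at h
  rw [defect_eq hg, sub_sub_cancel]
  exact abs_le.1 (abs_le_of_sq_le_sq
    (by nlinarith [sq_nonneg (a 1), sq_nonneg (a 2), sq_nonneg (a 3)]) zero_le_one)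

theorem defect_nonneg (g : SU2) : 0 ≤ defect g := by
  linarith [(one_sub_defect_mem g).2]

@[simp] theorem defect_one : defect 1 = 0 := by
  simp [defect]

theorem defect_mul_comm (g h : SU2) : defect (g * h) = defect (h * g) := by
  rw [defect, defect, Submonoid.coe_mul, Submonoid.coe_mul, Matrix.trace_mul_comm]

theorem defect_inv (g : SU2) : defect g⁻¹ = defect g := by
  have : ((g⁻¹ : SU2) : Matrix (Fin 2) (Fin 2) ℂ) = star (g : Matrix (Fin 2) (Fin 2) ℂ) := rfl
  simp [defect, this, Matrix.trace_fin_two, Matrix.star_apply]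

/-- For unit quaternions `defect` is half the squared distance to `1`; this is the triangle
inequality combined with `(s + t)² ≤ 2 s² + 2 t²`. -/
theorem defect_mul_le (g h : SU2) : defect (g * h) ≤ 2 * defect g + 2 * defect h := by
  obtain ⟨a, ha, hg⟩ := exists_quat_eq g
  obtain ⟨b, hb, hh⟩ := exists_quat_eq h
  have hgh : ((g * h : SU2) : Matrix (Fin 2) (Fin 2) ℂ) = quat (qmul a b) := by
    rw [Submonoid.coe_mul, hg, hh, quat_qmul]
  have h1 := norm_sq_eq a
  have h2 := norm_sq_eq b
  rw [ha] at h1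
  rw [hb] at h2
  rw [defect_eq hg, defect_eq hh, defect_eq hgh]
  simp only [qmul, LinearMap.coe_mk, AddHom.coe_mk, Matrix.cons_val_zero]
  nlinarith [sq_nonneg (a 0 + b 0 - 2), sq_nonneg (a 1 - b 1), sq_nonneg (a 2 - b 2),
    sq_nonneg (a 3 - b 3)]

variable {α : ℝ}

theorem heatKernel_mul_comm (α : ℝ) (g h : SU2) :
    heatKernel α (g * h) = heatKernel α (h * g) := by
  rw [heatKernel_eq, heatKernel_eq, defect_mul_comm]

theorem heatKernel_inv (α : ℝ) (g : SU2) : heatKernel α g⁻¹ = heatKernel α g := by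
  rw [heatKernel_eq, heatKernel_eq, defect_inv]

theorem continuous_heatKernel (hα : 0 < α) : Continuous (heatKernel α) := by
  rw [funext (heatKernel_eq α)]
  exact (continuousOn_kernelOfTrace hα).comp_continuous
    (continuous_const.sub continuous_defect) one_sub_defect_mem

theorem abs_heatKernel_le (hα : 0 < α) (g : SU2) : |heatKernel α g| ≤ heatKernel α 1 := by
  rw [heatKernel_eq, heatKernel_eq, defect_one, sub_zero]
  exact abs_kernelOfTrace_le hα (one_sub_defect_mem g)

theorem scale_le_heatKernel_one (hα : 0 < α) (hα1 : α ≤ 1) :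
    1 / 32 * scale α ≤ heatKernel α 1 := by
  have := le_kernelOfTrace hα hα1 (t := 1) (by simp)
  rw [heatKernel_eq, defect_one, sub_zero]
  simpa using this

theorem heatKernel_one_le_scale (hα : 0 < α) (hα1 : α ≤ 1) : heatKernel α 1 ≤ 4 * scale α := by
  have := abs_kernelOfTrace_le_exp hα hα1 (t := 1) (by simp)
  rw [heatKernel_eq, defect_one, sub_zero]
  simpa using (le_abs_self _).trans this

theorem heatKernel_one_pos (hα : 0 < α) (hα1 : α ≤ 1) : 0 < heatKernel α 1 :=
  lt_of_lt_of_le (by have := scale_pos hα; positivity) (scale_le_heatKernel_one hα hα1)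

theorem eventually_mem_Ioc : ∀ᶠ α : ℝ in 𝓝[>] 0, 0 < α ∧ α ≤ 1 :=
  Ioc_mem_nhdsGT one_pos

theorem tendsto_heatKernel_one : Tendsto (fun α => heatKernel α 1) (𝓝[>] 0) atTop := by
  have h1 : Tendsto (fun α : ℝ => 4 * Real.pi / α) (𝓝[>] 0) atTop := by
    simpa [div_eq_mul_inv] using tendsto_inv_nhdsGT_zero.const_mul_atTop
      (show (0 : ℝ) < 4 * Real.pi by positivity)
  have h2 : Tendsto (fun α => 1 / 32 * scale α) (𝓝[>] 0) atTop :=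
    ((tendsto_rpow_atTop (by norm_num : (0 : ℝ) < 3 / 2)).comp h1).const_mul_atTop (by norm_num)
  refine tendsto_atTop_mono' _ ?_ h2
  filter_upwards [eventually_mem_Ioc] with α hα
  exact scale_le_heatKernel_one hα.1 hα.2

theorem le_heatKernel (hα : 0 < α) (hα1 : α ≤ 1) {g : SU2} (hg : defect g ≤ α) :
    1 / 32 * scale α * Real.exp (-5) ≤ heatKernel α g := by
  have h := le_kernelOfTrace hα hα1 (t := 1 - defect g)
    ⟨by linarith, by linarith [defect_nonneg g]⟩
  rw [heatKernel_eq]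
  refine le_trans ?_ h
  have := scale_pos hα
  gcongr
  rw [sub_sub_cancel, le_div_iff₀ hα]
  linarith

/-- A layer decomposition into balls; the single layer with index the integer part of `defect g / (2
α)` already suffices. -/
theorem exp_le_tsum_indicator (hα : 0 < α) (g : SU2) :
    ENNReal.ofReal (Real.exp (-defect g / (2 * α))) ≤ ∑' k : ℕ,
      ENNReal.ofReal (Real.exp (-k)) *
        ({g : SU2 | defect g ≤ √(2 * α * (k + 1)) ^ 2}.indicator 1 g) := by
  have hD := defect_nonneg g
  have h0 : 0 ≤ defect g / (2 * α) := by positivity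
  refine le_trans ?_ (ENNReal.le_tsum ⌊defect g / (2 * α)⌋₊)
  have h1 := Nat.lt_floor_add_one (defect g / (2 * α))
  rw [div_lt_iff₀ (by positivity)] at h1
  rw [Set.indicator_of_mem, Pi.one_apply, mul_one]
  · refine ENNReal.ofReal_le_ofReal (Real.exp_le_exp.2 ?_)
    rw [neg_div]
    exact neg_le_neg (Nat.floor_le h0)
  · rw [Set.mem_ofPred_eq, Real.sq_sqrt (by positivity)]
    linarith

/-- The peak has height of order `α^(-3/2)`, and the layer `k` has volume of order `(α (k +
1))^(3/2)` and weight `e^(-k)`; the powers of `α` cancel and the sum over `k` converges. -/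
theorem exists_lintegral_heatKernel_le : ∃ L : ℝ, 0 < L ∧ ∀ α : ℝ, 0 < α → α ≤ 1 →
    ∫⁻ g : SU2, ‖heatKernel α g‖ₑ ≤ ENNReal.ofReal L := by
  obtain ⟨C, hC, hvol⟩ := exists_volume_defect_le
  have hsum : Summable fun k : ℕ => Real.exp (-k) * ((k : ℝ) + 1) ^ 2 := by
    have hr : ‖Real.exp (-1)‖ < 1 := by
      rw [Real.norm_of_nonneg (Real.exp_nonneg _), Real.exp_lt_one_iff]; norm_num
    have h := ((summable_pow_mul_geometric_of_norm_lt_one 2 hr).add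
      ((summable_pow_mul_geometric_of_norm_lt_one 1 hr).mul_left 2)).add
      (summable_pow_mul_geometric_of_norm_lt_one 0 hr)
    refine h.congr fun k => ?_
    rw [← Real.exp_nat_mul]
    ring_nf
  obtain ⟨S, hS⟩ : ∃ S, S = ∑' k : ℕ, Real.exp (-k) * ((k : ℝ) + 1) ^ 2 := ⟨_, rfl⟩
  have hS0 : 0 ≤ S := hS ▸ tsum_nonneg fun k => by positivity
  refine ⟨4 * (C * √2 ^ 3 * S) * (4 * Real.pi) ^ (3 / 2 : ℝ) + 1, by positivity,
    fun α hα hα1 => ?_⟩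
  have hκ := scale_pos hα
  have hmeas : ∀ k : ℕ, MeasurableSet {g : SU2 | defect g ≤ √(2 * α * (k + 1)) ^ 2} := fun k =>
    (isClosed_le continuous_defect continuous_const).measurableSet
  calc ∫⁻ g : SU2, ‖heatKernel α g‖ₑ
      ≤ ∫⁻ g : SU2, ENNReal.ofReal (4 * scale α) * ∑' k : ℕ, ENNReal.ofReal (Real.exp (-k)) *
        ({g : SU2 | defect g ≤ √(2 * α * (k + 1)) ^ 2}.indicator 1 g) := by
        refine lintegral_mono fun g => ?_
        have h := abs_kernelOfTrace_le_exp hα hα1 (one_sub_defect_mem g)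
        rw [← heatKernel_eq, sub_sub_cancel] at h
        rw [← ofReal_norm, Real.norm_eq_abs]
        refine (ENNReal.ofReal_le_ofReal h).trans ?_
        rw [ENNReal.ofReal_mul (by positivity)]
        gcongr
        exact exp_le_tsum_indicator hα g
    _ = ENNReal.ofReal (4 * scale α) * ∑' k : ℕ, ENNReal.ofReal (Real.exp (-k)) *
        volume {g : SU2 | defect g ≤ √(2 * α * (k + 1)) ^ 2} := by
        rw [lintegral_const_mul' _ _ ENNReal.ofReal_ne_top, lintegral_tsum]
        · congr 2
          funext k
          rw [lintegral_const_mul' _ _ ENNReal.ofReal_ne_top, lintegral_indicator_one (hmeas k)]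
        · intro k
          exact ((measurable_one.indicator (hmeas k)).const_mul _).aemeasurable
    _ ≤ ENNReal.ofReal (4 * scale α) * ∑' k : ℕ,
        ENNReal.ofReal (C * √2 ^ 3 * √α ^ 3 * (Real.exp (-k) * ((k : ℝ) + 1) ^ 2)) := by
        gcongr with k
        rw [show C * √2 ^ 3 * √α ^ 3 * (Real.exp (-k) * ((k : ℝ) + 1) ^ 2) =
          Real.exp (-k) * (C * √2 ^ 3 * √α ^ 3 * ((k : ℝ) + 1) ^ 2) by ring,
          ENNReal.ofReal_mul (Real.exp_nonneg _)]
        gcongr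
        refine (hvol _ (Real.sqrt_nonneg _)).trans (ENNReal.ofReal_le_ofReal ?_)
        have hk : (1 : ℝ) ≤ k + 1 := by linarith [(k : ℕ).cast_nonneg (α := ℝ)]
        -- The power `3 / 2` is rounded up to `2` in order to use the summability of a polynomial
        -- times a geometric sequence.
        have h1 : √((k : ℝ) + 1) ^ 3 ≤ ((k : ℝ) + 1) ^ 2 := by
          have h2 : √((k : ℝ) + 1) ≤ k + 1 := by
            rw [Real.sqrt_le_left (by linarith)]; nlinarith
          calc √((k : ℝ) + 1) ^ 3 = √((k : ℝ) + 1) ^ 2 * √((k : ℝ) + 1) := by ring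
            _ = ((k : ℝ) + 1) * √((k : ℝ) + 1) := by rw [Real.sq_sqrt (by linarith)]
            _ ≤ ((k : ℝ) + 1) * (k + 1) := by gcongr
            _ = _ := by ring
        rw [Real.sqrt_mul (by positivity), Real.sqrt_mul (by norm_num)]
        calc C * (√2 * √α * √((k : ℝ) + 1)) ^ 3 = C * √2 ^ 3 * √α ^ 3 * √((k : ℝ) + 1) ^ 3 := by ring
          _ ≤ _ := by gcongr
    _ = ENNReal.ofReal (4 * scale α) * ENNReal.ofReal (C * √2 ^ 3 * √α ^ 3 * S) := by
        rw [hS, ← tsum_mul_left, ENNReal.ofReal_tsum_of_nonneg (fun k => by positivity)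
          (hsum.mul_left _)]
    _ = ENNReal.ofReal (4 * (C * √2 ^ 3 * S) * (scale α * √α ^ 3)) := by
        rw [← ENNReal.ofReal_mul (by positivity)]; congr 1; ring
    _ ≤ _ := by
        rw [scale_mul_sqrt_pow hα]
        exact ENNReal.ofReal_le_ofReal (by linarith)

end SU2

/-! ### Integration along a forest -/

/-- If every nonempty set of the nodes in `A` contains a node with a variable which the other nodes
of that set do not see, then the integral of a product over the nodes in `A` factorises. -/
theorem lintegral_prod_forest {I V S : Type*} [Fintype I] [DecidableEq I] [MeasureSpace S]
    [IsProbabilityMeasure (volume : Measure S)]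
    (sees : V → I → Prop) (ρ : V → (I → S) → S) (hρ : ∀ n, Measurable (ρ n))
    (hfix : ∀ n i, ¬ sees n i → ∀ h g, ρ n (Function.update h i g) = ρ n h)
    (hpres : ∀ n i, sees n i → ∀ h, MeasurePreserving fun g => ρ n (Function.update h i g))
    (φ : V → S → ENNReal) (hφ : ∀ n, Measurable (φ n)) (A : Finset V)
    (hA : ∀ T ⊆ A, T.Nonempty → ∃ i, ∃ n ∈ T, sees n i ∧ ∀ n' ∈ T, n' ≠ n → ¬ sees n' i) :
    ∫⁻ h : I → S, ∏ n ∈ A, φ n (ρ n h) = ∏ n ∈ A, ∫⁻ g, φ n g := by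
  classical
  induction A using Finset.strongInduction with
  | H A ih =>
    rcases A.eq_empty_or_nonempty with rfl | hne
    · simp
    obtain ⟨i, n, hn, hni, hother⟩ := hA A subset_rfl hne
    have hih := ih (A.erase n) (Finset.erase_ssubset hn)
      fun T hT hTne => hA T (hT.trans (Finset.erase_subset _ _)) hTne
    rw [← Finset.mul_prod_erase A _ hn, ← hih]
    have hP : Measurable fun h => ∏ m ∈ A.erase n, φ m (ρ m h) :=
      Finset.measurable_prod _ fun m _ => (hφ m).comp (hρ m)
    rw [← lintegral_const_mul _ hP]
    -- Integrating over the private variable `i` of `n` replaces the factor of `n` by its Haar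
    -- integral and leaves the other factors alone.
    refine lintegral_eq_of_lmarginal_eq {i}
      (Finset.measurable_prod _ fun m _ => (hφ m).comp (hρ m)) (hP.const_mul _) ?_
    have hPfix : ∀ (h : I → S) (g : S),
        ∏ m ∈ A.erase n, φ m (ρ m (Function.update h i g)) = ∏ m ∈ A.erase n, φ m (ρ m h) :=
      fun h g => Finset.prod_congr rfl fun m hm => by
        rw [hfix m i (hother m (Finset.mem_of_mem_erase hm) (Finset.ne_of_mem_erase hm))]
    rw [lmarginal_singleton, lmarginal_singleton]
    funext h
    simp only [← Finset.mul_prod_erase A _ hn, hPfix]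
    have hm : Measurable fun g => φ n (ρ n (Function.update h i g)) :=
      (hφ n).comp (hpres n i hni h).measurable
    rw [lintegral_mul_const _ hm, lintegral_const,
      measure_univ, mul_one]
    congr 1
    exact (hpres n i hni h).lintegral_comp (hφ n)

/-! ### Measure preserving words in `SU(2)` -/

namespace SU2

theorem measurePreserving_word (u v : SU2) : MeasurePreserving fun g : SU2 => u * g * v :=
  (measurePreserving_mul_right volume v).comp (measurePreserving_mul_left volume u)

theorem measurePreserving_word_inv (u v : SU2) : MeasurePreserving fun g : SU2 => u * g⁻¹ * v :=
  (measurePreserving_word u v).comp (Measure.measurePreserving_inv volume)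

/-- Under the constraint of a triangle, any two of the three group elements are independent and Haar
distributed; this justifies the change to the charts. -/
theorem measurePreserving_fst_inv :
    MeasurePreserving fun p : SU2 × SU2 => (p.1, (p.1 * p.2)⁻¹) := by
  refine MeasurePreserving.skew_product (f := id) (g := fun x y => (x * y)⁻¹)
    (MeasurePreserving.id _) (by fun_prop) (Eventually.of_forall fun x => ?_)
  exact ((Measure.measurePreserving_inv volume).comp (measurePreserving_mul_left volume x)).map_eq

theorem measurePreserving_snd_inv :
    MeasurePreserving fun p : SU2 × SU2 => (p.2, (p.1 * p.2)⁻¹) := by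
  have h : MeasurePreserving fun p : SU2 × SU2 => (p.1, (p.2 * p.1)⁻¹) := by
    refine MeasurePreserving.skew_product (f := id) (g := fun x y => (y * x)⁻¹)
      (MeasurePreserving.id _) (by fun_prop) (Eventually.of_forall fun x => ?_)
    exact ((Measure.measurePreserving_inv volume).comp
      (measurePreserving_mul_right volume x)).map_eq
  exact h.comp Measure.measurePreserving_swap

end SU2

namespace ColoredGraph

open SU2

/-! ### The three ways to pair the colors -/

/-- The cyclic order of the triangle of color `c` is `(i j k)`. -/
def IsRot (c i j k : Fin 4) : Prop :=
  (cyc c 0 = i ∧ cyc c 1 = j ∧ cyc c 2 = k) ∨ (cyc c 0 = j ∧ cyc c 1 = k ∧ cyc c 2 = i) ∨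
    (cyc c 0 = k ∧ cyc c 1 = i ∧ cyc c 2 = j)

instance (c i j k : Fin 4) : Decidable (IsRot c i j k) := by unfold IsRot; infer_instance

section Rot

variable {c i j k : Fin 4}

theorem IsRot.heatKernel_eq (h : IsRot c i j k) (α : ℝ) (F : Fin 4 → SU2) :
    heatKernel α (F (cyc c 0) * F (cyc c 1) * F (cyc c 2)) = heatKernel α (F i * F j * F k) := by
  rcases h with ⟨h0, h1, h2⟩ | ⟨h0, h1, h2⟩ | ⟨h0, h1, h2⟩ <;> rw [h0, h1, h2]
  · rw [heatKernel_mul_comm, ← mul_assoc]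
  · rw [mul_assoc, heatKernel_mul_comm]

theorem strand_zero (c : Fin 4) (p : SU2 × SU2) : strand c p (cyc c 0) = p.1 := by
  simp [strand]

theorem strand_one (c : Fin 4) (p : SU2 × SU2) : strand c p (cyc c 1) = p.2 := by
  have : cyc c 1 ≠ cyc c 0 := by revert c; decide
  simp [strand, this]

theorem strand_two (c : Fin 4) (p : SU2 × SU2) : strand c p (cyc c 2) = (p.1 * p.2)⁻¹ := by
  have h : cyc c 2 ≠ cyc c 0 := by revert c; decide
  have h' : cyc c 2 ≠ cyc c 1 := by revert c; decide
  simp [strand, h, h']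

theorem IsRot.strand_mul (h : IsRot c i j k) (p : SU2 × SU2) :
    strand c p i * strand c p j * strand c p k = 1 := by
  rcases h with ⟨rfl, rfl, rfl⟩ | ⟨rfl, rfl, rfl⟩ | ⟨rfl, rfl, rfl⟩ <;>
    simp only [strand_zero, strand_one, strand_two] <;> group

theorem IsRot.measurePreserving (h : IsRot c i j k) :
    MeasurePreserving fun p : SU2 × SU2 => (strand c p i, strand c p j) := by
  rcases h with ⟨rfl, rfl, rfl⟩ | ⟨rfl, rfl, rfl⟩ | ⟨rfl, rfl, rfl⟩ <;>
    simp only [strand_zero, strand_one, strand_two]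
  · exact MeasurePreserving.id _
  · exact Measure.measurePreserving_swap.comp measurePreserving_fst_inv
  · exact measurePreserving_snd_inv

theorem IsRot.rotate (h : IsRot c i j k) : IsRot c k i j := by
  unfold IsRot at *; tauto

theorem IsRot.measurePreserving' (h : IsRot c i j k) :
    MeasurePreserving fun p : SU2 × SU2 => (strand c p i, strand c p k) :=
  Measure.measurePreserving_swap.comp h.rotate.measurePreserving

end Rot

/-- An enumeration `a, b, c, d` of the colors, compatible with the orientation of the tetrahedra. -/
structure Frame (a b c d : Fin 4) : Prop where
  rot_a : IsRot a b c d
  rot_b : IsRot b a d c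
  rot_c : IsRot c d a b
  rot_d : IsRot d c b a
  hab : a ≠ b
  hac : a ≠ c
  had : a ≠ d
  hbc : b ≠ c
  hbd : b ≠ d
  hcd : c ≠ d
  hall : ∀ v, v = a ∨ v = b ∨ v = c ∨ v = d

/-- The frames `frame₁`, `frame₂`, `frame₃` realise the three splittings of the colors into pairs.
-/
theorem frame₁ : Frame 0 1 2 3 := by constructor <;> decide
theorem frame₂ : Frame 0 2 3 1 := by constructor <;> decide
theorem frame₃ : Frame 0 3 1 2 := by constructor <;> decide

section Chart

variable {a b c d : Fin 4}

theorem Frame.univ_eq (hf : Frame a b c d) : (Finset.univ : Finset (Fin 4)) = {a, b, c, d} := by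
  ext v; simpa using hf.hall v

theorem Frame.prod_eq (hf : Frame a b c d) {M : Type*} [CommMonoid M] (f : Fin 4 → M) :
    ∏ v, f v = f a * f b * f c * f d := by
  rw [hf.univ_eq, Finset.prod_insert (by simp [hf.hab, hf.hac, hf.had]),
    Finset.prod_insert (by simp [hf.hbc, hf.hbd]), Finset.prod_insert (by simp [hf.hcd]),
    Finset.prod_singleton, mul_assoc, mul_assoc]

/-- The variables of a line of color `v`: the one shared with the jacket opposite to the pairing
`(a b) (c d)`, and another one. -/
noncomputable def chart (a b c d v : Fin 4) (p : SU2 × SU2) : SU2 × SU2 :=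
  if v = a then (strand v p b, strand v p c)
  else if v = b then (strand v p a, strand v p c)
  else if v = c then (strand v p d, strand v p a)
  else (strand v p c, strand v p a)

theorem Frame.measurePreserving_chart (hf : Frame a b c d) (v : Fin 4) :
    MeasurePreserving (chart a b c d v) := by
  rcases hf.hall v with rfl | rfl | rfl | rfl
  · have : chart v b c d v = fun p => (strand v p b, strand v p c) := by
      funext p; simp [chart]
    rw [this]; exact hf.rot_a.measurePreserving
  · have : chart a v c d v = fun p => (strand v p a, strand v p c) := by
      funext p; simp [chart, hf.hab.symm]
    rw [this]; exact hf.rot_b.measurePreserving'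
  · have : chart a b v d v = fun p => (strand v p d, strand v p a) := by
      funext p; simp [chart, hf.hac.symm, hf.hbc.symm]
    rw [this]; exact hf.rot_c.measurePreserving
  · have : chart a b c v v = fun p => (strand v p c, strand v p a) := by
      funext p; simp [chart, hf.had.symm, hf.hbd.symm, hf.hcd.symm]
    rw [this]; exact hf.rot_d.measurePreserving'

/-- Solving the constraint of each line for its third element, the kernels of the vertices `a` and
`b` share the word `s_c s_d`, and those of `c` and `d` share `s_a s_b`. The triangles `c`, `d` are
those that contain the edge `ab`, so each word belongs to an edge. -/
theorem Frame.nodeKernel_eq (hf : Frame a b c d) (α : ℝ) (P : Fin 4 → SU2 × SU2)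
    {f : Fin 4 → SU2 × SU2} (hP : ∀ v, f v = chart a b c d v (P v)) :
    nodeKernel α (fun v => strand v (P v)) =
      heatKernel α ((f b).1 * ((f c).2 * (f d).2)) *
      heatKernel α ((f a).1 * (f d).1⁻¹ * ((f c).2 * (f d).2)⁻¹ * (f c).1⁻¹) *
      heatKernel α ((f d).1 * ((f a).2 * (f b).2)) *
      heatKernel α ((f c).1 * (f b).1⁻¹ * ((f a).2 * (f b).2)⁻¹ * (f a).1⁻¹) /
      heatKernel α 1 := by
  have ea : f a = (strand a (P a) b, strand a (P a) c) := by rw [hP]; simp [chart]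
  have eb : f b = (strand b (P b) a, strand b (P b) c) := by
    rw [hP]; simp [chart, hf.hab.symm]
  have ec : f c = (strand c (P c) d, strand c (P c) a) := by
    rw [hP]; simp [chart, hf.hac.symm, hf.hbc.symm]
  have ed : f d = (strand d (P d) c, strand d (P d) a) := by
    rw [hP]; simp [chart, hf.had.symm, hf.hbd.symm, hf.hcd.symm]
  have ha := hf.rot_a.strand_mul (P a)
  have hc := hf.rot_c.strand_mul (P c)
  have ha' : strand a (P a) d = (strand a (P a) b * strand a (P a) c)⁻¹ :=
    eq_inv_of_mul_eq_one_right ha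
  have hc' : strand c (P c) b = (strand c (P c) d * strand c (P c) a)⁻¹ :=
    eq_inv_of_mul_eq_one_right hc
  have hb' : strand b (P b) d = (strand b (P b) c * strand b (P b) a)⁻¹ :=
    eq_inv_of_mul_eq_one_right (hf.rot_b.rotate.strand_mul (P b))
  have hd' : strand d (P d) b = (strand d (P d) a * strand d (P d) c)⁻¹ :=
    eq_inv_of_mul_eq_one_right (hf.rot_d.rotate.strand_mul (P d))
  unfold nodeKernel
  congr 1
  rw [hf.prod_eq, hf.rot_a.heatKernel_eq α (fun u => strand u (P u) a),
    hf.rot_b.heatKernel_eq α (fun u => strand u (P u) b),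
    hf.rot_c.heatKernel_eq α (fun u => strand u (P u) c),
    hf.rot_d.heatKernel_eq α (fun u => strand u (P u) d)]
  rw [ea, eb, ec, ed, ha', hb', hc', hd']
  simp only [mul_inv_rev, mul_assoc]

end Chart

end ColoredGraph

namespace ColoredGraph

universe u v

open SU2

variable {W : Type u} {B : Type v}

/-! ### The lines at a node -/

/-- The line of color `c` at a given node. -/
def lineAt (G : ColoredGraph W B) : W ⊕ B → Fin 4 → Fin 4 × W
  | Sum.inl w, c => (c, w)
  | Sum.inr b, c => (c, (G.line c).symm b)

@[simp] theorem lineAt_fst (G : ColoredGraph W B) (n : W ⊕ B) (c : Fin 4) :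
    (G.lineAt n c).1 = c := by cases n <;> rfl

theorem lineAt_injective (G : ColoredGraph W B) (n : W ⊕ B) : Function.Injective (G.lineAt n) :=
  fun c c' h => by simpa using congrArg Prod.fst h

theorem lineAt_ne (G : ColoredGraph W B) {c c' : Fin 4} (h : c ≠ c') (n n' : W ⊕ B) :
    G.lineAt n c ≠ G.lineAt n' c' := fun h' => h (by simpa using congrArg Prod.fst h')

/-- A nonempty set of nodes without complete components has a line with exactly one end in it. -/
theorem exists_boundary_line (G : ColoredGraph W B) (C : Set (Fin 4)) (S : Set (W ⊕ B))
    (hne : S.Nonempty) (hS : ∀ x ∈ S, ∃ y, G.comp C y = G.comp C x ∧ y ∉ S) :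
    ∃ c ∈ C, ∃ n ∈ S, ∀ n' ∈ S, n' ≠ n → G.lineAt n' c ≠ G.lineAt n c := by
  by_contra! hcon
  obtain ⟨x, hx⟩ := hne
  obtain ⟨y, hy, hyS⟩ := hS x hx
  refine hyS ?_
  rw [G.eq_of_comp_eq (· ∈ S) (fun c hc w => ?_) hy]
  · exact hx
  · refine propext ⟨fun h => ?_, fun h => ?_⟩ <;> obtain ⟨n | n, hn, hne, h'⟩ := hcon c hc _ h
    · exact absurd (by simpa [lineAt] using h') hne
    · obtain rfl : n = G.line c w :=
        (Equiv.symm_apply_eq (G.line c)).1 (congrArg Prod.snd h')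
      exact hn
    · obtain rfl : n = w := by
        simpa [lineAt] using congrArg Prod.snd h'
      exact hn
    · exact absurd (congrArg Sum.inr ((G.line c).symm.injective
        (by simpa [lineAt] using congrArg Prod.snd h'))) hne

section Frame

variable {a b c d : Fin 4}

/-- The four heat kernels at a node, in the variables of the charts. -/
noncomputable def frameKernel {M : Type*} [CommMonoid M] (k : SU2 → M) (a b c d : Fin 4)
    (h s : Fin 4 → SU2) : M :=
  k (h b * (s c * s d)) * k (h a * (h d)⁻¹ * (s c * s d)⁻¹ * (h c)⁻¹) *
    k (h d * (s a * s b)) * k (h c * (h b)⁻¹ * (s a * s b)⁻¹ * (h a)⁻¹)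

theorem measurable_frameKernel {M : Type*} [CommMonoid M] [MeasurableSpace M] [MeasurableMul₂ M]
    {k : SU2 → M} (hk : Measurable k) {I : Type*} (e : Fin 4 → I) :
    Measurable fun p : (I → SU2) × (I → SU2) =>
      frameKernel k a b c d (fun v => p.1 (e v)) fun v => p.2 (e v) := by
  unfold frameKernel
  fun_prop

/-- The integrand of the amplitude, in the variables of the charts. -/
noncomputable def frameIntegrand [Fintype W] [Fintype B] (G : ColoredGraph W B)
    {M : Type*} [CommMonoid M] (k : SU2 → M) (a b c d : Fin 4)
    (p : (Fin 4 × W → SU2) × (Fin 4 × W → SU2)) : M :=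
  ∏ n : W ⊕ B, frameKernel k a b c d (fun v => p.1 (G.lineAt n v)) fun v => p.2 (G.lineAt n v)

theorem measurable_frameIntegrand [Fintype W] [Fintype B] (G : ColoredGraph W B)
    {M : Type*} [CommMonoid M] [MeasurableSpace M] [MeasurableMul₂ M]
    {k : SU2 → M} (hk : Measurable k) : Measurable (G.frameIntegrand k a b c d) :=
  Finset.measurable_prod _ fun _ _ => measurable_frameKernel hk _

theorem Frame.amplitude_eq [Fintype W] [Fintype B] (hf : Frame a b c d) (G : ColoredGraph W B)
    {α : ℝ} (hα : 0 < α) : G.amplitude α =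
      (∫ p, G.frameIntegrand (heatKernel α) a b c d p) / heatKernel α 1 ^ Fintype.card (W ⊕ B) := by
  have h1 : MeasurePreserving fun X : Fin 4 × W → SU2 × SU2 => fun i => chart a b c d i.1 (X i) :=
    volume_preserving_pi fun i => hf.measurePreserving_chart i.1
  have h2 := (volume_measurePreserving_arrowProdEquivProdArrow SU2 SU2 (Fin 4 × W)).comp h1
  rw [← h2.map_eq, integral_map h2.measurable.aemeasurable
    (measurable_frameIntegrand G (continuous_heatKernel hα).measurable).aestronglyMeasurable,
    ← integral_div, amplitude]
  congr 1
  funext X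
  rw [frameIntegrand, ← Finset.card_univ, ← Finset.prod_const, ← Finset.prod_div_distrib,
    Fintype.prod_sum_type]
  refine congrArg₂ _ (Finset.prod_congr rfl fun w _ => ?_) (Finset.prod_congr rfl fun n _ => ?_)
  · rw [hf.nodeKernel_eq α (fun v => X (v, w)) (f := fun v => chart a b c d v (X (v, w)))
      fun _ => rfl]
    rfl
  · rw [hf.nodeKernel_eq α (fun v => X (v, (G.line v).symm n))
      (f := fun v => chart a b c d v (X (v, (G.line v).symm n))) fun _ => rfl]
    rfl

end Frame

end ColoredGraph

namespace ColoredGraph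

universe u v

open SU2

variable {W : Type u} {B : Type v} {a b c d : Fin 4}

theorem Frame.swap (hf : Frame a b c d) : Frame c d a b where
  rot_a := hf.rot_c
  rot_b := hf.rot_d
  rot_c := hf.rot_a
  rot_d := hf.rot_b
  hab := hf.hcd
  hac := hf.hac.symm
  had := hf.hbc.symm
  hbc := hf.had.symm
  hbd := hf.hbd.symm
  hcd := hf.hab
  hall v := by have := hf.hall v; tauto

theorem Frame.compl_eq (hf : Frame a b c d) : ({a, b}ᶜ : Set (Fin 4)) = {c, d} := by
  ext v
  have h1 := hf.hac; have h2 := hf.had; have h3 := hf.hbc; have h4 := hf.hbd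
  simp only [Set.mem_compl_iff, Set.mem_insert_iff, Set.mem_singleton_iff]
  rcases hf.hall v with rfl | rfl | rfl | rfl <;> simp_all [eq_comm]

/-! ### The integral over the variables attached to the corners -/

/-- Each node has two corners: that of type `false` is formed by its lines of colors `c, d`, that of
type `true` by its lines of colors `a, b`. The first colors are `cornerColor a c`, the second ones
are `cornerColor b d`. -/
def cornerColor (a c : Fin 4) (β : Bool) : Fin 4 := if β then a else c

/-- The word attached to a corner of a node. -/
noncomputable def cornerWord (G : ColoredGraph W B) (a b c d : Fin 4) (m : (W ⊕ B) × Bool)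
    (s : Fin 4 × W → SU2) : SU2 :=
  s (G.lineAt m.1 (cornerColor a c m.2)) * s (G.lineAt m.1 (cornerColor b d m.2))

/-- The kernels of a corner of a node, after those of the other type of nodes are bounded. -/
noncomputable def cornerFactor (G : ColoredGraph W B) (k : SU2 → ENNReal) (a b c d : Fin 4)
    (h : Fin 4 × W → SU2) : (W ⊕ B) × Bool → SU2 → ENNReal
  | (Sum.inl w, false), x => k (h (b, w) * x)
  | (Sum.inr w, false), x => k (h (G.lineAt (Sum.inr w) b) * x) *
      k (h (G.lineAt (Sum.inr w) a) * (h (G.lineAt (Sum.inr w) d))⁻¹ * x⁻¹ *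
        (h (G.lineAt (Sum.inr w) c))⁻¹)
  | (Sum.inl w, true), x => k (h (d, w) * x) *
      k (h (c, w) * (h (b, w))⁻¹ * x⁻¹ * (h (a, w))⁻¹)
  | (Sum.inr w, true), x => k (h (G.lineAt (Sum.inr w) d) * x)

theorem measurable_cornerFactor (G : ColoredGraph W B) {k : SU2 → ENNReal} (hk : Measurable k)
    (h : Fin 4 × W → SU2) (m : (W ⊕ B) × Bool) : Measurable (G.cornerFactor k a b c d h m) := by
  rcases m with ⟨n | n, _ | _⟩ <;> unfold cornerFactor <;> fun_prop

/-- The kernel given up is that of the vertex `b` at white nodes and of `d` at black nodes, so the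
corner that keeps a single kernel is of type `false` at white nodes and `true` at black ones. -/
theorem frameKernel_le (G : ColoredGraph W B) {k : SU2 → ENNReal} {M : ENNReal}
    (hM : ∀ g, k g ≤ M) (h s : Fin 4 × W → SU2) (n : W ⊕ B) :
    frameKernel k a b c d (fun v => h (G.lineAt n v)) (fun v => s (G.lineAt n v)) ≤
      M * (G.cornerFactor k a b c d h (n, false) (G.cornerWord a b c d (n, false) s) *
        G.cornerFactor k a b c d h (n, true) (G.cornerWord a b c d (n, true) s)) := by
  have key : ∀ A B C D : ENNReal, B ≤ M → A * B * C * D ≤ M * (A * (C * D)) := fun A B C D hB => by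
    calc A * B * C * D = B * (A * (C * D)) := by ring
      _ ≤ _ := by gcongr
  have key' : ∀ A B C D : ENNReal, D ≤ M → A * B * C * D ≤ M * (A * B * C) := fun A B C D hD => by
    rw [mul_comm M]; gcongr
  cases n with
  | inl w => exact key _ _ _ _ (hM _)
  | inr w => exact key' _ _ _ _ (hM _)

-- One root corner for each element of `E(ab)` and of `E(cd)`. Every bicolored cycle passes through
-- nodes of both kinds, so the roots can be taken among the corners that keep a single kernel.
open Classical in
theorem Frame.exists_roots [Finite W] [Finite B] (hf : Frame a b c d) (G : ColoredGraph W B) :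
    ∃ R : Finset ((W ⊕ B) × Bool), R.card ≤ G.numEdges a b + G.numEdges c d ∧
      (∀ r ∈ R, (∃ w, r = (Sum.inl w, false)) ∨ ∃ w, r = (Sum.inr w, true)) ∧
      ∀ (β : Bool) (n : W ⊕ B), ∃ m, (m, β) ∈ R ∧
        G.comp {cornerColor a c β, cornerColor b d β} m = G.comp {cornerColor a c β, cornerColor b d β} n := by
  have hc1 : c ∈ ({a, b}ᶜ : Set (Fin 4)) := by rw [hf.compl_eq]; simp
  have ha1 : a ∈ ({c, d}ᶜ : Set (Fin 4)) := by rw [hf.swap.compl_eq]; simp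
  choose f hf' using G.exists_white_rep hc1
  choose g hg' using G.exists_black_rep ha1
  have := Fintype.ofFinite (G.sub {a, b}ᶜ).ConnectedComponent
  have := Fintype.ofFinite (G.sub {c, d}ᶜ).ConnectedComponent
  refine ⟨Finset.univ.image (fun κ => (Sum.inl (f κ), false)) ∪
    Finset.univ.image (fun κ => (Sum.inr (g κ), true)), ?_, ?_, ?_⟩
  · refine (Finset.card_union_le _ _).trans (add_le_add ?_ ?_) <;>
    · rw [numEdges, Nat.card_eq_fintype_card]
      exact Finset.card_image_le
  · intro r hr
    simp only [Finset.mem_union, Finset.mem_image, Finset.mem_univ, true_and] at hr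
    obtain ⟨κ, rfl⟩ | ⟨κ, rfl⟩ := hr
    · exact Or.inl ⟨_, rfl⟩
    · exact Or.inr ⟨_, rfl⟩
  · rintro (_ | _) n
    · refine ⟨Sum.inl (f (G.comp {a, b}ᶜ n)), by simp, ?_⟩
      change G.comp {c, d} _ = G.comp {c, d} n
      rw [← hf.compl_eq]
      exact hf' _
    · refine ⟨Sum.inr (g (G.comp {c, d}ᶜ n)), by simp, ?_⟩
      change G.comp {a, b} _ = G.comp {a, b} n
      rw [← hf.swap.compl_eq]
      exact hg' _

end ColoredGraph

namespace ColoredGraph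

universe u v

open SU2

variable {W : Type u} {B : Type v} {a b c d : Fin 4}

/-- Corners of different types involve lines of different colors. Among those of one type, each
cycle misses a corner, so every nonempty set of remaining corners has a boundary line, whose
variable occurs in only one of its words. -/
theorem Frame.lintegral_prod_cornerFactor [Fintype W] (hf : Frame a b c d)
    (G : ColoredGraph W B) {k : SU2 → ENNReal} (hk : Measurable k)
    {A : Finset ((W ⊕ B) × Bool)} (hA : ∀ (β : Bool) (n : W ⊕ B), ∃ m, (m, β) ∉ A ∧
      G.comp {cornerColor a c β, cornerColor b d β} m = G.comp {cornerColor a c β, cornerColor b d β} n)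
    (h : Fin 4 × W → SU2) :
    ∫⁻ s, ∏ m ∈ A, G.cornerFactor k a b c d h m (G.cornerWord a b c d m s) =
      ∏ m ∈ A, ∫⁻ x, G.cornerFactor k a b c d h m x := by
  classical
  have hne : ∀ β, cornerColor a c β ≠ cornerColor b d β := by
    rintro (_ | _)
    exacts [hf.hcd, hf.hab]
  have hne' : ∀ β β', β ≠ β' → ∀ v ∈ ({cornerColor a c β, cornerColor b d β} : Set (Fin 4)),
      v ≠ cornerColor a c β' ∧ v ≠ cornerColor b d β' := by
    have h1 := hf.hac; have h2 := hf.had; have h3 := hf.hbc; have h4 := hf.hbd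
    rintro (_ | _) (_ | _) hβ v (rfl | rfl) <;> simp_all [cornerColor, eq_comm]
  refine lintegral_prod_forest
    (fun m i => i = G.lineAt m.1 (cornerColor a c m.2) ∨ i = G.lineAt m.1 (cornerColor b d m.2))
    (G.cornerWord a b c d) (fun m => ?_) ?_ ?_ _ (fun m => measurable_cornerFactor G hk h m) _ ?_
  · unfold cornerWord; fun_prop
  · intro m i hi s g
    rw [not_or] at hi
    simp only [cornerWord, Function.update_of_ne (Ne.symm hi.1), Function.update_of_ne (Ne.symm hi.2)]
  · intro m i hi s
    have hl := (G.lineAt_injective m.1).ne (hne m.2)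
    rcases hi with rfl | rfl
    · simpa [cornerWord, Function.update_of_ne hl.symm] using measurePreserving_mul_right volume _
    · simpa [cornerWord, Function.update_of_ne hl] using measurePreserving_mul_left volume _
  · rintro T hT ⟨⟨n₀, β⟩, hn₀⟩
    obtain ⟨v, hv, n, hn, hother⟩ := G.exists_boundary_line {cornerColor a c β, cornerColor b d β}
      {n | (n, β) ∈ T} ⟨n₀, hn₀⟩ fun x _ => by
        obtain ⟨m, hm, hmx⟩ := hA β x
        exact ⟨m, hmx, fun hmT => hm (hT hmT)⟩
    refine ⟨G.lineAt n v, (n, β), hn, ?_, ?_⟩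
    · rcases hv with rfl | rfl
      exacts [Or.inl rfl, Or.inr rfl]
    · rintro ⟨n', β'⟩ hn' hnn' hsee
      by_cases hβ : β = β'
      · subst hβ
        have hnn : n' ≠ n := fun h => hnn' (by rw [h])
        refine hother n' hn' hnn ?_
        have hv' : v = cornerColor a c β ∨ v = cornerColor b d β := hv
        rcases hsee with hsee | hsee
        · have := congrArg Prod.fst hsee
          simp only [lineAt_fst] at this
          rw [hsee, this]
        · have := congrArg Prod.fst hsee
          simp only [lineAt_fst] at this
          rw [hsee, this]
      · have := hne' β β' hβ v hv
        exact hsee.elim (G.lineAt_ne this.1 _ _) (G.lineAt_ne this.2 _ _)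

/-- The convolution square of a kernel. -/
noncomputable def convSq (k : SU2 → ENNReal) (z : SU2) : ENNReal := ∫⁻ x, k x * k (z * x⁻¹)

theorem measurable_convSq {k : SU2 → ENNReal} (hk : Measurable k) : Measurable (convSq k) := by
  unfold convSq
  refine Measurable.lintegral_prod_right' (f := fun p : SU2 × SU2 => k p.2 * k (p.1 * p.2⁻¹)) ?_
  fun_prop

theorem lintegral_convSq {k : SU2 → ENNReal} (hk : Measurable k) :
    ∫⁻ z, convSq k z = (∫⁻ x, k x) ^ 2 := by
  unfold convSq
  rw [lintegral_lintegral_swap (by fun_prop)]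
  have h : ∀ x : SU2, ∫⁻ z, k x * k (z * x⁻¹) = k x * ∫⁻ z, k z := fun x => by
    rw [lintegral_const_mul _ (by fun_prop), lintegral_mul_right_eq_self k]
  simp_rw [h]
  rw [lintegral_mul_const _ hk, sq]

theorem convSq_le {k : SU2 → ENNReal} (hk : Measurable k) {M : ENNReal} (hM : ∀ g, k g ≤ M)
    (z : SU2) : convSq k z ≤ M * ∫⁻ x, k x := by
  rw [← lintegral_const_mul _ hk]
  exact lintegral_mono fun x => by rw [mul_comm]; gcongr; exact hM _

/-- The convolution square at a word which is conjugate to `z * x⁻¹` after the substitution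
`x = u * y`. -/
theorem lintegral_mul_eq_convSq {k : SU2 → ENNReal} (hcomm : ∀ g h, k (g * h) = k (h * g))
    (u v w : SU2) : ∫⁻ x, k (u * x) * k (v * x⁻¹ * w) = convSq k (u * w * v) := by
  rw [convSq, ← lintegral_mul_left_eq_self (fun x => k x * k (u * w * v * x⁻¹)) u]
  refine lintegral_congr fun x => ?_
  rw [hcomm _ w, show u * w * v * (u * x)⁻¹ = u * (w * (v * x⁻¹) * u⁻¹) by group,
    hcomm u (w * (v * x⁻¹) * u⁻¹), inv_mul_cancel_right]

theorem convSq_inv {k : SU2 → ENNReal} (hcomm : ∀ g h, k (g * h) = k (h * g))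
    (hinv : ∀ g, k g⁻¹ = k g) (z : SU2) : convSq k z⁻¹ = convSq k z := by
  unfold convSq
  rw [← lintegral_inv_eq_self]
  refine lintegral_congr fun x => ?_
  rw [hinv x, inv_inv, ← hinv (z⁻¹ * x), mul_inv_rev, inv_inv, hcomm]

/-- The word around a node. -/
noncomputable def nodeWord (G : ColoredGraph W B) (a b c d : Fin 4) (n : W ⊕ B)
    (h : Fin 4 × W → SU2) : SU2 :=
  h (G.lineAt n b) * (h (G.lineAt n c))⁻¹ * h (G.lineAt n a) * (h (G.lineAt n d))⁻¹

/-- A single kernel integrates to a constant. A corner with two kernels gives their convolution,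
which depends on `h` only through the word around the node, up to inversion. -/
theorem lintegral_cornerFactor (G : ColoredGraph W B) {k : SU2 → ENNReal}
    (hcomm : ∀ g h, k (g * h) = k (h * g)) (hinv : ∀ g, k g⁻¹ = k g)
    (h : Fin 4 × W → SU2) (m : (W ⊕ B) × Bool) :
    ∫⁻ x, G.cornerFactor k a b c d h m x =
      if m.1.isLeft = m.2 then convSq k (G.nodeWord a b c d m.1 h) else ∫⁻ x, k x := by
  rcases m with ⟨n | n, _ | _⟩ <;> simp only [cornerFactor]
  · simpa using lintegral_mul_left_eq_self k _
  · rw [lintegral_mul_eq_convSq hcomm, ← convSq_inv hcomm hinv]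
    simp [nodeWord, lineAt, mul_assoc]
  · rw [lintegral_mul_eq_convSq hcomm]
    simp [nodeWord, mul_assoc]
  · simpa using lintegral_mul_left_eq_self k _

end ColoredGraph

/-! ### Integration over the words around the nodes and the resulting power of the kernel -/

namespace ColoredGraph

universe u v

open SU2

variable {W : Type u} {B : Type v} {a b c d : Fin 4} [Fintype W]

/-- The forest argument with all four colors: as the graph is connected, omitting the single node
`n₀` gives every nonempty set of the other nodes a boundary line. -/
theorem Frame.lintegral_nodeWord (hf : Frame a b c d) (G : ColoredGraph W B) (hG : G.Connected)
    {A : Finset (W ⊕ B)} {n₀ : W ⊕ B} (hn₀ : n₀ ∉ A) {φ : SU2 → ENNReal} (hφ : Measurable φ) :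
    ∫⁻ h, ∏ n ∈ A, φ (G.nodeWord a b c d n h) = ∏ _n ∈ A, ∫⁻ g, φ g := by
  classical
  refine lintegral_prod_forest (fun n i => ∃ v, i = G.lineAt n v) (G.nodeWord a b c d)
    (fun n => ?_) ?_ ?_ _ (fun _ => hφ) _ ?_
  · unfold nodeWord; fun_prop
  · intro n i hi h g
    have : ∀ v, G.lineAt n v ≠ i := fun v hv => hi ⟨v, hv.symm⟩
    simp only [nodeWord, Function.update_of_ne (this _)]
  · rintro n _ ⟨v, rfl⟩ h
    have hne : ∀ v', v' ≠ v → G.lineAt n v' ≠ G.lineAt n v :=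
      fun v' hv => (G.lineAt_injective n).ne hv
    rcases hf.hall v with rfl | rfl | rfl | rfl
    · simpa [nodeWord, Function.update_of_ne (hne _ hf.hab.symm),
        Function.update_of_ne (hne _ hf.hac.symm), Function.update_of_ne (hne _ hf.had.symm)] using
        measurePreserving_word _ _
    · simpa [nodeWord, Function.update_of_ne (hne _ hf.hab), mul_assoc,
        Function.update_of_ne (hne _ hf.hbc.symm), Function.update_of_ne (hne _ hf.hbd.symm)] using
        measurePreserving_mul_right volume _
    · simpa [nodeWord, Function.update_of_ne (hne _ hf.hac), mul_assoc,
        Function.update_of_ne (hne _ hf.hbc), Function.update_of_ne (hne _ hf.hcd.symm)] using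
        measurePreserving_word_inv _ _
    · simpa [nodeWord, Function.update_of_ne (hne _ hf.had),
        Function.update_of_ne (hne _ hf.hbd), Function.update_of_ne (hne _ hf.hcd)] using
        measurePreserving_word_inv _ 1
  · rintro T hT ⟨m₀, hm₀⟩
    obtain ⟨v, -, n, hn, hother⟩ := G.exists_boundary_line Set.univ (T : Set (W ⊕ B))
      ⟨m₀, hm₀⟩ fun x _ => ⟨n₀, comp_eq_of_connected hG _ _, fun h => hn₀ (hT h)⟩
    refine ⟨G.lineAt n v, n, hn, ⟨v, rfl⟩, ?_⟩
    rintro n' hn' hne ⟨v', hv'⟩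
    obtain rfl : v = v' := by simpa using congrArg Prod.fst hv'
    exact hother n' hn' hne hv'.symm

/-- The powers of `M` count one kernel per node, one per root corner, and one for the node omitted
in the final integration. -/
theorem Frame.lintegral_frameIntegrand_le [Fintype B] (hf : Frame a b c d) (G : ColoredGraph W B)
    (hG : G.Connected) {k : SU2 → ENNReal} (hk : Measurable k)
    (hcomm : ∀ g h, k (g * h) = k (h * g)) (hinv : ∀ g, k g⁻¹ = k g) {M L : ENNReal}
    (hM : ∀ g, k g ≤ M) (hM1 : 1 ≤ M) (hL : ∫⁻ x, k x ≤ L) (hL1 : 1 ≤ L) :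
    ∫⁻ p, G.frameIntegrand k a b c d p ≤
      M ^ (Fintype.card (W ⊕ B) + (G.numEdges a b + G.numEdges c d) + 1) *
        L ^ (3 * Fintype.card (W ⊕ B) + 1) := by
  classical
  obtain ⟨R, hRcard, hRsort, hR⟩ := hf.exists_roots G
  obtain ⟨n₀⟩ := hG.nonempty
  set N := Fintype.card (W ⊕ B) with hN
  set E := G.numEdges a b + G.numEdges c d with hE
  have hroot : ∀ m ∈ R, ¬ m.1.isLeft = m.2 := fun m hm => by
    rcases hRsort m hm with ⟨w, rfl⟩ | ⟨w, rfl⟩ <;> simp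
  have hpoint : ∀ h s : Fin 4 × W → SU2, G.frameIntegrand k a b c d (h, s) ≤
      M ^ (N + E) * ∏ m ∈ Rᶜ, G.cornerFactor k a b c d h m (G.cornerWord a b c d m s) := by
    intro h s
    calc G.frameIntegrand k a b c d (h, s)
        ≤ ∏ n : W ⊕ B, M * (G.cornerFactor k a b c d h (n, false)
            (G.cornerWord a b c d (n, false) s) *
          G.cornerFactor k a b c d h (n, true) (G.cornerWord a b c d (n, true) s)) :=
          Finset.prod_le_prod' fun n _ => frameKernel_le G hM h s n
      _ = M ^ N * ∏ m, G.cornerFactor k a b c d h m (G.cornerWord a b c d m s) := by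
          rw [Finset.prod_mul_distrib, Finset.prod_const, Finset.card_univ, Fintype.prod_prod_type, ← hN]
          simp only [Fintype.prod_bool, mul_comm]
      _ = M ^ N * ((∏ m ∈ R, G.cornerFactor k a b c d h m (G.cornerWord a b c d m s)) *
          ∏ m ∈ Rᶜ, G.cornerFactor k a b c d h m (G.cornerWord a b c d m s)) := by
          rw [Finset.prod_mul_prod_compl]
      _ ≤ M ^ N * (M ^ E * ∏ m ∈ Rᶜ, G.cornerFactor k a b c d h m (G.cornerWord a b c d m s)) := by
          gcongr
          refine (Finset.prod_le_pow_card _ _ M fun m hm => ?_).trans (pow_le_pow_right₀ hM1 hRcard)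
          rcases hRsort m hm with ⟨w, rfl⟩ | ⟨w, rfl⟩ <;> exact hM _
      _ = _ := by rw [pow_add M N E, mul_assoc]
  have hinner : ∀ h : Fin 4 × W → SU2, ∫⁻ s, G.frameIntegrand k a b c d (h, s) ≤
      M ^ (N + E) * L ^ N * ∏ n, convSq k (G.nodeWord a b c d n h) := by
    intro h
    have hmeas : Measurable fun s : Fin 4 × W → SU2 =>
        ∏ m ∈ Rᶜ, G.cornerFactor k a b c d h m (G.cornerWord a b c d m s) :=
      Finset.measurable_prod _ fun m _ => (measurable_cornerFactor G hk h m).comp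
        (by unfold cornerWord; fun_prop)
    calc ∫⁻ s, G.frameIntegrand k a b c d (h, s)
        ≤ ∫⁻ s, M ^ (N + E) * ∏ m ∈ Rᶜ, G.cornerFactor k a b c d h m (G.cornerWord a b c d m s) :=
          lintegral_mono fun s => hpoint h s
      _ = M ^ (N + E) * ∏ m ∈ Rᶜ, ∫⁻ x, G.cornerFactor k a b c d h m x := by
          rw [lintegral_const_mul _ hmeas, hf.lintegral_prod_cornerFactor G hk (by simpa using hR)]
      _ ≤ M ^ (N + E) * ∏ m : (W ⊕ B) × Bool,
            if m.1.isLeft = m.2 then convSq k (G.nodeWord a b c d m.1 h) else L := by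
          gcongr
          refine (Finset.prod_le_prod' fun m _ => ?_).trans
            (Finset.prod_le_prod_of_subset_of_one_le' (Finset.subset_univ _) fun m _ hm => ?_)
          · rw [lintegral_cornerFactor G hcomm hinv]
            split_ifs
            exacts [le_rfl, hL]
          -- The root corners are restored with a factor `L ≥ 1`. They carry a single kernel, so the
          -- product of convolution squares runs over all nodes.
          · rw [if_neg (hroot m (by simpa using hm))]
            exact hL1
      _ = M ^ (N + E) * ∏ n : W ⊕ B, L * convSq k (G.nodeWord a b c d n h) := by
          rw [Fintype.prod_prod_type]
          congr 1
          refine Finset.prod_congr rfl fun n _ => ?_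
          cases n <;> simp [mul_comm]
      _ = _ := by
          rw [Finset.prod_mul_distrib, Finset.prod_const, Finset.card_univ, mul_assoc]
  have hcs := measurable_convSq hk
  have hmw : ∀ n, Measurable fun h => convSq k (G.nodeWord a b c d n h) :=
    fun n => hcs.comp (by unfold nodeWord; fun_prop)
  have hmw' : Measurable fun h => ∏ n ∈ ({n₀}ᶜ : Finset (W ⊕ B)),
      convSq k (G.nodeWord a b c d n h) := Finset.measurable_prod _ fun n _ => hmw n
  calc ∫⁻ p, G.frameIntegrand k a b c d p
      = ∫⁻ h, ∫⁻ s, G.frameIntegrand k a b c d (h, s) :=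
        lintegral_prod _ (measurable_frameIntegrand G hk).aemeasurable
    -- The convolution square at `n₀` is bounded by `M * L`, which frees the remaining words for
    -- integration.
    _ ≤ ∫⁻ h, M ^ (N + E) * L ^ N * (M * L * ∏ n ∈ ({n₀}ᶜ : Finset (W ⊕ B)),
          convSq k (G.nodeWord a b c d n h)) := by
        refine lintegral_mono fun h => (hinner h).trans ?_
        rw [← Finset.prod_mul_prod_compl {n₀}, Finset.prod_singleton]
        gcongr
        exact (convSq_le hk hM _).trans (by gcongr)
    _ = M ^ (N + E) * L ^ N * (M * L * ∏ n ∈ ({n₀}ᶜ : Finset (W ⊕ B)), (∫⁻ x, k x) ^ 2) := by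
        rw [lintegral_const_mul _ (hmw'.const_mul _), lintegral_const_mul _ hmw',
          hf.lintegral_nodeWord G hG (n₀ := n₀) (by simp) hcs, lintegral_convSq hk]
    _ ≤ M ^ (N + E) * L ^ N * (M * L * (L ^ 2) ^ N) := by
        gcongr
        refine (Finset.prod_le_pow_card _ _ (L ^ 2) fun n _ => by gcongr).trans ?_
        exact pow_le_pow_right₀ (one_le_pow₀ hL1) (Finset.card_le_univ _)
    _ = _ := by ring

end ColoredGraph

/-! ### Power counting and the divergence degree -/

namespace ColoredGraph

universe u v

open SU2

variable {W : Type u} {B : Type v} {a b c d : Fin 4} [Fintype W] [Fintype B]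

theorem card_nodes (G : ColoredGraph W B) : Fintype.card (W ⊕ B) = 2 * Fintype.card W := by
  rw [Fintype.card_sum, ← Fintype.card_congr (G.line 0)]; ring

theorem enorm_frameIntegrand (G : ColoredGraph W B) (k : SU2 → ℝ)
    (p : (Fin 4 × W → SU2) × (Fin 4 × W → SU2)) :
    ‖G.frameIntegrand k a b c d p‖ₑ = G.frameIntegrand (fun g => ‖k g‖ₑ) a b c d p := by
  have h : ∀ (s : Finset (W ⊕ B)) (f : W ⊕ B → ℝ), ‖∏ n ∈ s, f n‖ₑ = ∏ n ∈ s, ‖f n‖ₑ := by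
    classical
    intro s f
    induction s using Finset.induction_on with
    | empty => simp
    | insert n s hn ih => rw [Finset.prod_insert hn, Finset.prod_insert hn, enorm_mul, ih]
  rw [frameIntegrand, h]
  simp only [frameKernel, enorm_mul, frameIntegrand]

theorem rescaledAmplitude_eq (G : ColoredGraph W B) {α : ℝ} (hK : 0 < heatKernel α 1) :
    G.rescaledAmplitude α = (heatKernel α 1 ^ Fintype.card W)⁻¹ * G.amplitude α := by
  rw [rescaledAmplitude, G.card_nodes, pow_mul, div_pow, one_pow, Real.sq_sqrt hK.le, one_div,
    inv_pow]

/-- The denominators of the node kernels cancel the powers coming from one kernel per node, and the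
rescaling of the coupling contributes the exponent `-Fintype.card W`. -/
theorem Frame.exists_abs_rescaledAmplitude_le (hf : Frame a b c d) (G : ColoredGraph W B)
    (hG : G.Connected) : ∃ C : ℝ, ∀ᶠ α : ℝ in 𝓝[>] 0, |G.rescaledAmplitude α| ≤
      C * heatKernel α 1 ^ ((G.numEdges a b + G.numEdges c d + 1 - Fintype.card W : ℝ)) := by
  obtain ⟨L, hL, hLint⟩ := exists_lintegral_heatKernel_le
  refine ⟨max L 1 ^ (3 * Fintype.card (W ⊕ B) + 1), ?_⟩
  filter_upwards [eventually_mem_Ioc, tendsto_heatKernel_one.eventually_ge_atTop 1] with α hα hK1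
  have hK : 0 < heatKernel α 1 := one_pos.trans_le hK1
  set K := heatKernel α 1 with hKdef
  set N := Fintype.card (W ⊕ B) with hN
  have hbound := hf.lintegral_frameIntegrand_le G hG (k := fun g => ‖heatKernel α g‖ₑ)
    (continuous_heatKernel hα.1).measurable.enorm
    (fun g h => by rw [heatKernel_mul_comm]) (fun g => by rw [heatKernel_inv])
    (M := ENNReal.ofReal K) (L := ENNReal.ofReal (max L 1))
    (fun g => by
      rw [← ofReal_norm]
      exact ENNReal.ofReal_le_ofReal (abs_heatKernel_le hα.1 g))
    (by simpa using hK1)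
    ((hLint α hα.1 hα.2).trans (ENNReal.ofReal_le_ofReal (le_max_left _ _)))
    (by simp)
  have hI : |∫ p, G.frameIntegrand (heatKernel α) a b c d p| ≤
      K ^ (N + (G.numEdges a b + G.numEdges c d) + 1) * max L 1 ^ (3 * N + 1) := by
    rw [← ENNReal.ofReal_le_ofReal_iff (by positivity), ENNReal.ofReal_mul (by positivity),
      ENNReal.ofReal_pow hK.le, ENNReal.ofReal_pow (by positivity), ← Real.norm_eq_abs, ofReal_norm]
    refine (enorm_integral_le_lintegral_enorm _).trans ?_
    simp only [enorm_frameIntegrand]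
    exact hbound
  rw [rescaledAmplitude_eq G hK, hf.amplitude_eq G hα.1, ← hKdef, abs_mul, abs_div,
    abs_of_pos (pow_pos hK N), abs_of_pos (inv_pos.2 (pow_pos hK _))]
  calc _ ≤ (K ^ Fintype.card W)⁻¹ * (K ^ (N + (G.numEdges a b + G.numEdges c d) + 1) *
        max L 1 ^ (3 * N + 1) / K ^ N) := by gcongr
    _ = max L 1 ^ (3 * N + 1) * (K ^ (G.numEdges a b + G.numEdges c d + 1) /
          K ^ Fintype.card W) := by
        rw [add_assoc N, pow_add K N]
        field_simp
    _ = _ := by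
        rw [Real.rpow_sub hK, Real.rpow_natCast]
        norm_cast

/-- Above `β` the limit exists and vanishes, so no limit is required at `β` itself. -/
theorem divergenceDegree_le (G : ColoredGraph W B) {C β : ℝ}
    (h : ∀ᶠ α : ℝ in 𝓝[>] 0, |G.rescaledAmplitude α| ≤ C * heatKernel α 1 ^ β) :
    G.divergenceDegree ≤ (β : EReal) := by
  refine EReal.le_of_forall_lt_iff_le.1 fun γ hγ => sInf_le ⟨γ, ⟨0, ?_⟩, rfl⟩
  have hγ' : 0 < γ - β := sub_pos.2 (EReal.coe_lt_coe_iff.1 hγ)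
  have h0 : Tendsto (fun α => C * heatKernel α 1 ^ (-(γ - β))) (𝓝[>] 0) (𝓝 0) := by
    simpa using ((tendsto_rpow_neg_atTop hγ').comp tendsto_heatKernel_one).const_mul C
  refine squeeze_zero_norm' ?_ h0
  filter_upwards [h, eventually_mem_Ioc] with α hα hα1
  have hK := heatKernel_one_pos hα1.1 hα1.2
  rw [norm_mul, Real.norm_eq_abs, Real.norm_eq_abs, abs_of_pos (Real.rpow_pos_of_pos hK _)]
  calc _ ≤ heatKernel α 1 ^ (-γ) * (C * heatKernel α 1 ^ β) := by gcongr
    _ = _ := by rw [neg_sub, sub_eq_add_neg, Real.rpow_add hK]; ring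

/-- Below `β` the renormalised amplitude tends to infinity. -/
theorem le_divergenceDegree (G : ColoredGraph W B) {C β : ℝ} (hC : 0 < C)
    (h : ∀ᶠ α : ℝ in 𝓝[>] 0, C * heatKernel α 1 ^ β ≤ G.rescaledAmplitude α) :
    (β : EReal) ≤ G.divergenceDegree := by
  refine le_sInf ?_
  rintro _ ⟨γ, ⟨L, hL⟩, rfl⟩
  by_contra! hγ
  have hγ' : 0 < β - γ := sub_pos.2 (EReal.coe_lt_coe_iff.1 hγ)
  refine not_tendsto_nhds_of_tendsto_atTop (tendsto_atTop_mono' _ ?_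
    (((tendsto_rpow_atTop hγ').comp tendsto_heatKernel_one).const_mul_atTop hC)) L hL
  filter_upwards [h, eventually_mem_Ioc] with α hα hα1
  have hK := heatKernel_one_pos hα1.1 hα1.2
  calc _ = heatKernel α 1 ^ (-γ) * (C * heatKernel α 1 ^ β) := by
        rw [Function.comp_apply, sub_eq_add_neg, Real.rpow_add hK]; ring
    _ ≤ _ := by gcongr

theorem Frame.divergenceDegree_le (hf : Frame a b c d) (G : ColoredGraph W B) (hG : G.Connected) :
    G.divergenceDegree ≤
      ((G.numEdges a b + G.numEdges c d + 1 - Fintype.card W : ℝ) : EReal) :=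
  let ⟨_, hC⟩ := hf.exists_abs_rescaledAmplitude_le G hG
  ColoredGraph.divergenceDegree_le G hC

end ColoredGraph

namespace ColoredGraph

open SU2

/-! ### The supermelon -/

/-- The connected graph with two nodes. -/
def supermelon : ColoredGraph (Fin 1) (Fin 1) := ⟨fun _ => Equiv.refl _⟩

theorem supermelon_comp {S : Set (Fin 4)} (hS : S.Nonempty) (x y : Fin 1 ⊕ Fin 1) :
    supermelon.comp S x = supermelon.comp S y := by
  obtain ⟨c, hc⟩ := hS
  have h := supermelon.comp_line hc 0
  rw [Subsingleton.elim (supermelon.line c 0) 0] at h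
  have key : ∀ z, supermelon.comp S z = supermelon.comp S (Sum.inl 0) := by
    rintro (z | z) <;> rw [Subsingleton.elim z 0]
    exact h.symm
  rw [key x, key y]

theorem supermelon_connected : supermelon.Connected :=
  have : Nonempty (Fin 1 ⊕ Fin 1) := ⟨Sum.inl 0⟩
  ⟨fun x y => SimpleGraph.ConnectedComponent.exact (supermelon_comp ⟨0, Set.mem_univ _⟩ x y)⟩

theorem supermelon_lineAt (n : Fin 1 ⊕ Fin 1) (v : Fin 4) : supermelon.lineAt n v = (v, 0) :=
  Prod.ext (by simp) (Subsingleton.elim _ _)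

/-- The indicator function of a neighborhood of the unit. -/
noncomputable def nearOne (r : ℝ) : SU2 → ENNReal := {g | defect g ≤ r}.indicator 1

theorem measurableSet_defect_le (r : ℝ) : MeasurableSet {g : SU2 | defect g ≤ r} :=
  (isClosed_le continuous_defect continuous_const).measurableSet

theorem measurable_nearOne (r : ℝ) : Measurable (nearOne r) :=
  measurable_one.indicator (measurableSet_defect_le r)

theorem defect_le_of_nearOne_ne_zero {r : ℝ} {g : SU2} (h : nearOne r g ≠ 0) : defect g ≤ r :=
  Set.mem_of_indicator_ne_zero (s := {g | defect g ≤ r}) h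

theorem lintegral_nearOne (r : ℝ) : ∫⁻ g, nearOne r g = volume {g : SU2 | defect g ≤ r} :=
  lintegral_indicator_one (measurableSet_defect_le r)

section Integral

variable {a b c d : Fin 4}

/-- The three words are independent: for fixed `h` the last two are Haar distributed and independent
in `s`, and the first one is a Haar word in `h`. -/
theorem Frame.lintegral_supermelon (hf : Frame a b c d) {k : SU2 → ENNReal} (hk : Measurable k) :
    ∫⁻ p : (Fin 4 × Fin 1 → SU2) × (Fin 4 × Fin 1 → SU2),
      k (p.1 (b, 0) * (p.1 (c, 0))⁻¹ * p.1 (a, 0) * (p.1 (d, 0))⁻¹) *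
        (k (p.1 (b, 0) * (p.2 (c, 0) * p.2 (d, 0))) * k (p.1 (d, 0) * (p.2 (a, 0) * p.2 (b, 0)))) =
      (∫⁻ g, k g) ^ 3 := by
  rw [Measure.volume_eq_prod, lintegral_prod _ (by fun_prop)]
  have hinner : ∀ h : Fin 4 × Fin 1 → SU2, ∫⁻ s : Fin 4 × Fin 1 → SU2,
      k (h (b, 0) * (s (c, 0) * s (d, 0))) * k (h (d, 0) * (s (a, 0) * s (b, 0))) =
      (∫⁻ g, k g) ^ 2 := by
    intro h
    have := hf.lintegral_prod_cornerFactor supermelon hk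
      (A := {(Sum.inl 0, false), (Sum.inr 0, true)}) (by
        rintro (_ | _) n
        · exact ⟨Sum.inr 0, by simp, supermelon_comp ⟨_, Or.inl rfl⟩ _ _⟩
        · exact ⟨Sum.inl 0, by simp, supermelon_comp ⟨_, Or.inl rfl⟩ _ _⟩) h
    simp only [Finset.prod_pair (show ((Sum.inl 0, false) : (Fin 1 ⊕ Fin 1) × Bool) ≠
      (Sum.inr 0, true) by simp), cornerFactor, cornerWord, cornerColor, supermelon_lineAt] at this
    rw [lintegral_mul_left_eq_self k, lintegral_mul_left_eq_self k, ← sq] at this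
    simpa using this
  have hm : ∀ h : Fin 4 × Fin 1 → SU2, Measurable fun s : Fin 4 × Fin 1 → SU2 =>
      k (h (b, 0) * (s (c, 0) * s (d, 0))) * k (h (d, 0) * (s (a, 0) * s (b, 0))) := by
    intro h; fun_prop
  simp only [lintegral_const_mul _ (hm _), hinner]
  rw [lintegral_mul_const _ (by fun_prop), pow_succ' _ 2]
  have := hf.lintegral_nodeWord supermelon supermelon_connected (A := {Sum.inl 0})
    (n₀ := Sum.inr 0) (by simp) hk
  simp only [Finset.prod_singleton, nodeWord, supermelon_lineAt] at this
  rw [this]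

/-- The arguments of the other two kernels are conjugate to `z * x⁻¹` and `z⁻¹ * y⁻¹`. The radius `α
/ 4` keeps their defects below `α`, by `defect_mul_le`. -/
theorem le_frameIntegrand_supermelon {α : ℝ} (hα : 0 < α) (hα1 : α ≤ 1)
    (p : (Fin 4 × Fin 1 → SU2) × (Fin 4 × Fin 1 → SU2)) :
    ENNReal.ofReal ((1 / 32 * scale α * Real.exp (-5)) ^ 8) *
      (nearOne (α / 4) (p.1 (b, 0) * (p.1 (c, 0))⁻¹ * p.1 (a, 0) * (p.1 (d, 0))⁻¹) *
        (nearOne (α / 4) (p.1 (b, 0) * (p.2 (c, 0) * p.2 (d, 0))) *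
          nearOne (α / 4) (p.1 (d, 0) * (p.2 (a, 0) * p.2 (b, 0))))) ≤
      ENNReal.ofReal (supermelon.frameIntegrand (heatKernel α) a b c d p) := by
  set z := p.1 (b, 0) * (p.1 (c, 0))⁻¹ * p.1 (a, 0) * (p.1 (d, 0))⁻¹ with hz
  set x := p.1 (b, 0) * (p.2 (c, 0) * p.2 (d, 0)) with hx
  set y := p.1 (d, 0) * (p.2 (a, 0) * p.2 (b, 0)) with hy
  by_cases h : defect z ≤ α / 4 ∧ defect x ≤ α / 4 ∧ defect y ≤ α / 4
  · obtain ⟨h1, h2, h3⟩ := h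
    have e1 : nearOne (α / 4) z = 1 := Set.indicator_of_mem (by exact h1) _
    have e2 : nearOne (α / 4) x = 1 := Set.indicator_of_mem (by exact h2) _
    have e3 : nearOne (α / 4) y = 1 := Set.indicator_of_mem (by exact h3) _
    rw [e1, e2, e3, mul_one, mul_one, mul_one]
    refine ENNReal.ofReal_le_ofReal ?_
    have hs := scale_pos hα
    set t := 1 / 32 * scale α * Real.exp (-5) with ht
    have ht0 : 0 < t := by positivity
    have kx : t ≤ heatKernel α x := le_heatKernel hα hα1 (by linarith)
    have ky : t ≤ heatKernel α y := le_heatKernel hα hα1 (by linarith)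
    have kb : t ≤ heatKernel α (p.1 (a, 0) * (p.1 (d, 0))⁻¹ * (p.2 (c, 0) * p.2 (d, 0))⁻¹ *
        (p.1 (c, 0))⁻¹) := by
      refine le_heatKernel hα hα1 ?_
      have e : p.1 (a, 0) * (p.1 (d, 0))⁻¹ * (p.2 (c, 0) * p.2 (d, 0))⁻¹ * (p.1 (c, 0))⁻¹ =
          (p.1 (a, 0) * (p.1 (d, 0))⁻¹ * x⁻¹) * (p.1 (b, 0) * (p.1 (c, 0))⁻¹) := by
        rw [hx]; group
      rw [e, defect_mul_comm, show p.1 (b, 0) * (p.1 (c, 0))⁻¹ *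
        (p.1 (a, 0) * (p.1 (d, 0))⁻¹ * x⁻¹) = z * x⁻¹ by rw [hz]; group]
      have := defect_mul_le z x⁻¹
      rw [defect_inv] at this
      linarith
    have kd : t ≤ heatKernel α (p.1 (c, 0) * (p.1 (b, 0))⁻¹ * (p.2 (a, 0) * p.2 (b, 0))⁻¹ *
        (p.1 (a, 0))⁻¹) := by
      refine le_heatKernel hα hα1 ?_
      have e : p.1 (c, 0) * (p.1 (b, 0))⁻¹ * (p.2 (a, 0) * p.2 (b, 0))⁻¹ * (p.1 (a, 0))⁻¹ =
          (p.1 (c, 0) * (p.1 (b, 0))⁻¹ * y⁻¹) * (p.1 (d, 0) * (p.1 (a, 0))⁻¹) := by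
        rw [hy]; group
      rw [e, defect_mul_comm, show p.1 (d, 0) * (p.1 (a, 0))⁻¹ *
        (p.1 (c, 0) * (p.1 (b, 0))⁻¹ * y⁻¹) = z⁻¹ * y⁻¹ by rw [hz]; group]
      have := defect_mul_le z⁻¹ y⁻¹
      rw [defect_inv, defect_inv] at this
      linarith
    have h4 : t * t * t * t ≤ frameKernel (heatKernel α) a b c d (fun v => p.1 (v, 0))
        fun v => p.2 (v, 0) :=
      mul_le_mul (mul_le_mul (mul_le_mul kx kb ht0.le (ht0.le.trans kx)) ky ht0.le
        (mul_nonneg (ht0.le.trans kx) (ht0.le.trans kb))) kd ht0.le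
        (mul_nonneg (mul_nonneg (ht0.le.trans kx) (ht0.le.trans kb)) (ht0.le.trans ky))
    calc t ^ 8 = (t * t * t * t) * (t * t * t * t) := by ring
      _ ≤ _ := by
        rw [frameIntegrand, Fintype.prod_sum_type, Fin.prod_univ_one, Fin.prod_univ_one]
        simp only [supermelon_lineAt]
        exact mul_le_mul h4 h4 (by positivity) (le_trans (by positivity) h4)
  · have : nearOne (α / 4) z * (nearOne (α / 4) x * nearOne (α / 4) y) = 0 := by
      by_contra h0
      simp only [mul_eq_zero, not_or] at h0
      exact h ⟨defect_le_of_nearOne_ne_zero h0.1, defect_le_of_nearOne_ne_zero h0.2.1,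
        defect_le_of_nearOne_ne_zero h0.2.2⟩
    simp [this]

theorem integrable_frameIntegrand {W B : Type*} [Fintype W] [Fintype B] (G : ColoredGraph W B)
    {α : ℝ} (hα : 0 < α) : Integrable (G.frameIntegrand (heatKernel α) a b c d) := by
  have hk := continuous_heatKernel hα
  have hcont : Continuous (G.frameIntegrand (heatKernel α) a b c d) := by
    unfold frameIntegrand frameKernel
    fun_prop
  exact hcont.integrable_of_hasCompactSupport (HasCompactSupport.of_compactSpace _)

end Integral

/-- Eight kernels of order `scale α` on a region of volume of order `(scale α)⁻³` give the power
five; the normalisation of the two nodes and the rescaling remove three. -/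
theorem two_le_divergenceDegree_supermelon : (2 : EReal) ≤ supermelon.divergenceDegree := by
  obtain ⟨C, hC, hvol⟩ := exists_le_volume_defect
  have hS : (0 : ℝ) < (4 * Real.pi) ^ (3 / 2 : ℝ) := by positivity
  set S := (4 * Real.pi) ^ (3 / 2 : ℝ) with hSdef
  set q := 1 / 32 * Real.exp (-5) with hq
  have hq0 : 0 < q := by positivity
  refine mod_cast supermelon.le_divergenceDegree (β := 2)
    (C := q ^ 8 * (C / 8) ^ 3 * S ^ 3 * (1 / 4) ^ 5) (by positivity) ?_
  filter_upwards [eventually_mem_Ioc] with α hα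
  have hK := heatKernel_one_pos hα.1 hα.2
  have hs := scale_pos hα.1
  have hsK : heatKernel α 1 * (1 / 4) ≤ scale α := by
    linarith [heatKernel_one_le_scale hα.1 hα.2]
  have hscale := scale_mul_sqrt_pow hα.1
  have hr0 := Real.sqrt_nonneg α
  have hr1 : √α ≤ 1 := by simpa using Real.sqrt_le_sqrt hα.2
  have hv : ENNReal.ofReal (C * (√α / 2) ^ 3) ≤ ∫⁻ g, nearOne (α / 4) g := by
    rw [lintegral_nearOne]
    have := hvol (√α / 2) (by positivity) (by linarith)
    rwa [div_pow √α 2 2, Real.sq_sqrt hα.1.le, show (2 : ℝ) ^ 2 = 4 by norm_num] at this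
  have hnn : 0 ≤ᵐ[volume] supermelon.frameIntegrand (heatKernel α) 0 1 2 3 :=
    Eventually.of_forall fun p => by
      rw [frameIntegrand, Fintype.prod_sum_type, Fin.prod_univ_one, Fin.prod_univ_one]
      simp only [supermelon_lineAt]
      exact mul_self_nonneg _
  have hint : (1 / 32 * scale α * Real.exp (-5)) ^ 8 * (C * (√α / 2) ^ 3) ^ 3 ≤
      ∫ p, supermelon.frameIntegrand (heatKernel α) 0 1 2 3 p := by
    rw [← ENNReal.ofReal_le_ofReal_iff (integral_nonneg_of_ae hnn),
      ofReal_integral_eq_lintegral_ofReal (integrable_frameIntegrand _ hα.1) hnn]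
    refine le_trans ?_ (lintegral_mono (le_frameIntegrand_supermelon hα.1 hα.2))
    have hm := measurable_nearOne (α / 4)
    rw [lintegral_const_mul _ (by fun_prop), frame₁.lintegral_supermelon hm,
      ENNReal.ofReal_mul (by positivity), ENNReal.ofReal_pow (by positivity : 0 ≤ C * (√α / 2) ^ 3)]
    gcongr
  rw [rescaledAmplitude_eq _ hK, frame₁.amplitude_eq _ hα.1, Real.rpow_two]
  simp only [Fintype.card_sum, Fintype.card_fin]
  calc q ^ 8 * (C / 8) ^ 3 * S ^ 3 * (1 / 4) ^ 5 * heatKernel α 1 ^ 2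
      = q ^ 8 * (C / 8) ^ 3 * S ^ 3 * (heatKernel α 1 * (1 / 4)) ^ 5 / heatKernel α 1 ^ 3 := by
        field_simp
    _ ≤ q ^ 8 * (C / 8) ^ 3 * S ^ 3 * scale α ^ 5 / heatKernel α 1 ^ 3 := by gcongr
    _ = (1 / 32 * scale α * Real.exp (-5)) ^ 8 * (C * (√α / 2) ^ 3) ^ 3 / heatKernel α 1 ^ 3 := by
        rw [hSdef, ← hscale, hq]; ring
    _ ≤ (∫ p, supermelon.frameIntegrand (heatKernel α) 0 1 2 3 p) / heatKernel α 1 ^ 3 := by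
        gcongr
    _ = _ := by field_simp

end ColoredGraph

namespace ColoredGraph

universe u v

/-! ### The three jackets -/

theorem ColorCycle.apply_ne (σ : ColorCycle) (x : Fin 4) : σ.1 x ≠ x :=
  Equiv.Perm.mem_support.1 (by rw [σ.2.2]; exact Finset.mem_univ x)

theorem ColorCycle.apply_apply_ne (σ : ColorCycle) : σ.1 (σ.1 0) ≠ 0 := fun h => by
  have h' : σ.1 ^ 2 = 1 := σ.2.1.pow_eq_one_iff.2 ⟨0, σ.apply_ne 0, by simpa [sq] using h⟩
  have := orderOf_dvd_of_pow_eq_one h'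
  rw [σ.2.1.orderOf, σ.2.2] at this
  revert this; decide

theorem ColorCycle.cases (σ : ColorCycle) :
    (σ.1 0 = 1 ∧ σ.1 1 = 2 ∧ σ.1 2 = 3 ∧ σ.1 3 = 0) ∨
    (σ.1 0 = 3 ∧ σ.1 1 = 0 ∧ σ.1 2 = 1 ∧ σ.1 3 = 2) ∨
    (σ.1 0 = 1 ∧ σ.1 1 = 3 ∧ σ.1 2 = 0 ∧ σ.1 3 = 2) ∨
    (σ.1 0 = 2 ∧ σ.1 1 = 0 ∧ σ.1 2 = 3 ∧ σ.1 3 = 1) ∨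
    (σ.1 0 = 2 ∧ σ.1 1 = 3 ∧ σ.1 2 = 1 ∧ σ.1 3 = 0) ∨
    (σ.1 0 = 3 ∧ σ.1 1 = 2 ∧ σ.1 2 = 0 ∧ σ.1 3 = 1) := by
  have key : ∀ σ : Equiv.Perm (Fin 4), (∀ x, σ x ≠ x) → σ (σ 0) ≠ 0 →
      (σ 0 = 1 ∧ σ 1 = 2 ∧ σ 2 = 3 ∧ σ 3 = 0) ∨ (σ 0 = 3 ∧ σ 1 = 0 ∧ σ 2 = 1 ∧ σ 3 = 2) ∨
      (σ 0 = 1 ∧ σ 1 = 3 ∧ σ 2 = 0 ∧ σ 3 = 2) ∨ (σ 0 = 2 ∧ σ 1 = 0 ∧ σ 2 = 3 ∧ σ 3 = 1) ∨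
      (σ 0 = 2 ∧ σ 1 = 3 ∧ σ 2 = 1 ∧ σ 3 = 0) ∨ (σ 0 = 3 ∧ σ 1 = 2 ∧ σ 2 = 0 ∧ σ 3 = 1) := by
    decide
  exact key σ.1 σ.apply_ne σ.apply_apply_ne

/-- The color which is two steps away from the first one. -/
def opposite : Jacket → {x : Fin 4 // x ≠ 0} :=
  Quotient.lift (fun σ : ColorCycle => ⟨σ.1 (σ.1 0), σ.apply_apply_ne⟩) (by
    have key : ∀ σ : Equiv.Perm (Fin 4), (∀ x, σ x ≠ x) → σ (σ 0) ≠ 0 →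
        σ (σ 0) = σ⁻¹ (σ⁻¹ 0) := by decide
    rintro σ τ (h | h)
    · simp [h]
    · simpa [h] using key σ.1 σ.apply_ne σ.apply_apply_ne)

/-- Up to inversion, a cyclic order of four colors is determined by the color opposite to `0`. -/
theorem card_jacket : Fintype.card Jacket = 3 := by
  have hbij : Function.Bijective opposite := by
    constructor
    · have key : ∀ σ : Equiv.Perm (Fin 4), (∀ x, σ x ≠ x) → σ (σ 0) ≠ 0 →
          ∀ τ : Equiv.Perm (Fin 4), (∀ x, τ x ≠ x) → σ (σ 0) = τ (τ 0) → τ = σ ∨ τ = σ⁻¹ := by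
        decide
      intro J K
      refine Quotient.inductionOn₂ J K fun σ τ h => Quotient.sound ?_
      exact key σ.1 σ.apply_ne σ.apply_apply_ne τ.1 τ.apply_ne (congrArg Subtype.val h)
    -- Conjugating the standard rotation by the transposition of `2` and `x`, which fixes `0`, makes
    -- `x` opposite to `0`.
    · have key : ∀ x : Fin 4, x ≠ 0 → Equiv.swap 2 x (finRotate 4 ((Equiv.swap 2 x)⁻¹
          (Equiv.swap 2 x (finRotate 4 ((Equiv.swap 2 x)⁻¹ 0))))) = x := by decide
      rintro ⟨x, hx⟩
      refine ⟨⟦⟨Equiv.swap 2 x * finRotate 4 * (Equiv.swap 2 x)⁻¹, isCycle_finRotate.conj, ?_⟩⟧, ?_⟩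
      · rw [Equiv.Perm.support_conj, support_finRotate]
        simp
      · refine Subtype.ext ?_
        change (Equiv.swap 2 x * finRotate 4 * (Equiv.swap 2 x)⁻¹)
          ((Equiv.swap 2 x * finRotate 4 * (Equiv.swap 2 x)⁻¹) 0) = x
        simp only [Equiv.Perm.mul_apply]
        exact key x hx
  rw [Fintype.card_congr (Equiv.ofBijective _ hbij)]
  decide

section Genus

variable {W : Type u} {B : Type v}

/-- A cyclic order omits exactly the pairs of opposite colors, which form one of the three
splittings; the other two remain. -/
theorem jacketVertices_eq (G : ColoredGraph W B) (J : Jacket) :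
    G.jacketVertices J =
      (G.numEdges 0 1 + G.numEdges 2 3) + (G.numEdges 0 3 + G.numEdges 1 2) ∨
    G.jacketVertices J =
      (G.numEdges 0 1 + G.numEdges 2 3) + (G.numEdges 0 2 + G.numEdges 3 1) ∨
    G.jacketVertices J =
      (G.numEdges 0 2 + G.numEdges 3 1) + (G.numEdges 0 3 + G.numEdges 1 2) := by
  refine Quotient.inductionOn J fun σ => ?_
  change (∑ ℓ, G.numEdges ℓ (σ.1 ℓ) = _) ∨ (∑ ℓ, G.numEdges ℓ (σ.1 ℓ) = _) ∨
    (∑ ℓ, G.numEdges ℓ (σ.1 ℓ) = _)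
  rw [Fin.sum_univ_four]
  have h10 := G.numEdges_comm 1 0
  have h20 := G.numEdges_comm 2 0
  have h30 := G.numEdges_comm 3 0
  have h21 := G.numEdges_comm 2 1
  have h31 := G.numEdges_comm 3 1
  have h32 := G.numEdges_comm 3 2
  rcases σ.cases with ⟨h0, h1, h2, h3⟩ | ⟨h0, h1, h2, h3⟩ | ⟨h0, h1, h2, h3⟩ |
    ⟨h0, h1, h2, h3⟩ | ⟨h0, h1, h2, h3⟩ | ⟨h0, h1, h2, h3⟩ <;> rw [h0, h1, h2, h3] <;> omega

variable [Fintype W] [Fintype B]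

theorem two_sub_genus (G : ColoredGraph W B) (J : Jacket) :
    2 - G.genus J = (G.jacketVertices J : ℝ) / 2 + 1 - Fintype.card W := by
  rw [genus, jacketEuler, G.card_nodes]
  simp only [Fintype.card_prod, Fintype.card_fin]
  push_cast
  ring

/-- By `two_sub_genus` the right side is the mean of the exponents of the two splittings in `J`,
hence at least the smaller of them. -/
theorem divergenceDegree_le_two_sub_genus (G : ColoredGraph W B) (hG : G.Connected) (J : Jacket) :
    G.divergenceDegree ≤ ((2 - G.genus J : ℝ) : EReal) := by
  have key : ∀ x y w : ℝ, G.divergenceDegree ≤ ((x + 1 - w : ℝ) : EReal) →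
      G.divergenceDegree ≤ ((y + 1 - w : ℝ) : EReal) →
      G.divergenceDegree ≤ (((x + y) / 2 + 1 - w : ℝ) : EReal) := by
    intro x y w hx hy
    rcases le_total x y with h | h
    · exact hx.trans (EReal.coe_le_coe_iff.2 (by linarith))
    · exact hy.trans (EReal.coe_le_coe_iff.2 (by linarith))
  have h1 := frame₁.divergenceDegree_le G hG
  have h2 := frame₂.divergenceDegree_le G hG
  have h3 := frame₃.divergenceDegree_le G hG
  rw [two_sub_genus]
  rcases G.jacketVertices_eq J with h | h | h <;> rw [h] <;> push_cast
  exacts [key _ _ _ h1 h3, key _ _ _ h1 h2, key _ _ _ h2 h3]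

/-- Comparison with the supermelon makes all three exponents at least `2`; adding the three
inequalities gives the extremal number of faces. The genera are not needed here. -/
theorem IsLeadingOrder.isMelonic {G : ColoredGraph W B} (h : G.IsLeadingOrder) : G.IsMelonic := by
  have hG := h.1
  have h2 := two_le_divergenceDegree_supermelon.trans (h.2 1 supermelon supermelon_connected)
  have key : ∀ x w : ℕ, G.divergenceDegree ≤ ((x + 1 - w : ℝ) : EReal) → w + 1 ≤ x := by
    intro x w hx
    have h3 : ((2 : ℝ) : EReal) ≤ G.divergenceDegree := by exact_mod_cast h2
    have h4 := EReal.coe_le_coe_iff.1 (h3.trans hx)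
    have : (w : ℝ) + 1 ≤ x := by linarith
    exact_mod_cast this
  have h1 := key (G.numEdges 0 1 + G.numEdges 2 3) (Fintype.card W)
    (by push_cast; exact frame₁.divergenceDegree_le G hG)
  have h2 := key (G.numEdges 0 2 + G.numEdges 3 1) (Fintype.card W)
    (by push_cast; exact frame₂.divergenceDegree_le G hG)
  have h3 := key (G.numEdges 0 3 + G.numEdges 1 2) (Fintype.card W)
    (by push_cast; exact frame₃.divergenceDegree_le G hG)
  refine isMelonic_of_faceCount _ W B G rfl hG ?_
  rw [Nat.card_eq_fintype_card, G.faceCount_eq (i := 0) (j := 1) (k := 2) (l := 3) (by decide)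
    (by decide) (by decide) (by decide) (by decide) (by decide)]
  have e : ∀ {a b c d : Fin 4}, Frame a b c d → G.numEdges a b = G.numComp {c, d} :=
    fun hf => by rw [← hf.compl_eq]; rfl
  have h31 : G.numComp {3, 1} = G.numComp {1, 3} := by rw [Set.pair_comm]
  rw [e frame₁, e frame₁.swap] at h1
  rw [e frame₂, e frame₂.swap] at h2
  rw [e frame₃, e frame₃.swap] at h3
  omega

end Genus

end ColoredGraph

/-! ### The proposition -/

theorem mainTheorem8 {W : Type*} {B : Type*} [Fintype W] [Fintype B]
    (G : ColoredGraph W B) (hG : G.Connected) :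
    (∀ J : ColoredGraph.Jacket, G.divergenceDegree ≤ ((2 - G.genus J : ℝ) : EReal)) ∧
    G.divergenceDegree ≤ ((2 - ⨆ J : ColoredGraph.Jacket, G.genus J : ℝ) : EReal) ∧
    2 - (⨆ J : ColoredGraph.Jacket, G.genus J) ≤
      2 - 1 / 3 * ∑ J : ColoredGraph.Jacket, G.genus J ∧
    G.divergenceDegree ≤
      ((2 - 1 / 3 * ∑ J : ColoredGraph.Jacket, G.genus J : ℝ) : EReal) ∧
    (G.IsLeadingOrder → G.IsSpherical ∧ G.IsMelonic) := by
  have h1 := G.divergenceDegree_le_two_sub_genus hG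
  have : Nonempty ColoredGraph.Jacket :=
    Fintype.card_pos_iff.1 (by rw [ColoredGraph.card_jacket]; norm_num)
  have h2 : G.divergenceDegree ≤ ((2 - ⨆ J : ColoredGraph.Jacket, G.genus J : ℝ) : EReal) := by
    -- There are finitely many jackets, so the supremum is attained and the bound of that jacket
    -- applies.
    obtain ⟨J, hJ⟩ := exists_eq_ciSup_of_finite (f := G.genus)
    rw [← hJ]
    exact h1 J
  have h3 : 2 - (⨆ J : ColoredGraph.Jacket, G.genus J) ≤
      2 - 1 / 3 * ∑ J : ColoredGraph.Jacket, G.genus J := by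
    have := Finset.sum_le_card_nsmul Finset.univ G.genus (⨆ J, G.genus J)
      fun J _ => le_ciSup (Set.finite_range _).bddAbove J
    rw [Finset.card_univ, ColoredGraph.card_jacket, nsmul_eq_mul] at this
    push_cast at this
    linarith
  exact ⟨h1, h2, h3, h2.trans (EReal.coe_le_coe_iff.2 h3),
    fun h => ⟨h.isMelonic.isSpherical.2.2, h.isMelonic⟩⟩
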